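/- Let $q\ge 5$ be a prime power. In $\mathrm{PG}(3,q)$ let $\mathscr C=\{P(t): t\in\mathbb F_q\cup\{\infty\}\}$ be the twisted cubic, with $P(t)=(1,t,t^2,t^3)$ for $t\in\mathbb F_q$ and $P(\infty)=(0,0,0,1)$. Let $G_q$ be the group of projectivities of $\mathrm{PG}(3,q)$ that map $\mathscr C$ onto itself. The osculating plane at $P(t)$ is $-t^3x_0+3t^2x_1-3tx_2+x_3=0$ for $t\in\mathbb F_q$, and $x_0=0$ for $t=\infty$. The tangent at $P(t)$ is the line through $P(t)$ and $(0,1,2t,3t^2)$ for $t\in\mathbb F_q$, and the line through $(0,0,0,1)$ and $(0,0,1,0)$ for $t=\infty$. A real chord is a line through two distinct points of $\mathscr C$. An imaginary chord is a line of $\mathrm{PG}(3,q)$ through $P(\theta)$ and $P(\theta^q)$ for some $\theta\in\mathbb F_{q^2}\setminus\mathbb F_q$, where $P(\theta)=(1,\theta,\theta^2,\theta^3)$. Points off $\mathscr C$ are named as follows. A $\mu_\Gamma$-point is a point off $\mathscr C$ on exactly $\mu$ osculating planes. An RC-point is a point off $\mathscr C$ on a real chord, and an IC-point is a point on an imaginary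 chord. For $q\not\equiv0\pmod 3$, a T-point is a point off $\mathscr C$ on a tangent. For $q\equiv 0\pmod 3$, a TO-point is a point off $\mathscr C$ on a tangent and on exactly one osculating plane. Put - if $q\not\equiv0\pmod 3$: $\mathscr M_1=\mathscr C$, $\mathscr M_2=\{\text{T-points}\}$, $\mathscr M_3=\{3_\Gamma\text{-points}\}$, $\mathscr M_4=\{1_\Gamma\text{-points}\}$, $\mathscr M_5=\{0_\Gamma\text{-points}\}$; - if $q\equiv0\pmod 3$: $\mathscr M_1=\mathscr C$, $\mathscr M_2=\{(q+1)_\Gamma\text{-points}\}$, $\mathscr M_3=\{\text{TO-points}\}$, $\mathscr M_4=\{\text{RC-points}\}$, $\mathscr M_5=\{\text{IC-points}\}$. For a point $P$ let $r(P)$ be the number of planes through $P$ that contain exactly three points of $\mathscr C$. Let $H$ be any $4\times(q+1)$ matrix over $\mathbb F_q$ whose columns are the points of $\mathscr C$, each listed once, in any order and with any choice of homogeneous coordinates. Let $\mathcal C=\{x\in\mathbb F_q^{q+1}: Hx^{tr}=0\}$. The weight of a coset $\mathcal V$ of $\mathcal C$ is the least Hamming weight of a vector of $\mathcal V$, its syndrome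 is $Hx^{tr}$ for any $x\in\mathcal V$, and $B_3(\mathcal V)$ is the number of vectors of weight 3 in $\mathcal V$. A coset is generated by a set $S$ of points if its syndrome is a vector of homogeneous coordinates of a point of $S$. Then: 1. $\mathcal C$ is a $[q+1,q-3,5]_q3$ code (length $q+1$, dimension $q-3$, minimum distance $5$, covering radius $3$). 2. The sets $\mathscr M_1,\dots,\mathscr M_5$ are orbits of $G_q$ and partition the points of $\mathrm{PG}(3,q)$. Every coset other than $\mathcal C$ is generated by exactly one of them. 3. $\mathcal C$ is the only coset of weight $0$, and $B_3(\mathcal C)=0$. There are $(q+1)(q-1)$ cosets generated by $\mathscr M_1=\mathscr C$, and each has weight $1$ and $B_3=0$. 4. The remaining cosets $\mathcal V$ are given by the following table. For each generating set, all cosets generated by it have the stated weight and value of $B_3$, their number is as stated, and the last column expresses $B_3(\mathcal V)$ through the number $r=r(P)$ for the point $P$ represented by the syndrome of $\mathcal V$. $$\begin{array}{c|c|c|c|c|c} q \bmod 3&\text{weight}&B_3(\mathcal V)&\text{number of cosets}&\text{generating set}&B_3(\mathcal V)\\\hline 1&2&\frac16(q^2-5q+4)&\frac13(q^3-q)(q-1)&\mathscr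 M_5=\{\text{RC-points}\}\setminus\mathscr M_3&r-(q-1)\\ 1&2&\frac16(q^2-5q+10)&\frac16(q^3-q)(q-1)&\mathscr M_3=\{\text{RC-points}\}\setminus\mathscr M_5&r-(q-1)\\ 1&3&\frac16(q^2-3q+2)&(q^2+q)(q-1)&\mathscr M_2=\{\text{T-points}\}&r\\ 1&3&\frac16(q^2-q)&\frac12(q^3-q)(q-1)&\mathscr M_4=\{\text{IC-points}\}&r\\\hline -1&2&\frac16(q^2-5q+6)&\frac12(q^3-q)(q-1)&\mathscr M_4=\{\text{RC-points}\}&r-(q-1)\\ -1&3&\frac16(q^2-3q+2)&(q^2+q)(q-1)&\mathscr M_2=\{\text{T-points}\}&r\\ -1&3&\frac16(q^2-q-2)&\frac13(q^3-q)(q-1)&\mathscr M_5=\{\text{IC-points}\}\setminus\mathscr M_3&r\\ -1&3&\frac16(q^2-q+4)&\frac16(q^3-q)(q-1)&\mathscr M_3=\{\text{IC-points}\}\setminus\mathscr M_5&r\\\hline 0&2&\frac16(q^2-5q+6)&\frac12(q^3-q)(q-1)&\mathscr M_4=\{\text{RC-points}\}&r-(q-1)\\ 0&3&\frac16(q^2-3q)&(q^2-1)(q-1)&\mathscr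 M_3=\{\text{TO-points}\}&r\\ 0&3&\frac16(q^2-q)&\frac12(q+1)(q^2-q+2)(q-1)&\mathscr M_2\cup\mathscr M_5=\{(q+1)_\Gamma\text{-points}\}\cup\{\text{IC-points}\}&r \end{array}$$ The equalities of point sets in the fifth column are part of the claim. -/

import Mathlib

open scoped LinearAlgebra.Projectivization

namespace TwistedCubic

/-! ### The twisted cubic in `PG(3,q)` and its osculating planes, chords and tangents

Points of `PG(3,q)` are the elements of `ℙ F (Fin 4 → F)`; lines and planes are the
subspaces of `Fin 4 → F` of dimension 2 and 3, a point `P` lying on `L` when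
`P.submodule ≤ L`. The parameter set `F ∪ {∞}` is `Option F`, with `none` as `∞`. -/

/-- Homogeneous coordinates of `P(t)`: `(1, t, t², t³)` for `t ∈ K`, and `(0,0,0,1)` for `t = ∞`. -/
def cubicVec {K : Type*} [Field K] : Option K → Fin 4 → K
  | some t => ![1, t, t ^ 2, t ^ 3]
  | none => ![0, 0, 0, 1]

theorem cubicVec_ne_zero {K : Type*} [Field K] (t : Option K) : cubicVec t ≠ 0 := by
  cases t with
  | none => intro h; simpa [cubicVec] using congrFun h 3
  | some t => intro h; simpa [cubicVec] using congrFun h 0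

/-- The point `P(t)` of `PG(3,q)`. -/
def cubicPoint {F : Type*} [Field F] (t : Option F) : ℙ F (Fin 4 → F) :=
  Projectivization.mk F (cubicVec t) (cubicVec_ne_zero t)

/-- The twisted cubic `𝒞 = {P(t) : t ∈ F ∪ {∞}}`. -/
def cubic (F : Type*) [Field F] : Set (ℙ F (Fin 4 → F)) :=
  Set.range cubicPoint

/-- The group `G_q` of the projectivities of `PG(3,q)` that fix the cubic as a set: permutations
of the points that are induced by an invertible linear map and map the cubic onto itself. -/
def cubicGroup (F : Type*) [Field F] : Subgroup (Equiv.Perm (ℙ F (Fin 4 → F))) where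
  carrier := {σ | (∃ g : (Fin 4 → F) ≃ₗ[F] (Fin 4 → F), ∀ P, σ P = g • P) ∧
    σ '' cubic F = cubic F}
  one_mem' := ⟨⟨1, fun P => (one_smul _ P).symm⟩, by simp⟩
  mul_mem' := by
    rintro σ τ ⟨⟨g, hg⟩, hσ⟩ ⟨⟨h, hh⟩, hτ⟩
    refine ⟨⟨g * h, fun P => ?_⟩, ?_⟩
    · rw [Equiv.Perm.mul_apply, hh, hg, mul_smul]
    · rw [Equiv.Perm.coe_mul, Set.image_comp, hτ, hσ]
  inv_mem' := by
    rintro σ ⟨⟨g, hg⟩, hσ⟩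
    refine ⟨⟨g⁻¹, fun P => ?_⟩, ?_⟩
    · rw [Equiv.Perm.inv_eq_iff_eq, hg, smul_inv_smul]
    · nth_rewrite 1 [← hσ]
      rw [← Set.image_comp, ← Equiv.Perm.coe_mul, inv_mul_cancel]
      simp

/-- `S` is an orbit of points under `G_q`. -/
def IsPointOrbit {F : Type*} [Field F] (S : Set (ℙ F (Fin 4 → F))) : Prop :=
  ∃ P : ℙ F (Fin 4 → F), S = MulAction.orbit (cubicGroup F) P

/-- The plane `π(c₀,c₁,c₂,c₃)` with equation `c₀x₀ + c₁x₁ + c₂x₂ + c₃x₃ = 0`. -/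
def planeOf {F : Type*} [Field F] (c : Fin 4 → F) : Submodule F (Fin 4 → F) :=
  LinearMap.ker (Fintype.linearCombination F c)

theorem mem_planeOf {F : Type*} [Field F] (c x : Fin 4 → F) :
    x ∈ planeOf c ↔ c 0 * x 0 + c 1 * x 1 + c 2 * x 2 + c 3 * x 3 = 0 := by
  simp [planeOf, Fintype.linearCombination_apply, Fin.sum_univ_four, mul_comm]

/-- The osculating plane at `P(t)`. -/
def osculatingPlane {F : Type*} [Field F] : Option F → Submodule F (Fin 4 → F)
  | some t => planeOf ![-t ^ 3, 3 * t ^ 2, -(3 * t), 1]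
  | none => planeOf ![1, 0, 0, 0]

/-- The tangent to the cubic at `P(t)`. -/
def tangentLine {F : Type*} [Field F] : Option F → Submodule F (Fin 4 → F)
  | some t => Submodule.span F {![1, t, t ^ 2, t ^ 3], ![0, 1, 2 * t, 3 * t ^ 2]}
  | none => Submodule.span F {![0, 0, 0, 1], ![0, 0, 1, 0]}

/-- A real chord: the line through two distinct points of the cubic. -/
def IsRealChord {F : Type*} [Field F] (L : Submodule F (Fin 4 → F)) : Prop :=
  ∃ P ∈ cubic F, ∃ Q ∈ cubic F, P ≠ Q ∧ L = P.submodule ⊔ Q.submodule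

/-- An imaginary chord: a line of `PG(3,q)` through two conjugate points `P(θ)`, `P(θ^q)` of the
cubic, where `θ ∈ F_{q²} ∖ F_q`. Here `F_{q²}` is the set of `θ` with `θ^(q²) = θ` in the algebraic
closure of `F = F_q`. -/
def IsImaginaryChord {F : Type*} [Field F] (L : Submodule F (Fin 4 → F)) : Prop :=
  Module.finrank F L = 2 ∧
  ∃ θ : AlgebraicClosure F, θ ^ (Nat.card F ^ 2) = θ ∧
    θ ∉ Set.range (algebraMap F (AlgebraicClosure F)) ∧
    ∀ x ∈ L, (fun i => algebraMap F (AlgebraicClosure F) (x i)) ∈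
      Submodule.span (AlgebraicClosure F)
        {cubicVec (some θ), cubicVec (some (θ ^ Nat.card F))}

/-! ### Types of points -/

/-- The number of osculating planes through `P`. -/
noncomputable def osculatingCount {F : Type*} [Field F] (P : ℙ F (Fin 4 → F)) : ℕ :=
  {π : Submodule F (Fin 4 → F) | π ∈ Set.range osculatingPlane ∧ P.submodule ≤ π}.ncard

/-- `μ_Γ`-points: points off the cubic lying on exactly `μ` osculating planes. -/
def gammaPoints (F : Type*) [Field F] (μ : ℕ) : Set (ℙ F (Fin 4 → F)) :=
  {P | P ∉ cubic F ∧ osculatingCount P = μ}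

/-- Points off the cubic lying on a tangent (the T-points, when `q ≢ 0 mod 3`). -/
def tangentPoints (F : Type*) [Field F] : Set (ℙ F (Fin 4 → F)) :=
  {P | P ∉ cubic F ∧ ∃ t : Option F, P.submodule ≤ tangentLine t}

/-- TO-points: points off the cubic lying on a tangent and on exactly one osculating plane. -/
def toPoints (F : Type*) [Field F] : Set (ℙ F (Fin 4 → F)) :=
  {P | P ∈ tangentPoints F ∧ osculatingCount P = 1}

/-- RC-points: points off the cubic lying on a real chord. -/
def rcPoints (F : Type*) [Field F] : Set (ℙ F (Fin 4 → F)) :=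
  {P | P ∉ cubic F ∧ ∃ L, IsRealChord L ∧ P.submodule ≤ L}

/-- IC-points: points lying on an imaginary chord. -/
def icPoints (F : Type*) [Field F] : Set (ℙ F (Fin 4 → F)) :=
  {P | ∃ L, IsImaginaryChord L ∧ P.submodule ≤ L}

/-- The number of `3_𝒞`-planes (planes containing exactly three points of the cubic) through `P`;
its constant value on the orbit `ℳ_j` is `r_{3j}`. -/
noncomputable def threePlaneCount {F : Type*} [Field F] (P : ℙ F (Fin 4 → F)) : ℕ :=
  {π : Submodule F (Fin 4 → F) | Module.finrank F π = 3 ∧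
    {Q : ℙ F (Fin 4 → F) | Q ∈ cubic F ∧ Q.submodule ≤ π}.ncard = 3 ∧ P.submodule ≤ π}.ncard

/-! ### Linear codes and their cosets -/

/-- A parity check matrix of the code associated with the cubic. Its columns are the points of the
cubic in homogeneous coordinates: `e` is the order in which they are listed and `v` is the choice
of the nonzero multipliers. -/
def cubicParityCheck {F : Type*} [Field F] {n : ℕ} (e : Fin n ≃ Option F) (v : Fin n → Fˣ) :
    Matrix (Fin 4) (Fin n) F :=
  Matrix.of fun i j => (v j : F) * cubicVec (e j) i

/-- The linear code with parity check matrix `H`. -/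
def codeOf {F : Type*} [Field F] {m n : ℕ} (H : Matrix (Fin m) (Fin n) F) :
    Submodule F (Fin n → F) :=
  LinearMap.ker H.mulVecLin

/-- `d` is the minimum distance of the linear code `C`. -/
def IsMinDist {F : Type*} [Field F] [DecidableEq F] {n : ℕ} (C : Submodule F (Fin n → F))
    (d : ℕ) : Prop :=
  IsLeast {w : ℕ | ∃ c ∈ C, c ≠ 0 ∧ hammingNorm c = w} d

/-- `B_w(V)`: the number of weight `w` vectors in the coset `V`. -/
noncomputable def weightCount {F : Type*} [Field F] [DecidableEq F] {n : ℕ}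
    {C : Submodule F (Fin n → F)} (w : ℕ) (V : (Fin n → F) ⧸ C) : ℕ :=
  {x : Fin n → F | C.mkQ x = V ∧ hammingNorm x = w}.ncard

/-- The weight of a coset: the smallest Hamming weight of a vector in it. -/
noncomputable def cosetWeight {F : Type*} [Field F] [DecidableEq F] {n : ℕ}
    {C : Submodule F (Fin n → F)} (V : (Fin n → F) ⧸ C) : ℕ :=
  sInf {w : ℕ | ∃ x : Fin n → F, C.mkQ x = V ∧ hammingNorm x = w}

/-- The covering radius of a code: the maximum weight of a coset. -/
def IsCoveringRadius {F : Type*} [Field F] [DecidableEq F] {n : ℕ} (C : Submodule F (Fin n → F))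
    (R : ℕ) : Prop :=
  IsGreatest (Set.range fun V : (Fin n → F) ⧸ C => cosetWeight V) R

/-- The syndrome of a coset: the common value of `H x` over the vectors `x` of the coset. -/
def syndrome {F : Type*} [Field F] {m n : ℕ} (H : Matrix (Fin m) (Fin n) F)
    (V : (Fin n → F) ⧸ codeOf H) : Fin m → F :=
  (codeOf H).liftQ H.mulVecLin le_rfl V

/-- The cosets generated by the set `S` of points: those whose syndrome is nonzero and is a vector
of homogeneous coordinates of a point of `S`. -/
def cosetsOver {F : Type*} [Field F] {n : ℕ} (H : Matrix (Fin 4) (Fin n) F)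
    (S : Set (ℙ F (Fin 4 → F))) : Set ((Fin n → F) ⧸ codeOf H) :=
  {V | ∃ h : syndrome H V ≠ 0, Projectivization.mk F (syndrome H V) h ∈ S}

/-- One type of cosets: there are exactly `N` cosets generated by `S`, and each of them has
weight `W` and contains exactly `B` vectors of weight 3. -/
def TableRow {F : Type*} [Field F] [DecidableEq F] {n : ℕ} (H : Matrix (Fin 4) (Fin n) F)
    (S : Set (ℙ F (Fin 4 → F))) (W : ℕ) (B N : ℚ) : Prop :=
  ((cosetsOver H S).ncard : ℚ) = N ∧
  ∀ V ∈ cosetsOver H S, cosetWeight V = W ∧ (weightCount 3 V : ℚ) = B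

/-- Relation with plane counts: if the syndrome of the coset `V` is a point `P ∈ S`, then
`B_3(V)` is the number of `3_𝒞`-planes through `P` minus `δ`. -/
def PlaneColumn {F : Type*} [Field F] [DecidableEq F] {n : ℕ} (H : Matrix (Fin 4) (Fin n) F)
    (S : Set (ℙ F (Fin 4 → F))) (δ : ℚ) : Prop :=
  ∀ P ∈ S, ∀ V ∈ cosetsOver H {P}, (weightCount 3 V : ℚ) = (threePlaneCount P : ℚ) - δ

/-- The point sets `ℳ_1, …, ℳ_5` (indexed from 0) for the field with `q` elements. -/
def pointClass (F : Type*) [Field F] (q : ℕ) : Fin 5 → Set (ℙ F (Fin 4 → F)) :=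
  if q % 3 = 0 then
    ![cubic F, gammaPoints F (q + 1), toPoints F, rcPoints F, icPoints F]
  else
    ![cubic F, tangentPoints F, gammaPoints F 3, gammaPoints F 1, gammaPoints F 0]

end TwistedCubic

set_option linter.unusedSectionVars false

/-! A vector `x` defines a symmetric trilinear form `polar x` on the plane of homogeneous
parameters, the polarization of a binary cubic form. Its vanishing at three parameters, `Rel x s t
u`, encodes all the incidences needed: for distinct parameters, `x` lies on the plane through three
points of the cubic; for three equal ones, on an osculating plane; and if the relation holds for all
`u`, `x` lies on the chord of `s` and `t`, or on the tangent when `s = t`.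

With two arguments fixed, the form is linear in the third, so it has one projective zero or
vanishes. This property alone (`IsPolarity`) yields `6 r = q^2 - q - 2 + 2 osc + q (chord - 2 tan)`,
where `osc` and `tan` count osculating planes and tangents through the point and `chord` is twice
the number of real chords. Off the cubic, vectors of weight 3 with syndrome `x` correspond to the
three-point planes through `x` that contain no real chord through `x`; a point on a real chord
therefore loses `q - 1` planes.

A point off the cubic lies on exactly one tangent, real chord or imaginary chord: its coordinates
satisfy a binary linear recurrence, and the factorization of the characteristic polynomial decides
which. Only `osc` remains to be found. If 3 does not divide `q`, it is at most 3, and the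
integrality of `r` fixes it modulo 3 (`oscNum_values`). In characteristic 3 the osculating planes
are `x_3 = t^3 x_0` and `x_0 = 0`, and bijectivity of cubing leaves only 1 and `q + 1`
(`class_cases_zero`). The sizes of the classes follow by double counting.

For orbits, transitivity comes from the third symmetric power of GL_2, by 3-transitivity on the
parameters and, for points tied to irreducible polynomials, by comparing roots in a common extension
field. Invariance does not use the structure of the group of the cubic: a projectivity preserving
the cubic preserves `r`, whose values separate the classes (`isInvariant_of_signature`). The
exception is characteristic 3, where the `(q+1)_Γ`-points and the IC-points have equal `r`;
`isolatedPoints` separates them.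

For the code, cosets correspond bijectively to syndromes, so a row of the table concerns the vectors
representing one class of points. -/

namespace TwistedCubic

/-! ### Symmetric ternary relations of the type `trilinear form = 0` -/

/-- A symmetric ternary relation such that `R s t` has exactly one solution or is always true. -/
structure IsPolarity {X : Type*} (R : X → X → X → Prop) : Prop where
  left : ∀ {s t u}, R s t u → R t s u
  right : ∀ {s t u}, R s t u → R s u t
  exists_rel : ∀ s t, ∃ u, R s t u
  all_of_two : ∀ {s t u v}, R s t u → R s t v → u ≠ v → ∀ w, R s t w

namespace IsPolarity

variable {X : Type*} {R : X → X → X → Prop}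

theorem all_symm (h : IsPolarity R) {s t : X} (hD : ∀ u, R s t u) (u : X) : R t s u :=
  h.left (hD u)

/-- Each pair `(s, u)` has the two distinct solutions `t` and `t'`, so it is related to everything.
-/
theorem all_of_all_of_all (h : IsPolarity R) {s t t' : X} (hD : ∀ u, R s t u)
    (hD' : ∀ u, R s t' u) (ht : t ≠ t') (u w : X) : R s u w :=
  h.all_of_two (h.right (hD u)) (h.right (hD' u)) ht w

/-- The pair `(s, s')` has the two solutions `t` and `t'`, so it is total; together with the total
pair `(s, t)` this makes everything related to `s`. Geometrically, two disjoint chords or tangents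
can only meet on the cubic. -/
theorem all_of_disjoint (h : IsPolarity R) {s t s' t' : X} (hD : ∀ u, R s t u)
    (hD' : ∀ u, R s' t' u) (htt : t ≠ t') (hts : t ≠ s') (u w : X) : R s u w :=
  h.all_of_all_of_all hD
    (h.all_of_two (h.right (hD s')) (h.left (h.right (hD' s))) htt) hts u w

variable [Fintype X]

-- A pair that is not total has a single solution, which is lost when it equals `s` or `t`, that is,
-- when `R s s t` or `R t t s`. For a total pair `q + 1 - 2` solutions remain while both indicators
-- are 1, hence the correction `q`.
open Classical in
theorem sum_third (h : IsPolarity R) {q : ℤ} (hX : (Fintype.card X : ℤ) = q + 1) {s t : X}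
    (hst : s ≠ t) :
    (∑ u, if s ≠ u ∧ t ≠ u ∧ R s t u then 1 else 0 : ℤ) =
      1 - (if R s s t then 1 else 0) - (if R t t s then 1 else 0) +
        q * (if ∀ u, R s t u then 1 else 0) := by
  by_cases hD : ∀ u, R s t u
  · have h1 : R s s t := h.right (hD s)
    have h2 : R t t s := h.right (h.left (hD t))
    rw [if_pos hD, if_pos h1, if_pos h2]
    have : ∀ u, (s ≠ u ∧ t ≠ u ∧ R s t u) ↔ u ∈ (Finset.univ \ {s, t} : Finset X) := by
      intro u
      simp [hD u, eq_comm]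
    simp only [this]
    rw [Finset.sum_boole, Finset.filter_mem_eq_inter, Finset.univ_inter]
    have hc := Finset.card_sdiff_add_card_eq_card (Finset.subset_univ ({s, t} : Finset X))
    rw [Finset.card_pair hst, Finset.card_univ] at hc
    have : (((Finset.univ \ {s, t} : Finset X).card : ℤ)) + 2 = q + 1 := by
      rw [← hX]; exact_mod_cast hc
    linarith
  · obtain ⟨u0, h0⟩ := h.exists_rel s t
    have hu : ∀ u, R s t u ↔ u = u0 := fun u =>
      ⟨fun hu => by_contra fun hne => hD (h.all_of_two hu h0 hne), fun e => e ▸ h0⟩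
    have h1 : R s s t ↔ s = u0 := by
      rw [← hu]; exact ⟨h.right, h.right⟩
    have h2 : R t t s ↔ t = u0 := by
      rw [← hu]; exact ⟨fun k => h.left (h.right k), fun k => h.right (h.left k)⟩
    rw [if_neg hD]
    simp only [h1, h2, hu]
    have : ∀ u, (s ≠ u ∧ t ≠ u ∧ u = u0) ↔ (u = u0 ∧ (s ≠ u0 ∧ t ≠ u0)) := by
      intro u
      constructor
      · rintro ⟨a, b, rfl⟩; exact ⟨rfl, a, b⟩
      · rintro ⟨rfl, a, b⟩; exact ⟨a, b, rfl⟩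
    simp only [this, ite_and, Finset.sum_ite_eq', Finset.mem_univ, if_true]
    by_cases e1 : s = u0
    · have e2 : t ≠ u0 := fun e2 => hst (e1.trans e2.symm)
      simp [e1, e2]
    · by_cases e2 : t = u0
      · simp [e1, e2]
      · simp [e1, e2]

open Classical in
theorem sum_second (h : IsPolarity R) {q : ℤ} (hX : (Fintype.card X : ℤ) = q + 1) (s : X) :
    (∑ t, if s ≠ t ∧ R s s t then 1 else 0 : ℤ) =
      1 - (if R s s s then 1 else 0) + q * (if ∀ u, R s s u then 1 else 0) := by
  have key : (∑ t, if R s s t then 1 else 0 : ℤ) =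
      1 + q * (if ∀ u, R s s u then 1 else 0) := by
    by_cases hD : ∀ u, R s s u
    · simp [hD, hX]; ring
    · obtain ⟨u0, h0⟩ := h.exists_rel s s
      have hu : ∀ u, R s s u ↔ u = u0 := fun u =>
        ⟨fun hu => by_contra fun hne => hD (h.all_of_two hu h0 hne), fun e => e ▸ h0⟩
      rw [if_neg hD]
      simp [hu]
  have split : (∑ t, if R s s t then 1 else 0 : ℤ) =
      (∑ t, if s ≠ t ∧ R s s t then 1 else 0) + (if R s s s then 1 else 0) := by
    have : (if R s s s then 1 else 0 : ℤ) =
        ∑ t, if t = s then (if R s s t then 1 else 0) else 0 := by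
      simp
    rw [this, ← Finset.sum_add_distrib]
    refine Finset.sum_congr rfl fun t _ => ?_
    by_cases e : t = s
    · subst e; simp
    · simp [e, Ne.symm e]
  linarith

open Classical in
/-- The number of ordered triples of distinct elements in relation. -/
theorem sum_distinct (h : IsPolarity R) {q : ℤ} (hX : (Fintype.card X : ℤ) = q + 1) :
    (∑ s, ∑ t, ∑ u, if s ≠ t ∧ s ≠ u ∧ t ≠ u ∧ R s t u then 1 else 0 : ℤ) =
      q ^ 2 - q - 2 + 2 * (∑ s, if R s s s then 1 else 0) +
        q * ((∑ s, ∑ t, if s ≠ t ∧ ∀ u, R s t u then 1 else 0) -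
          2 * ∑ s, if ∀ u, R s s u then 1 else 0) := by
  have h1 : ∀ s t, (∑ u, if s ≠ t ∧ s ≠ u ∧ t ≠ u ∧ R s t u then 1 else 0 : ℤ) =
      (if s ≠ t then 1 else 0) - (if s ≠ t ∧ R s s t then 1 else 0)
        - (if t ≠ s ∧ R t t s then 1 else 0)
        + q * (if s ≠ t ∧ ∀ u, R s t u then 1 else 0) := by
    intro s t
    by_cases e : s = t
    · subst e; simp
    · have := h.sum_third hX e
      simpa [e, Ne.symm e] using this
  have h2 : (∑ s : X, ∑ t : X, if s ≠ t then 1 else 0 : ℤ) = (q + 1) * q := by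
    have : ∀ s : X, (∑ t : X, if s ≠ t then 1 else 0 : ℤ) = q := by
      intro s
      rw [Finset.sum_boole, Finset.filter_ne, Finset.card_erase_of_mem (Finset.mem_univ _),
        Finset.card_univ, Nat.cast_sub (Fintype.card_pos_iff.mpr ⟨s⟩), hX]
      simp
    simp only [this]
    simp [hX]
  have h3 : (∑ s, ∑ t, if s ≠ t ∧ R s s t then 1 else 0 : ℤ) =
      (q + 1) - (∑ s, if R s s s then 1 else 0) + q * ∑ s, if ∀ u, R s s u then 1 else 0 := by
    simp only [h.sum_second hX, Finset.sum_add_distrib, Finset.sum_sub_distrib, Finset.mul_sum]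
    simp [hX]
  have h4 : (∑ s, ∑ t, if t ≠ s ∧ R t t s then 1 else 0 : ℤ) =
      ∑ s, ∑ t, if s ≠ t ∧ R s s t then 1 else 0 := Finset.sum_comm
  simp only [h1, Finset.sum_add_distrib, Finset.sum_sub_distrib, ← Finset.mul_sum]
  rw [h4, h2, h3]
  ring

open Classical in
/-- The number of ordered triples of distinct elements in relation, none of whose pairs is in
relation with everything. -/
theorem sum_distinct_proper (h : IsPolarity R) (hnd : ∀ s, ¬ ∀ t u, R s t u)
    {q : ℤ} (hX : (Fintype.card X : ℤ) = q + 1) :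
    (∑ s, ∑ t, ∑ u, if s ≠ t ∧ s ≠ u ∧ t ≠ u ∧ R s t u ∧ (¬ ∀ w, R s t w) ∧
        (¬ ∀ w, R s u w) ∧ (¬ ∀ w, R t u w) then 1 else 0 : ℤ) =
      (∑ s, ∑ t, ∑ u, if s ≠ t ∧ s ≠ u ∧ t ≠ u ∧ R s t u then 1 else 0) -
        3 * (q - 1) * (∑ s, ∑ t, if s ≠ t ∧ ∀ u, R s t u then 1 else 0) := by
  -- `Z` marks the triples whose pair `(s, t)` is total; each such ordered pair has `q - 1`
  -- admissible third elements.
  set Z : X → X → X → ℤ := fun s t u => if s ≠ t ∧ s ≠ u ∧ t ≠ u ∧ ∀ w, R s t w then 1 else 0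
  have hZ : (∑ s, ∑ t, ∑ u, Z s t u) =
      (q - 1) * (∑ s, ∑ t, if s ≠ t ∧ ∀ u, R s t u then 1 else 0) := by
    simp only [Finset.mul_sum]
    refine Finset.sum_congr rfl fun s _ => Finset.sum_congr rfl fun t _ => ?_
    by_cases hc : s ≠ t ∧ ∀ u, R s t u
    · have := h.sum_third hX hc.1
      rw [if_pos hc.2, if_pos (h.right (hc.2 s)), if_pos (h.right (h.left (hc.2 t)))] at this
      simp only [Z, if_pos hc]
      simp only [hc.2, and_true] at this
      simp only [hc.1, hc.2, ne_eq, not_false_eq_true, true_and, implies_true, and_true]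
      rw [this]; ring
    · rw [if_neg hc, mul_zero]
      refine Finset.sum_eq_zero fun u _ => if_neg ?_
      rintro ⟨a, _, _, b⟩
      exact hc ⟨a, b⟩
  have hZ2 : (∑ s, ∑ t, ∑ u, Z s u t) = ∑ s, ∑ t, ∑ u, Z s t u :=
    Finset.sum_congr rfl fun s _ => Finset.sum_comm
  have hZ3 : (∑ s, ∑ t, ∑ u, Z t u s) = ∑ s, ∑ t, ∑ u, Z s t u := by
    rw [Finset.sum_comm]
    exact Finset.sum_congr rfl fun s _ => Finset.sum_comm
  -- At most one of the three pairs is total, since two total pairs share an element, which would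
  -- then be related to everything. Inclusion-exclusion therefore stops after its first terms.
  have main : ∀ s t u, (if s ≠ t ∧ s ≠ u ∧ t ≠ u ∧ R s t u ∧ (¬ ∀ w, R s t w) ∧
        (¬ ∀ w, R s u w) ∧ (¬ ∀ w, R t u w) then 1 else 0 : ℤ) =
      (if s ≠ t ∧ s ≠ u ∧ t ≠ u ∧ R s t u then 1 else 0) - Z s t u - Z s u t - Z t u s := by
    intro s t u
    simp only [Z]
    by_cases e1 : s = t
    · simp [e1]
    by_cases e2 : s = u
    · simp [e2]
    by_cases e3 : t = u
    · simp [e3]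
    by_cases d1 : ∀ w, R s t w
    · have d2 : ¬ ∀ w, R s u w := fun k => hnd s fun a b => h.all_of_all_of_all d1 k e3 a b
      have d3 : ¬ ∀ w, R t u w := fun k => hnd t fun a b =>
        h.all_of_all_of_all (h.all_symm d1) k e2 a b
      simp [e1, e2, e3, d1, d2, d3, Ne.symm e1, Ne.symm e2, Ne.symm e3]
    · by_cases d2 : ∀ w, R s u w
      · have d3 : ¬ ∀ w, R t u w := fun k => hnd u fun a b =>
          h.all_of_all_of_all (h.all_symm d2) (h.all_symm k) e1 a b
        simp [e1, e2, e3, d1, d2, d3, Ne.symm e1, Ne.symm e2, Ne.symm e3, h.right (d2 t)]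
      · by_cases d3 : ∀ w, R t u w
        · simp [e1, e2, e3, d1, d2, d3, Ne.symm e1, Ne.symm e2, Ne.symm e3,
            h.left (h.right (d3 s))]
        · simp [e1, e2, e3, d1, d2, d3, Ne.symm e1, Ne.symm e2, Ne.symm e3]
  simp only [main, Finset.sum_sub_distrib]
  rw [hZ2, hZ3, hZ]
  ring

end IsPolarity

open Classical in
/-- Each set of three elements is listed by six ordered triples. -/
theorem six_mul_ncard_triples {X : Type*} [Fintype X] [DecidableEq X] (p : Finset X → Prop) :
    (6 * ({S : Finset X | S.card = 3 ∧ p S}.ncard : ℤ)) =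
      ∑ s, ∑ t, ∑ u, if s ≠ t ∧ s ≠ u ∧ t ≠ u ∧ p {s, t, u} then 1 else 0 := by
  have e1 : ({S : Finset X | S.card = 3 ∧ p S}.ncard) =
      (Finset.univ.filter fun S : Finset X => S.card = 3 ∧ p S).card := by
    rw [← Set.ncard_coe_finset]; congr 1; ext S; simp
  have e2 : (∑ s, ∑ t, ∑ u, if s ≠ t ∧ s ≠ u ∧ t ≠ u ∧ p {s, t, u} then 1 else 0 : ℤ) =
      (Finset.univ.filter fun x : X × X × X => x.1 ≠ x.2.1 ∧ x.1 ≠ x.2.2 ∧ x.2.1 ≠ x.2.2 ∧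
        p {x.1, x.2.1, x.2.2}).card := by
    rw [← Finset.sum_boole, ← Finset.univ_product_univ, Finset.sum_product]
    refine Finset.sum_congr rfl fun s _ => ?_
    rw [← Finset.univ_product_univ, Finset.sum_product]
  rw [e1, e2, Finset.card_eq_sum_card_fiberwise (f := fun x : X × X × X => {x.1, x.2.1, x.2.2})
    (t := Finset.univ.filter fun S : Finset X => S.card = 3 ∧ p S)]
  · rw [Finset.sum_const_nat (m := 6)]
    · push_cast; ring
    · intro S hS
      rw [Finset.mem_filter] at hS
      obtain ⟨_, hS3, hp⟩ := hS
      obtain ⟨a, b, c, hab, hac, hbc, rfl⟩ := Finset.card_eq_three.mp hS3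
      have : (Finset.filter (fun x : X × X × X => ({x.1, x.2.1, x.2.2} : Finset X) = {a, b, c})
          (Finset.univ.filter fun x : X × X × X => x.1 ≠ x.2.1 ∧ x.1 ≠ x.2.2 ∧ x.2.1 ≠ x.2.2 ∧
            p {x.1, x.2.1, x.2.2})) =
          {(a, b, c), (a, c, b), (b, a, c), (b, c, a), (c, a, b), (c, b, a)} := by
        ext ⟨x, y, z⟩
        simp only [Finset.mem_filter, Finset.mem_univ, true_and, Finset.mem_insert,
          Finset.mem_singleton, Prod.mk.injEq]
        constructor
        · rintro ⟨⟨h1, h2, h3, -⟩, h5⟩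
          have hx : x ∈ ({a, b, c} : Finset X) := h5 ▸ by simp
          have hy : y ∈ ({a, b, c} : Finset X) := h5 ▸ by simp
          have hz : z ∈ ({a, b, c} : Finset X) := h5 ▸ by simp
          simp only [Finset.mem_insert, Finset.mem_singleton] at hx hy hz
          rcases hx with rfl | rfl | rfl <;> rcases hy with rfl | rfl | rfl <;>
            rcases hz with rfl | rfl | rfl <;> simp_all
        · intro hx
          have hperm : ({x, y, z} : Finset X) = {a, b, c} := by
            rcases hx with h | h | h | h | h | h <;> obtain ⟨rfl, rfl, rfl⟩ := h <;> ext w <;>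
              simp only [Finset.mem_insert, Finset.mem_singleton] <;> tauto
          refine ⟨⟨?_, ?_, ?_, hperm ▸ hp⟩, hperm⟩ <;>
          rcases hx with h | h | h | h | h | h <;> obtain ⟨rfl, rfl, rfl⟩ := h <;>
            first | assumption | (apply Ne.symm; assumption)
      rw [this]
      have hba := hab.symm
      have hca := hac.symm
      have hcb := hbc.symm
      simp [Finset.card_insert_of_notMem, hab, hac, hbc, hba, hca, hcb]
  · rintro ⟨x, y, z⟩ hx
    simp only [Finset.coe_filter, Finset.mem_univ, true_and, Set.mem_ofPred_eq] at hx ⊢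
    exact ⟨Finset.card_eq_three.mpr ⟨x, y, z, hx.1, hx.2.1, hx.2.2.1, rfl⟩, hx.2.2.2⟩

/-! ### The polar form of a vector -/

section Polar

variable {K : Type*} [Field K]

/-- Homogeneous coordinates of a parameter. -/
def param : Option K → K × K
  | some t => (1, t)
  | none => (0, 1)

/-- A determinant: it vanishes exactly when two nonzero arguments represent the same point of the
projective line. -/
def bracket (p q : K × K) : K := p.1 * q.2 - p.2 * q.1

/-- The point of the twisted cubic with homogeneous parameters `p`. -/
def veronese (p : K × K) : Fin 4 → K :=
  ![p.1 ^ 3, p.1 ^ 2 * p.2, p.1 * p.2 ^ 2, p.2 ^ 3]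

/-- The symmetric trilinear form attached to `x`; for distinct parameters, its vanishing says that
`x` lies on the plane through the three points of the cubic. -/
def polar (x : Fin 4 → K) (p q r : K × K) : K :=
  p.1 * q.1 * r.1 * x 3 - (p.1 * q.1 * r.2 + p.1 * q.2 * r.1 + p.2 * q.1 * r.1) * x 2
    + (p.1 * q.2 * r.2 + p.2 * q.1 * r.2 + p.2 * q.2 * r.1) * x 1 - p.2 * q.2 * r.2 * x 0

/-- The polar form as a linear functional of `x`. -/
def polarMap (p q r : K × K) : (Fin 4 → K) →ₗ[K] K where
  toFun x := polar x p q r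
  map_add' x y := by simp only [polar, Pi.add_apply]; ring
  map_smul' c x := by simp only [polar, Pi.smul_apply, smul_eq_mul, RingHom.id_apply]; ring

@[simp] theorem polarMap_apply (p q r : K × K) (x : Fin 4 → K) :
    polarMap p q r x = polar x p q r := rfl

theorem polar_add (x y : Fin 4 → K) (p q r : K × K) :
    polar (x + y) p q r = polar x p q r + polar y p q r := (polarMap p q r).map_add x y

theorem polar_smul (c : K) (x : Fin 4 → K) (p q r : K × K) :
    polar (c • x) p q r = c * polar x p q r := (polarMap p q r).map_smul c x

theorem polar_swap_left (x : Fin 4 → K) (p q r : K × K) : polar x p q r = polar x q p r := by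
  simp only [polar]; ring

theorem polar_swap_right (x : Fin 4 → K) (p q r : K × K) : polar x p q r = polar x p r q := by
  simp only [polar]; ring

theorem polar_smul_smul_smul (x : Fin 4 → K) (a b c : K) (p q r : K × K) :
    polar x (a • p) (b • q) (c • r) = a * b * c * polar x p q r := by
  simp only [polar, Prod.smul_fst, Prod.smul_snd, smul_eq_mul]; ring

/-- Three vectors of the plane satisfy `[u,v] w = [w,v] u + [u,w] v`, and the form is linear in its
last argument. Two zeros with different parameters thus kill the whole linear form. -/
theorem polar_mul_bracket (x : Fin 4 → K) (p q u v w : K × K) :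
    polar x p q w * bracket u v = polar x p q u * bracket w v + polar x p q v * bracket u w := by
  simp only [polar, bracket]; ring

/-- The cubic form of a point of the cubic is, up to sign, the cube of a linear form, so its
polarization is a product. -/
theorem polar_veronese (w p q r : K × K) :
    polar (veronese w) p q r = bracket p w * bracket q w * bracket r w := by
  simp [polar, bracket, veronese]; ring

theorem cubicVec_eq_veronese (s : Option K) : cubicVec s = veronese (param s) := by
  cases s <;> ext i <;> fin_cases i <;> simp [cubicVec, veronese, param]

theorem polar_cubicVec (w : Option K) (p q r : K × K) :
    polar (cubicVec w) p q r =
      bracket p (param w) * bracket q (param w) * bracket r (param w) := by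
  rw [cubicVec_eq_veronese, polar_veronese]

theorem bracket_self (p : K × K) : bracket p p = 0 := by simp only [bracket]; ring

theorem bracket_param_eq_zero {s t : Option K} : bracket (param s) (param t) = 0 ↔ s = t := by
  cases s <;> cases t <;> simp [bracket, param, sub_eq_zero, eq_comm]

theorem bracket_param_ne_zero {s t : Option K} (h : s ≠ t) :
    bracket (param s) (param t) ≠ 0 := fun h0 => h (bracket_param_eq_zero.mp h0)

theorem param_ne_zero (s : Option K) : param s ≠ 0 := by
  cases s <;> simp [param]

theorem exists_smul_param {p : K × K} (hp : p ≠ 0) :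
    ∃ (c : K) (s : Option K), c ≠ 0 ∧ p = c • param s := by
  obtain ⟨a, b⟩ := p
  by_cases ha : a = 0
  · refine ⟨b, none, ?_, ?_⟩
    · rintro rfl; exact hp (by simp [ha])
    · simp [param, ha]
  · refine ⟨a, some (b / a), ha, ?_⟩
    simp [param]
    field_simp

theorem veronese_smul (c : K) (p : K × K) : veronese (c • p) = c ^ 3 • veronese p := by
  ext i; fin_cases i <;> simp [veronese] <;> ring

/-- `x` lies on the plane spanned by the points with parameters `s`, `t`, `u` (suitably
interpreted when these are not distinct). -/
def Rel (x : Fin 4 → K) (s t u : Option K) : Prop :=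
  polar x (param s) (param t) (param u) = 0

/-- The parameters of `none` and `some 0` are a basis of the plane. -/
theorem polar_eq_zero_of_rel {x : Fin 4 → K} {s t : Option K} (h : ∀ u, Rel x s t u)
    (w : K × K) : polar x (param s) (param t) w = 0 := by
  have h1 := h none
  have h2 := h (some 0)
  simp only [Rel, polar, param] at h1 h2 ⊢
  linear_combination w.2 * h1 + w.1 * h2

/-- With two arguments fixed, what remains is a linear form on the plane: one projective zero, or
identically zero. -/
theorem isPolarity_rel (x : Fin 4 → K) : IsPolarity (Rel x) where
  left {s t u} h := by rw [Rel, polar_swap_left]; exact h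
  right {s t u} h := by rw [Rel, polar_swap_right]; exact h
  exists_rel s t := by
    by_cases h : ∀ u, Rel x s t u
    · exact ⟨none, h none⟩
    -- A linear form with coefficients `(A, B)` has the zero `(B, -A)`, which is nonzero as soon as
    -- the form is.
    · set r : K × K := (polar x (param s) (param t) (0, 1), -polar x (param s) (param t) (1, 0))
        with hr
      have hr0 : r ≠ 0 := by
        intro h0
        apply h
        intro u
        have h1 : polar x (param s) (param t) (0, 1) = 0 := congrArg Prod.fst h0
        have h2 : polar x (param s) (param t) (1, 0) = 0 := neg_eq_zero.mp (congrArg Prod.snd h0)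
        simp only [Rel, polar] at h1 h2 ⊢
        linear_combination (param u).2 * h1 + (param u).1 * h2
      obtain ⟨c, u, hc, hcu⟩ := exists_smul_param hr0
      refine ⟨u, ?_⟩
      have h1 : polar x (param s) (param t) r = 0 := by
        simp only [hr, polar]; ring
      have h2 := polar_smul_smul_smul x 1 1 c (param s) (param t) (param u)
      rw [one_smul, one_smul, ← hcu, h1] at h2
      exact (mul_eq_zero.mp h2.symm).resolve_left (by simpa using hc)
  all_of_two {s t u v} h1 h2 huv w := by
    have := polar_mul_bracket x (param s) (param t) (param u) (param v) (param w)
    rw [h1, h2] at this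
    rw [zero_mul, zero_mul, add_zero, mul_eq_zero] at this
    exact this.resolve_right (bracket_param_ne_zero huv)

theorem rel_cubicVec {w s t u : Option K} :
    Rel (cubicVec w) s t u ↔ s = w ∨ t = w ∨ u = w := by
  rw [Rel, polar_cubicVec, mul_eq_zero, mul_eq_zero, bracket_param_eq_zero,
    bracket_param_eq_zero, bracket_param_eq_zero, or_assoc]

theorem rel_smul {x : Fin 4 → K} {c : K} (hc : c ≠ 0) {s t u : Option K} :
    Rel (c • x) s t u ↔ Rel x s t u := by
  rw [Rel, polar_smul, mul_eq_zero, or_iff_right hc, Rel]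

theorem rel_zero (s t u : Option K) : Rel (0 : Fin 4 → K) s t u := by
  simp [Rel, polar]

/-- The vectors that represent a point of the cubic, and zero. -/
def OnCone (x : Fin 4 → K) : Prop := ∃ (s : Option K) (c : K), x = c • cubicVec s

/-- With `s` as first argument, the parameters `∞, 0` in the other two places give three independent
linear functionals of `x` that vanish at `P(s)`; their common kernel is the line of `P(s)`. -/
theorem eq_smul_cubicVec_of_rel {x : Fin 4 → K} {s : Option K} (h : ∀ t u, Rel x s t u) :
    ∃ c : K, x = c • cubicVec s := by
  have h1 := h none none
  have h2 := h none (some 0)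
  have h3 := h (some 0) (some 0)
  cases s with
  | none =>
    simp only [Rel, polar, param] at h1 h2 h3
    refine ⟨x 3, ?_⟩
    ext i
    fin_cases i <;> simp [cubicVec]
    · linear_combination -h1
    · linear_combination h2
    · linear_combination -h3
  | some s =>
    simp only [Rel, polar, param] at h1 h2 h3
    refine ⟨x 0, ?_⟩
    ext i
    fin_cases i <;> simp [cubicVec]
    · linear_combination h1
    · linear_combination -h2 + s * h1
    · linear_combination h3 - s * h2 + s ^ 2 * h1

theorem onCone_of_rel {x : Fin 4 → K} {s : Option K} (h : ∀ t u, Rel x s t u) : OnCone x :=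
  ⟨s, eq_smul_cubicVec_of_rel h⟩

theorem polar_sum_smul_cubicVec {ι : Type*} (S : Finset ι) (f : ι → Option K) (z : ι → K)
    (p q r : K × K) :
    polar (∑ i ∈ S, z i • cubicVec (f i)) p q r =
      ∑ i ∈ S, z i * (bracket p (param (f i)) * bracket q (param (f i)) *
        bracket r (param (f i))) := by
  rw [← polarMap_apply, map_sum]
  exact Finset.sum_congr rfl fun i _ => by
    rw [map_smul, polarMap_apply, polar_cubicVec, smul_eq_mul]

end Polar

/-! ### Any four points of the cubic are independent -/

section Independent

variable {F : Type*} [Field F] [Fintype F] [DecidableEq F]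

theorem card_option_eq : Fintype.card (Option F) = Nat.card F + 1 := by
  rw [Fintype.card_option, Nat.card_eq_fintype_card]

theorem exists_ne_of_card_lt {X : Type*} [Fintype X] [DecidableEq X] (S : Finset X)
    (h : S.card < Fintype.card X) : ∃ x, x ∉ S := by
  by_contra! hS
  rw [Finset.eq_univ_iff_forall.mpr hS, Finset.card_univ] at h
  exact lt_irrefl _ h

/-- Evaluated at three parameters that cover the support except `a`, the polar form of the sum keeps
only the term of `a`, multiplied by nonzero brackets. -/
theorem eq_zero_of_sum_smul_cubicVec (hF : 3 ≤ Nat.card F) {z : Option F → F}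
    (hz : ∑ s, z s • cubicVec s = 0) (hn : hammingNorm z ≤ 4) : z = 0 := by
  ext a
  by_contra ha
  set S : Finset (Option F) := Finset.univ.filter fun i => z i ≠ 0 with hS
  have hSc : S.card ≤ 4 := hn
  have haS : a ∈ S := by simpa [hS] using ha
  -- The support may have fewer than four elements, so the remaining part is padded to exactly three
  -- parameters other than `a`.
  obtain ⟨T, hST, hTa, hT⟩ := Finset.exists_subsuperset_card_eq (s := S.erase a)
    (t := Finset.univ.erase a) (n := 3) (Finset.erase_subset_erase _ (Finset.subset_univ _))
    (by rw [Finset.card_erase_of_mem haS]; omega)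
    (by rw [Finset.card_erase_of_mem (Finset.mem_univ _), Finset.card_univ, card_option_eq]
        omega)
  obtain ⟨t, u, w, htu, htw, huw, rfl⟩ := Finset.card_eq_three.mp hT
  have hat : t ≠ a := Finset.ne_of_mem_erase (hTa (by simp))
  have hau : u ≠ a := Finset.ne_of_mem_erase (hTa (by simp))
  have haw : w ≠ a := Finset.ne_of_mem_erase (hTa (by simp))
  have h0 := polar_sum_smul_cubicVec Finset.univ id z (param t) (param u) (param w)
  simp only [id_eq] at h0
  rw [hz, Finset.sum_eq_single a] at h0
  · have : polar (0 : Fin 4 → F) (param t) (param u) (param w) = 0 := rel_zero _ _ _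
    rw [this] at h0
    have := mul_ne_zero (mul_ne_zero (bracket_param_ne_zero hat) (bracket_param_ne_zero hau))
      (bracket_param_ne_zero haw)
    exact mul_ne_zero ha this h0.symm
  · intro b _ hb
    by_cases hzb : z b = 0
    · rw [hzb, zero_mul]
    · have : b ∈ ({t, u, w} : Finset (Option F)) :=
        hST (Finset.mem_erase.mpr ⟨hb, by simpa [hS] using hzb⟩)
      simp only [Finset.mem_insert, Finset.mem_singleton] at this
      rcases this with rfl | rfl | rfl <;> simp [bracket_self]
  · simp

theorem linearIndependent_cubicVec (hF : 3 ≤ Nat.card F) (S : Finset (Option F))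
    (hS : S.card ≤ 4) : LinearIndependent F (fun s : S => cubicVec (s : Option F)) := by
  rw [Fintype.linearIndependent_iff]
  intro g hg i
  set z : Option F → F := fun s => if h : s ∈ S then g ⟨s, h⟩ else 0 with hz
  have hsum : ∑ s, z s • cubicVec s = 0 := by
    rw [← hg, ← Finset.sum_subset (Finset.subset_univ S), ← Finset.sum_coe_sort]
    · exact Finset.sum_congr rfl fun s _ => by simp [hz]
    · intro s _ hs; simp [hz, hs]
  have hn : hammingNorm z ≤ 4 := by
    refine le_trans (Finset.card_le_card ?_) hS
    intro s hs
    by_contra hsS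
    simp [hz, hsS] at hs
  have := congrFun (eq_zero_of_sum_smul_cubicVec hF hsum hn) i
  simpa [hz] using this

theorem mem_span_cubicVec_iff (S : Finset (Option F)) (y : Fin 4 → F) :
    y ∈ Submodule.span F (cubicVec '' (S : Set (Option F))) ↔
      ∃ z : Option F → F, (∀ i, i ∉ S → z i = 0) ∧ ∑ s, z s • cubicVec s = y := by
  rw [Submodule.mem_span_image_finset_iff_exists_fun]
  constructor
  · rintro ⟨c, hc⟩
    refine ⟨fun i => if h : i ∈ S then c ⟨i, h⟩ else 0, fun i hi => by simp [hi], ?_⟩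
    rw [← hc, ← Finset.sum_subset (Finset.subset_univ S), ← Finset.sum_coe_sort]
    · exact Finset.sum_congr rfl fun s _ => by simp
    · intro s _ hs; simp [hs]
  · rintro ⟨z, hz, hy⟩
    refine ⟨fun i => z i, ?_⟩
    rw [← hy, Finset.sum_coe_sort S fun i => z i • cubicVec i]
    exact Finset.sum_subset (Finset.subset_univ S) fun s _ hs => by simp [hz s hs]

theorem finrank_span_cubicVec (hF : 3 ≤ Nat.card F) (S : Finset (Option F)) (hS : S.card ≤ 4) :
    Module.finrank F (Submodule.span F (cubicVec '' (S : Set (Option F)))) = S.card := by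
  have := finrank_span_eq_card (linearIndependent_cubicVec hF S hS)
  rw [Fintype.card_coe] at this
  rw [← this]
  rw [Set.image_eq_range]
  rfl

theorem exists_sum_eq (hF : 3 ≤ Nat.card F) (S : Finset (Option F)) (hS : S.card = 4)
    (y : Fin 4 → F) :
    ∃ z : Option F → F, (∀ i, i ∉ S → z i = 0) ∧ ∑ s, z s • cubicVec s = y := by
  rw [← mem_span_cubicVec_iff]
  have : Submodule.span F (cubicVec '' (S : Set (Option F))) = ⊤ := by
    apply Submodule.eq_top_of_finrank_eq
    rw [finrank_span_cubicVec hF S hS.le, hS]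
    simp
  rw [this]
  trivial

/-- The polar form at `(s, t, u)` annihilates the terms supported there. What is left is `z a` times
three nonzero brackets, so the relation reads off one coefficient. -/
theorem sum_eq_single_of_rel {z : Option F → F} {s t u a : Option F}
    (hz : ∀ i, i ≠ a → z i = 0 ∨ i = s ∨ i = t ∨ i = u)
    (has : s ≠ a) (hat : t ≠ a) (hau : u ≠ a) :
    Rel (∑ i, z i • cubicVec i) s t u ↔ z a = 0 := by
  have h0 := polar_sum_smul_cubicVec Finset.univ id z (param s) (param t) (param u)
  simp only [id_eq] at h0
  rw [Rel, h0, Finset.sum_eq_single a]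
  · have := mul_ne_zero (mul_ne_zero (bracket_param_ne_zero has) (bracket_param_ne_zero hat))
      (bracket_param_ne_zero hau)
    rw [mul_eq_zero, or_iff_left this]
  · intro b _ hb
    rcases hz b hb with h | rfl | rfl | rfl
    · rw [h, zero_mul]
    all_goals simp [bracket_self]
  · simp

/-- Expand `y` in the basis of points with parameters `s, t, u` and some fourth `w`; the relation
says that the coefficient of `w` vanishes. -/
theorem mem_span_triple_iff (hF : 3 ≤ Nat.card F) {s t u : Option F} (hst : s ≠ t) (hsu : s ≠ u)
    (htu : t ≠ u) (y : Fin 4 → F) :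
    y ∈ Submodule.span F (cubicVec '' (({s, t, u} : Finset (Option F)) : Set (Option F))) ↔
      Rel y s t u := by
  rw [mem_span_cubicVec_iff]
  obtain ⟨w, hw⟩ := exists_ne_of_card_lt {s, t, u} (by
    rw [card_option_eq, Finset.card_eq_three.mpr ⟨s, t, u, hst, hsu, htu, rfl⟩]; omega)
  have hw' := hw
  simp only [Finset.mem_insert, Finset.mem_singleton, not_or] at hw'
  constructor
  · rintro ⟨z, hz, rfl⟩
    refine (sum_eq_single_of_rel (a := w) ?_ (Ne.symm hw'.1) (Ne.symm hw'.2.1)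
      (Ne.symm hw'.2.2)).mpr (hz w hw)
    intro i _
    by_contra! h
    exact h.1 (hz i (by simp [h.2]))
  · intro h
    obtain ⟨z, hz, rfl⟩ := exists_sum_eq hF (insert w {s, t, u}) (by
      rw [Finset.card_insert_of_notMem hw,
        Finset.card_eq_three.mpr ⟨s, t, u, hst, hsu, htu, rfl⟩]) y
    refine ⟨z, ?_, rfl⟩
    rw [sum_eq_single_of_rel (a := w) ?_ (Ne.symm hw'.1) (Ne.symm hw'.2.1)
      (Ne.symm hw'.2.2)] at h
    · intro i hi
      by_cases hiw : i = w
      · rw [hiw, h]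
      · exact hz i (by rw [Finset.mem_insert, not_or]; exact ⟨hiw, hi⟩)
    · intro i hi
      by_contra! h'
      exact h'.1 (hz i (by simp [h'.2, hi]))

/-- A total pair first puts `y` in the plane of `s, t, u`; the relation at a fourth parameter `w`
then removes the coordinate of `u`. -/
theorem mem_span_pair_iff_rel (hF : 3 ≤ Nat.card F) {s t : Option F} (hst : s ≠ t)
    (y : Fin 4 → F) :
    y ∈ Submodule.span F (cubicVec '' (({s, t} : Finset (Option F)) : Set (Option F))) ↔
      ∀ u, Rel y s t u := by
  obtain ⟨u, hu⟩ := exists_ne_of_card_lt {s, t} (by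
    rw [card_option_eq, Finset.card_pair hst]; omega)
  simp only [Finset.mem_insert, Finset.mem_singleton, not_or] at hu
  constructor
  · intro h
    rw [mem_span_cubicVec_iff] at h
    obtain ⟨z, hz, rfl⟩ := h
    intro u
    have h0 := polar_sum_smul_cubicVec Finset.univ id z (param s) (param t) (param u)
    simp only [id_eq] at h0
    rw [Rel, h0]
    refine Finset.sum_eq_zero fun i _ => ?_
    by_cases hi : i ∈ ({s, t} : Finset (Option F))
    · simp only [Finset.mem_insert, Finset.mem_singleton] at hi
      rcases hi with rfl | rfl <;> simp [bracket_self]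
    · rw [hz i hi, zero_mul]
  · intro h
    have h3 := (mem_span_triple_iff hF hst (Ne.symm hu.1) (Ne.symm hu.2) y).mpr (h u)
    rw [mem_span_cubicVec_iff] at h3 ⊢
    obtain ⟨z, hz, rfl⟩ := h3
    refine ⟨z, ?_, rfl⟩
    obtain ⟨w, hw⟩ := exists_ne_of_card_lt {s, t, u} (by
      rw [card_option_eq, Finset.card_eq_three.mpr ⟨s, t, u, hst, Ne.symm hu.1, Ne.symm hu.2, rfl⟩]
      omega)
    simp only [Finset.mem_insert, Finset.mem_singleton, not_or] at hw
    have := (sum_eq_single_of_rel (a := u) (fun i hi => ?_) (Ne.symm hu.1) (Ne.symm hu.2)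
      hw.2.2).mp (h w)
    · intro i hi
      by_cases hiu : i = u
      · rw [hiu, this]
      · refine hz i ?_
        simp only [Finset.mem_insert, Finset.mem_singleton, not_or] at hi ⊢
        exact ⟨hi.1, hi.2, hiu⟩
    · by_contra! h'
      exact h'.1 (hz i (by simp [h'.2, hi]))

end Independent

/-! ### Types of points in terms of the polar form -/

section Dictionary

variable {F : Type*} [Field F]

theorem submodule_mk_le {y : Fin 4 → F} (hy : y ≠ 0) (L : Submodule F (Fin 4 → F)) :
    (Projectivization.mk F y hy).submodule ≤ L ↔ y ∈ L := by
  rw [Projectivization.submodule_mk, Submodule.span_singleton_le_iff_mem]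

theorem cubicPoint_le_iff (s : Option F) (L : Submodule F (Fin 4 → F)) :
    (cubicPoint s).submodule ≤ L ↔ cubicVec s ∈ L := submodule_mk_le _ _

theorem cubicPoint_injective : Function.Injective (cubicPoint (F := F)) := by
  intro s t h
  rw [cubicPoint, cubicPoint, Projectivization.mk_eq_mk_iff'] at h
  obtain ⟨a, ha⟩ := h
  have h1 : Rel (a • cubicVec t) t t t := by
    rw [Rel, polar_smul]
    exact mul_eq_zero_of_right _ (rel_cubicVec.mpr (Or.inl rfl))
  rw [ha, rel_cubicVec] at h1
  simpa [eq_comm] using h1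

theorem mk_mem_cubic_iff {y : Fin 4 → F} (hy : y ≠ 0) :
    Projectivization.mk F y hy ∈ cubic F ↔ OnCone y := by
  constructor
  · rintro ⟨s, hs⟩
    rw [cubicPoint, Projectivization.mk_eq_mk_iff'] at hs
    obtain ⟨a, ha⟩ := hs
    have ha0 : a ≠ 0 := by
      rintro rfl
      rw [zero_smul] at ha
      exact cubicVec_ne_zero s ha.symm
    exact ⟨s, a⁻¹, by rw [← ha, inv_smul_smul₀ ha0]⟩
  · rintro ⟨s, c, rfl⟩
    refine ⟨s, ?_⟩
    rw [cubicPoint, Projectivization.mk_eq_mk_iff']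
    have hc : c ≠ 0 := by rintro rfl; exact hy (zero_smul _ _)
    exact ⟨c⁻¹, inv_smul_smul₀ hc _⟩

theorem mem_osculatingPlane_iff (s : Option F) (y : Fin 4 → F) :
    y ∈ osculatingPlane s ↔ Rel y s s s := by
  cases s with
  | none => rw [osculatingPlane, mem_planeOf]; simp [Rel, polar, param]
  | some s =>
    rw [osculatingPlane, mem_planeOf]
    simp only [Rel, polar, param, Matrix.cons_val]
    constructor <;> intro h <;> linear_combination h

theorem osculatingPlane_injective : Function.Injective (osculatingPlane (F := F)) := by
  intro s t h
  have h1 : cubicVec t ∈ osculatingPlane t :=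
    (mem_osculatingPlane_iff _ _).mpr (rel_cubicVec.mpr (Or.inl rfl))
  rw [← h, mem_osculatingPlane_iff, rel_cubicVec] at h1
  simpa using h1

theorem osculatingCount_mk {y : Fin 4 → F} (hy : y ≠ 0) :
    osculatingCount (Projectivization.mk F y hy) = {s | Rel y s s s}.ncard := by
  rw [osculatingCount, ← Set.ncard_image_of_injective _ osculatingPlane_injective]
  congr 1
  ext π
  simp only [submodule_mk_le]
  constructor
  · rintro ⟨⟨s, rfl⟩, h⟩
    exact ⟨s, (mem_osculatingPlane_iff _ _).mp h, rfl⟩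
  · rintro ⟨s, h, rfl⟩
    exact ⟨⟨s, rfl⟩, (mem_osculatingPlane_iff _ _).mpr h⟩

theorem mem_tangentLine_iff (s : Option F) (y : Fin 4 → F) :
    y ∈ tangentLine s ↔ ∀ u, Rel y s s u := by
  constructor
  · intro h u
    cases s <;> rw [tangentLine, Submodule.mem_span_pair] at h <;> obtain ⟨a, b, rfl⟩ := h <;>
      cases u <;> simp [Rel, polar, param] <;> ring
  · intro h
    have h1 := h none
    have h2 := h (some 0)
    cases s <;> rw [tangentLine, Submodule.mem_span_pair] <;> simp only [Rel, polar, param] at h1 h2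
    · refine ⟨y 3, y 2, ?_⟩
      ext i
      fin_cases i <;> simp
      · linear_combination h1
      · linear_combination -h2
    · rename_i s
      refine ⟨y 0, y 1 - s * y 0, ?_⟩
      ext i
      fin_cases i <;> simp
      · ring
      · linear_combination h1
      · linear_combination -h2 + 2 * s * h1

theorem mk_mem_tangentPoints_iff {y : Fin 4 → F} (hy : y ≠ 0) :
    Projectivization.mk F y hy ∈ tangentPoints F ↔ ¬ OnCone y ∧ ∃ s, ∀ u, Rel y s s u := by
  simp only [tangentPoints, Set.mem_ofPred_eq, mk_mem_cubic_iff, submodule_mk_le,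
    mem_tangentLine_iff]

variable [Fintype F] [DecidableEq F]

theorem mk_mem_rcPoints_iff (hF : 3 ≤ Nat.card F) {y : Fin 4 → F} (hy : y ≠ 0) :
    Projectivization.mk F y hy ∈ rcPoints F ↔
      ¬ OnCone y ∧ ∃ s t, s ≠ t ∧ ∀ u, Rel y s t u := by
  have key : ∀ s t : Option F, s ≠ t →
      (y ∈ (cubicPoint s).submodule ⊔ (cubicPoint t).submodule ↔ ∀ u, Rel y s t u) := by
    intro s t hst
    rw [← mem_span_pair_iff_rel hF hst, cubicPoint, cubicPoint, Projectivization.submodule_mk,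
      Projectivization.submodule_mk, ← Submodule.span_union]
    rw [Finset.coe_pair, Set.image_pair, Set.singleton_union]
  simp only [rcPoints, Set.mem_ofPred_eq, mk_mem_cubic_iff, submodule_mk_le]
  refine and_congr_right fun _ => ⟨?_, ?_⟩
  · rintro ⟨L, ⟨_, ⟨s, rfl⟩, _, ⟨t, rfl⟩, hst, rfl⟩, hL⟩
    have hst : s ≠ t := fun h => hst (by rw [h])
    exact ⟨s, t, hst, (key s t hst).mp hL⟩
  · rintro ⟨s, t, hst, h⟩
    exact ⟨_, ⟨_, ⟨s, rfl⟩, _, ⟨t, rfl⟩, fun h => hst (cubicPoint_injective h), rfl⟩,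
      (key s t hst).mpr h⟩

theorem ncard_cubic_inter (π : Submodule F (Fin 4 → F)) :
    {Q : ℙ F (Fin 4 → F) | Q ∈ cubic F ∧ Q.submodule ≤ π}.ncard =
      {s : Option F | cubicVec s ∈ π}.ncard := by
  rw [← Set.ncard_image_of_injective _ cubicPoint_injective]
  congr 1
  ext Q
  constructor
  · rintro ⟨⟨s, rfl⟩, h⟩
    exact ⟨s, (cubicPoint_le_iff _ _).mp h, rfl⟩
  · rintro ⟨s, h, rfl⟩
    exact ⟨⟨s, rfl⟩, (cubicPoint_le_iff _ _).mpr h⟩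

theorem cubicVec_mem_span_iff (hF : 3 ≤ Nat.card F) {S : Finset (Option F)} (hS : S.card = 3)
    (w : Option F) :
    cubicVec w ∈ Submodule.span F (cubicVec '' (S : Set (Option F))) ↔ w ∈ S := by
  obtain ⟨s, t, u, hst, hsu, htu, rfl⟩ := Finset.card_eq_three.mp hS
  rw [mem_span_triple_iff hF hst hsu htu, rel_cubicVec]
  simp [eq_comm]

/-- A plane with exactly three points of the cubic is spanned by them, and by independence the span
of three points contains no fourth. Such planes are thus the 3-subsets of the parameters. -/
theorem threePlaneCount_mk (hF : 3 ≤ Nat.card F) {y : Fin 4 → F} (hy : y ≠ 0) :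
    threePlaneCount (Projectivization.mk F y hy) =
      {S : Finset (Option F) | S.card = 3 ∧
        y ∈ Submodule.span F (cubicVec '' (S : Set (Option F)))}.ncard := by
  rw [threePlaneCount]
  symm
  refine Set.ncard_congr
    (fun S _ => Submodule.span F (cubicVec '' (S : Set (Option F)))) ?_ ?_ ?_
  · rintro S ⟨hS, hyS⟩
    refine ⟨by rw [finrank_span_cubicVec hF S (by omega), hS], ?_, (submodule_mk_le _ _).mpr hyS⟩
    rw [ncard_cubic_inter, ← hS, ← Set.ncard_coe_finset]
    congr 1
    ext w
    exact cubicVec_mem_span_iff hF hS w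
  · rintro S T ⟨hS, _⟩ ⟨hT, _⟩ h
    ext w
    rw [← cubicVec_mem_span_iff hF hS, ← cubicVec_mem_span_iff hF hT]
    exact h ▸ Iff.rfl
  · rintro π ⟨hπ, h3, hyπ⟩
    rw [ncard_cubic_inter] at h3
    have hfin : {s : Option F | cubicVec s ∈ π}.Finite := Set.toFinite _
    set S := hfin.toFinset with hSdef
    have hS : S.card = 3 := by rw [← h3, Set.ncard_eq_toFinset_card _ hfin]
    have hle : Submodule.span F (cubicVec '' (S : Set (Option F))) ≤ π := by
      rw [Submodule.span_le]
      rintro _ ⟨s, hs, rfl⟩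
      exact (Set.Finite.mem_toFinset hfin).mp hs
    have heq := Submodule.eq_of_le_of_finrank_eq hle (by
      rw [finrank_span_cubicVec hF S (by omega), hS, hπ])
    refine ⟨S, ⟨hS, ?_⟩, heq⟩
    rw [heq]
    exact (submodule_mk_le _ _).mp hyπ

/-- Two words with the same sum and the same 3-element support differ by a dependency among three
points, which is trivial; the support determines the word. -/
theorem ncard_weight_three (hF : 3 ≤ Nat.card F) (y : Fin 4 → F) :
    {z : Option F → F | ∑ s, z s • cubicVec s = y ∧ hammingNorm z = 3}.ncard =
      {S : Finset (Option F) | S.card = 3 ∧ ∃ z : Option F → F,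
        (∀ i, z i ≠ 0 ↔ i ∈ S) ∧ ∑ s, z s • cubicVec s = y}.ncard := by
  refine Set.ncard_congr (fun z _ => Finset.univ.filter fun i => z i ≠ 0) ?_ ?_ ?_
  · rintro z ⟨hz, h3⟩
    exact ⟨h3, z, by simp, hz⟩
  · rintro z z' ⟨hz, h3⟩ ⟨hz', _⟩ h
    have h0 : z - z' = 0 := by
      apply eq_zero_of_sum_smul_cubicVec hF
      · simp only [Pi.sub_apply, sub_smul, Finset.sum_sub_distrib, hz, hz', sub_self]
      · refine le_trans (le_trans (Finset.card_le_card ?_) h3.le) (by norm_num)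
        intro i hi
        simp only [Finset.mem_filter, Finset.mem_univ, true_and, Pi.sub_apply] at hi ⊢
        intro hzi
        have : z' i = 0 := by
          by_contra hne
          have : i ∈ Finset.univ.filter fun i => z' i ≠ 0 := by simpa using hne
          rw [← h] at this
          simp [hzi] at this
        rw [hzi, this, sub_zero] at hi
        exact hi rfl
    exact sub_eq_zero.mp h0
  · rintro S ⟨hS, z, hz, hy⟩
    have : (Finset.univ.filter fun i => z i ≠ 0) = S := by ext i; simp [← hz]
    refine ⟨z, ⟨hy, ?_⟩, this⟩
    rw [← hS, ← this]
    rfl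

/-- In the expansion over three independent points, a coefficient vanishes exactly when `y` lies on
the chord of the other two. -/
theorem exists_support_triple_iff (hF : 3 ≤ Nat.card F) {s t u : Option F} (hst : s ≠ t)
    (hsu : s ≠ u) (htu : t ≠ u) (y : Fin 4 → F) :
    (∃ z : Option F → F, (∀ i, z i ≠ 0 ↔ i ∈ ({s, t, u} : Finset (Option F))) ∧
      ∑ s, z s • cubicVec s = y) ↔
    Rel y s t u ∧ (¬ ∀ w, Rel y s t w) ∧ (¬ ∀ w, Rel y s u w) ∧ (¬ ∀ w, Rel y t u w) := by
  constructor
  · rintro ⟨z, hz, hy⟩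
    refine ⟨(mem_span_triple_iff hF hst hsu htu y).mp ((mem_span_cubicVec_iff _ _).mpr
      ⟨z, fun i hi => not_not.mp fun h => hi ((hz i).mp h), hy⟩), ?_⟩
    have key : ∀ a b c : Option F, a ≠ b → a ≠ c → b ≠ c →
        ({a, b, c} : Finset (Option F)) = {s, t, u} → ¬ ∀ w, Rel y a b w := by
      intro a b c hab hac hbc hS hD
      have h1 : Rel (∑ i, z i • cubicVec i) a b c := hy ▸ hD c
      obtain ⟨w, hw⟩ := exists_ne_of_card_lt {a, b, c} (by
        rw [card_option_eq, Finset.card_eq_three.mpr ⟨a, b, c, hab, hac, hbc, rfl⟩]; omega)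
      simp only [Finset.mem_insert, Finset.mem_singleton, not_or] at hw
      have h2 := (sum_eq_single_of_rel (z := z) (s := a) (t := b) (u := w) (a := c) (fun i hi => ?_)
        hac hbc hw.2.2).mp (hy ▸ hD w)
      · exact (hz c).mpr (hS ▸ by simp) h2
      · by_contra! h
        have := (hz i).mp h.1
        rw [← hS] at this
        simp [hi, h.2] at this
    refine ⟨key s t u hst hsu htu rfl, key s u t hsu hst (Ne.symm htu) ?_,
      key t u s htu (Ne.symm hst) (Ne.symm hsu) ?_⟩
    · ext; simp; tauto
    · ext; simp; tauto
  · rintro ⟨hR, h1, h2, h3⟩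
    obtain ⟨z, hz, hy⟩ := (mem_span_cubicVec_iff _ _).mp
      ((mem_span_triple_iff hF hst hsu htu y).mpr hR)
    refine ⟨z, fun i => ⟨fun h => by_contra fun hi => h (hz i hi), fun hi h0 => ?_⟩, hy⟩
    have key : ∀ a b c : Option F, a ≠ b → z c = 0 →
        ({s, t, u} : Finset (Option F)) ⊆ {a, b, c} → ∀ w, Rel y a b w := by
      intro a b c hab hc hS
      rw [← mem_span_pair_iff_rel hF hab, mem_span_cubicVec_iff]
      refine ⟨z, fun i hi => ?_, hy⟩
      by_cases hic : i = c
      · rw [hic, hc]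
      · refine hz i fun h => hi ?_
        have := hS h
        simp only [Finset.mem_insert, Finset.mem_singleton] at this ⊢
        tauto
    simp only [Finset.mem_insert, Finset.mem_singleton] at hi
    rcases hi with rfl | rfl | rfl
    · exact h3 (key t u i htu h0 (by intro; simp; tauto))
    · exact h2 (key s u i hsu h0 (by intro; simp; tauto))
    · exact h1 (key s t i hst h0 (by intro; simp))

/-! ### Counting planes and vectors of weight three -/

open Classical in
/-- The number of osculating planes that contain `y`. -/
noncomputable def oscNum (y : Fin 4 → F) : ℤ := ∑ s, if Rel y s s s then 1 else 0

open Classical in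
/-- The number of tangents that contain `y`. -/
noncomputable def tanNum (y : Fin 4 → F) : ℤ := ∑ s, if ∀ u, Rel y s s u then 1 else 0

open Classical in
/-- Twice the number of real chords that contain `y`. -/
noncomputable def chordNum (y : Fin 4 → F) : ℤ :=
  ∑ s, ∑ t, if s ≠ t ∧ ∀ u, Rel y s t u then 1 else 0

theorem card_option_int : (Fintype.card (Option F) : ℤ) = (Nat.card F : ℤ) + 1 := by
  rw [card_option_eq]; simp

/-- The basic identity, used in three ways: for the value of `r`, through divisibility by 3 to find
`oscNum`, and through the invariance of its left side to show that point classes are preserved by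
the group. -/
theorem six_mul_threePlaneCount (hF : 3 ≤ Nat.card F) {y : Fin 4 → F} (hy : y ≠ 0) :
    6 * (threePlaneCount (Projectivization.mk F y hy) : ℤ) =
      (Nat.card F : ℤ) ^ 2 - Nat.card F - 2 + 2 * oscNum y +
        Nat.card F * (chordNum y - 2 * tanNum y) := by
  classical
  rw [threePlaneCount_mk hF, six_mul_ncard_triples]
  have h := (isPolarity_rel y).sum_distinct card_option_int
  refine Eq.trans ?_ (h.trans ?_)
  swap
  · simp only [oscNum, chordNum, tanNum]
    congr!
  refine Finset.sum_congr rfl fun s _ => Finset.sum_congr rfl fun t _ =>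
    Finset.sum_congr rfl fun u _ => ?_
  congr! 1
  constructor
  · rintro ⟨a, b, c, d⟩
    exact ⟨a, b, c, (mem_span_triple_iff hF a b c y).mp d⟩
  · rintro ⟨a, b, c, d⟩
    exact ⟨a, b, c, (mem_span_triple_iff hF a b c y).mpr d⟩

/-- A chord through `y` lies in `q - 1` three-point planes, each listed by six ordered triples,
whereas `chordNum` counts the chord twice; hence the factor `3 (q - 1)`. -/
theorem six_mul_ncard_weight_three (hF : 3 ≤ Nat.card F) {y : Fin 4 → F} (hy : ¬ OnCone y) :
    6 * ({z : Option F → F | ∑ s, z s • cubicVec s = y ∧ hammingNorm z = 3}.ncard : ℤ) =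
      (Nat.card F : ℤ) ^ 2 - Nat.card F - 2 + 2 * oscNum y +
        Nat.card F * (chordNum y - 2 * tanNum y) - 3 * (Nat.card F - 1) * chordNum y := by
  classical
  rw [ncard_weight_three hF, six_mul_ncard_triples]
  have h := (isPolarity_rel y).sum_distinct_proper (fun s hs => hy (onCone_of_rel hs))
    card_option_int
  rw [(isPolarity_rel y).sum_distinct card_option_int] at h
  refine Eq.trans ?_ (h.trans ?_)
  swap
  · simp only [oscNum, chordNum, tanNum]
    congr!
  refine Finset.sum_congr rfl fun s _ => Finset.sum_congr rfl fun t _ =>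
    Finset.sum_congr rfl fun u _ => ?_
  congr! 1
  constructor
  · rintro ⟨a, b, c, d⟩
    exact ⟨a, b, c, (exists_support_triple_iff hF a b c y).mp d⟩
  · rintro ⟨a, b, c, d⟩
    exact ⟨a, b, c, (exists_support_triple_iff hF a b c y).mpr d⟩

theorem ncard_weight_three_of_onCone (hF : 3 ≤ Nat.card F) {y : Fin 4 → F} (hy : OnCone y) :
    {z : Option F → F | ∑ s, z s • cubicVec s = y ∧ hammingNorm z = 3}.ncard = 0 := by
  rw [Set.ncard_eq_zero, Set.eq_empty_iff_forall_notMem]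
  rintro z ⟨hz, h3⟩
  obtain ⟨a, c, rfl⟩ := hy
  -- The difference is a dependency of weight at most 4, so it vanishes, and `z` has weight at most
  -- 1.
  have h0 : z - Pi.single a c = 0 := by
    apply eq_zero_of_sum_smul_cubicVec hF
    · simp only [Pi.sub_apply, sub_smul, Finset.sum_sub_distrib, hz]
      rw [Finset.sum_eq_single a]
      · simp
      · intro b _ hb; simp [hb]
      · simp
    · have h1 : hammingNorm (z - Pi.single a c) ≤
          (insert a (Finset.univ.filter fun i => z i ≠ 0)).card := by
        refine Finset.card_le_card fun i hi => ?_
        by_cases hia : i = a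
        · simp [hia]
        · simpa [hia] using hi
      refine h1.trans ((Finset.card_insert_le _ _).trans ?_)
      have : (Finset.univ.filter fun i => z i ≠ 0).card = 3 := h3
      omega
  rw [sub_eq_zero.mp h0] at h3
  have h1 : hammingNorm (Pi.single a c : Option F → F) ≤ ({a} : Finset (Option F)).card := by
    refine Finset.card_le_card fun i hi => ?_
    by_contra hia
    simp only [Finset.mem_singleton] at hia
    simp [hia] at hi
  rw [h3] at h1
  simp at h1

end Dictionary

/-! ### Imaginary chords -/

section Imaginary

/-- Every vector satisfies a binary linear recurrence; either its characteristic polynomial has its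
roots in the field or at infinity, or it is irreducible. -/
theorem exists_rel_or_irreducible {F : Type*} [Field F] (x : Fin 4 → F) :
    (∃ s t, ∀ u, Rel x s t u) ∨ ∃ c₀ c₁ : F, (∀ τ : F, τ ^ 2 + c₁ * τ + c₀ ≠ 0) ∧
      x 2 = -c₁ * x 1 - c₀ * x 0 ∧ x 3 = -c₁ * x 2 - c₀ * x 1 := by
  obtain ⟨c0, c1, c2, hc, h1, h2⟩ : ∃ c0 c1 c2 : F, (c0 ≠ 0 ∨ c1 ≠ 0 ∨ c2 ≠ 0) ∧
      c0 * x 0 + c1 * x 1 + c2 * x 2 = 0 ∧ c0 * x 1 + c1 * x 2 + c2 * x 3 = 0 := by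
    -- The cross product of `(x 0, x 1, x 2)` and `(x 1, x 2, x 3)` solves both equations; if it is
    -- zero, these rows are dependent and a solution is easy to write down.
    by_cases h : x 1 * x 3 - x 2 ^ 2 ≠ 0 ∨ x 1 * x 2 - x 0 * x 3 ≠ 0 ∨ x 0 * x 2 - x 1 ^ 2 ≠ 0
    · exact ⟨_, _, _, h, by ring, by ring⟩
    · push Not at h
      obtain ⟨ha, hb, hc⟩ := h
      by_cases h0 : x 0 = 0
      · have h1 : x 1 = 0 := by
          rw [h0] at hc; simpa using hc
        exact ⟨1, 0, 0, by simp, by simp [h0], by simp [h1]⟩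
      · refine ⟨-x 1, x 0, 0, by simp [h0], by ring, by linear_combination hc⟩
  -- The roots of the binary quadratic form with these coefficients, `∞` being one exactly when `c2
  -- = 0`, are the parameters of the chord or tangent.
  by_cases h0 : c2 = 0
  · subst h0
    left
    by_cases h10 : c1 = 0
    · subst h10
      have hc0 : c0 ≠ 0 := by simpa using hc
      have e0 : x 0 = 0 := by simpa [hc0] using h1
      have e1 : x 1 = 0 := by simpa [hc0] using h2
      refine ⟨none, none, fun u => ?_⟩
      simp [Rel, polar, param, e0, e1]
    · refine ⟨none, some (-c0 / c1), fun u => ?_⟩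
      rw [Rel]
      generalize param u = r
      simp only [polar, param]
      field_simp
      linear_combination -r.1 * h2 + r.2 * h1
  · by_cases hr : ∃ τ : F, c2 * τ ^ 2 + c1 * τ + c0 = 0
    · left
      obtain ⟨τ, hτ⟩ := hr
      refine ⟨some τ, some (-c1 / c2 - τ), fun u => ?_⟩
      have e0 : c0 = -(c2 * τ ^ 2 + c1 * τ) := by linear_combination hτ
      rw [Rel]
      generalize param u = r
      simp only [polar, param]
      field_simp
      rw [e0] at h1 h2
      linear_combination r.1 * h2 - r.2 * h1
    · right
      refine ⟨c0 / c2, c1 / c2, fun τ hτ => hr ⟨τ, ?_⟩, ?_, ?_⟩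
      · field_simp at hτ
        linear_combination hτ
      · field_simp; linear_combination h1
      · field_simp; linear_combination h2

variable {F : Type*} [Field F]

theorem rel_map {Ω : Type*} [Field Ω] (φ : F →+* Ω) (x : Fin 4 → F) (s t u : Option F) :
    Rel (fun i => φ (x i)) (s.map φ) (t.map φ) (u.map φ) ↔ Rel x s t u := by
  have hp : ∀ s : Option F, param (s.map φ) = (φ (param s).1, φ (param s).2) := by
    intro s; cases s <;> simp [param]
  have : polar (fun i => φ (x i)) (param (s.map φ)) (param (t.map φ)) (param (u.map φ)) =
      φ (polar x (param s) (param t) (param u)) := by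
    simp only [hp, polar, map_add, map_sub, map_mul]
  rw [Rel, Rel, this, map_eq_zero]

variable [Fintype F]

/-- The polynomial `X^q - X` has at most `q` roots, and the `q` elements of `F` are roots. -/
theorem pow_card_eq_self_iff {Ω : Type*} [Field Ω] [Algebra F Ω] (x : Ω) :
    x ^ Nat.card F = x ↔ x ∈ Set.range (algebraMap F Ω) := by
  classical
  rw [Nat.card_eq_fintype_card]
  constructor
  · intro hx
    have h1 : 1 < Fintype.card F := Fintype.one_lt_card
    have hne := FiniteField.X_pow_card_sub_X_ne_zero Ω h1
    have hsub : Finset.univ.image (algebraMap F Ω) ⊆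
        (Polynomial.X ^ Fintype.card F - Polynomial.X : Polynomial Ω).roots.toFinset := by
      intro y hy
      obtain ⟨a, _, rfl⟩ := Finset.mem_image.mp hy
      rw [Multiset.mem_toFinset, Polynomial.mem_roots hne]
      simp [← map_pow, FiniteField.pow_card]
    have hcard : (Polynomial.X ^ Fintype.card F - Polynomial.X : Polynomial Ω).roots.toFinset.card ≤
        (Finset.univ.image (algebraMap F Ω)).card := by
      rw [Finset.card_image_of_injective _ (algebraMap F Ω).injective, Finset.card_univ]
      refine (Multiset.toFinset_card_le _).trans ((Polynomial.card_roots' _).trans ?_)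
      rw [FiniteField.X_pow_card_sub_X_natDegree_eq Ω h1]
    have heq := Finset.eq_of_subset_of_card_le hsub hcard
    have hmem : x ∈ (Polynomial.X ^ Fintype.card F - Polynomial.X : Polynomial Ω).roots.toFinset := by
      rw [Multiset.mem_toFinset, Polynomial.mem_roots hne]
      simp [hx]
    rw [← heq] at hmem
    obtain ⟨a, _, rfl⟩ := Finset.mem_image.mp hmem
    exact ⟨a, rfl⟩
  · rintro ⟨a, rfl⟩
    rw [← map_pow, FiniteField.pow_card]

/-- Write `x = α P(θ) + β P(θ')`. A pair total over `F` stays total over the closure by linearity,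
and evaluation at `θ'` and `θ` isolates `α` and `β`. The brackets with `s` and `t` are nonzero
because neither `θ` nor `θ'` lies in `F`, so `x` would be zero. -/
theorem not_rel_of_mem_imaginaryChord {x : Fin 4 → F} (hx : x ≠ 0)
    {θ : AlgebraicClosure F} (hθ : θ ∉ Set.range (algebraMap F (AlgebraicClosure F)))
    (hθ2 : θ ^ (Nat.card F ^ 2) = θ)
    (hspan : (fun i => algebraMap F (AlgebraicClosure F) (x i)) ∈
      Submodule.span (AlgebraicClosure F)
        {cubicVec (some θ), cubicVec (some (θ ^ Nat.card F))}) (s t : Option F) :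
    ¬ ∀ u, Rel x s t u := by
  intro hD
  set φ := algebraMap F (AlgebraicClosure F) with hφ
  set θ' := θ ^ Nat.card F with hθ'
  have hne : θ ≠ θ' := fun h => hθ ((pow_card_eq_self_iff θ).mp h.symm)
  have hθ'r : θ' ∉ Set.range φ := by
    intro h
    have h1 := (pow_card_eq_self_iff θ').mpr h
    apply hθ
    rw [hθ', ← pow_mul, ← sq, hθ2] at h1
    exact (pow_card_eq_self_iff θ).mp h1.symm
  have hD' : ∀ w, Rel (fun i => φ (x i)) (s.map φ) (t.map φ) w := by
    refine (isPolarity_rel _).all_of_two ((rel_map φ x s t none).mpr (hD none))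
      ((rel_map φ x s t (some 0)).mpr (hD (some 0))) (by simp)
  obtain ⟨α, β, hαβ⟩ := Submodule.mem_span_pair.mp hspan
  have hs : ∀ (s : Option F) (θ), θ ∉ Set.range φ →
      bracket (param (s.map φ)) (param (some θ)) ≠ 0 := by
    intro s θ hθ
    refine bracket_param_ne_zero fun h => hθ ?_
    cases s with
    | none => simp at h
    | some a => exact ⟨a, by simpa using h⟩
  have key : ∀ w, α * (bracket (param (s.map φ)) (param (some θ)) *
      bracket (param (t.map φ)) (param (some θ)) * bracket (param w) (param (some θ))) +
      β * (bracket (param (s.map φ)) (param (some θ')) *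
      bracket (param (t.map φ)) (param (some θ')) * bracket (param w) (param (some θ'))) = 0 := by
    intro w
    have := hD' w
    rw [← hαβ, Rel, polar_add, polar_smul, polar_smul, polar_cubicVec, polar_cubicVec] at this
    exact this
  have hα : α = 0 := by
    have := key (some θ')
    rw [bracket_self, mul_zero, mul_zero, add_zero] at this
    refine (mul_eq_zero.mp this).resolve_right ?_
    exact mul_ne_zero (mul_ne_zero (hs s θ hθ) (hs t θ hθ))
      (bracket_param_ne_zero fun h => hne (Option.some_injective _ h).symm)
  have hβ : β = 0 := by
    have := key (some θ)
    rw [bracket_self, mul_zero, mul_zero, zero_add] at this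
    refine (mul_eq_zero.mp this).resolve_right ?_
    exact mul_ne_zero (mul_ne_zero (hs s θ' hθ'r) (hs t θ' hθ'r))
      (bracket_param_ne_zero fun h => hne (Option.some_injective _ h))
  apply hx
  ext i
  have := congrFun hαβ i
  rw [hα, hβ] at this
  simpa using this.symm

/-- The solutions of the recurrence form a plane of vectors, that is, a projective line. Over the
closure they are combinations of the geometric sequences of the two characteristic roots, which
Frobenius interchanges. -/
theorem exists_imaginaryChord {x : Fin 4 → F} {c₀ c₁ : F}
    (hirr : ∀ τ : F, τ ^ 2 + c₁ * τ + c₀ ≠ 0) (h2 : x 2 = -c₁ * x 1 - c₀ * x 0)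
    (h3 : x 3 = -c₁ * x 2 - c₀ * x 1) : ∃ L, IsImaginaryChord L ∧ x ∈ L := by
  set v : Fin 4 → F := ![1, 0, -c₀, c₀ * c₁] with hv
  set w : Fin 4 → F := ![0, 1, -c₁, c₁ ^ 2 - c₀] with hw
  refine ⟨Submodule.span F {v, w}, ⟨?_, ?_⟩, ?_⟩
  · have hli : LinearIndependent F ![v, w] := by
      rw [LinearIndependent.pair_iff]
      intro a b h
      have e0 := congrFun h 0
      have e1 := congrFun h 1
      simp [hv, hw] at e0 e1
      exact ⟨e0, e1⟩
    have := finrank_span_eq_card hli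
    rwa [Matrix.range_cons_cons_empty, Fintype.card_fin] at this
  · set Ω := AlgebraicClosure F
    set φ := algebraMap F Ω with hφ
    obtain ⟨θ, hθ⟩ := IsAlgClosed.exists_root
      (Polynomial.X ^ 2 + Polynomial.C (φ c₁) * Polynomial.X + Polynomial.C (φ c₀)) (by
        have : (Polynomial.X ^ 2 + Polynomial.C (φ c₁) * Polynomial.X +
          Polynomial.C (φ c₀)).degree = 2 := by compute_degree!
        rw [this]; norm_num)
    have hθ0 : θ ^ 2 + φ c₁ * θ + φ c₀ = 0 := by simpa [Polynomial.IsRoot] using hθ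
    have hrange : θ ∉ Set.range φ := by
      rintro ⟨τ, rfl⟩
      apply hirr τ
      apply φ.injective
      simpa using hθ0
    set σ := FiniteField.frobeniusAlgHom F Ω with hσ
    have hσa : ∀ y, σ y = y ^ Nat.card F := by
      intro y; rw [hσ, FiniteField.coe_frobeniusAlgHom, Nat.card_eq_fintype_card]
    set θ' := θ ^ Nat.card F with hθ'
    have hne : θ ≠ θ' := fun h => hrange ((pow_card_eq_self_iff θ).mp h.symm)
    have hstep : ∀ y, y ^ 2 + φ c₁ * y + φ c₀ = 0 → (σ y) ^ 2 + φ c₁ * σ y + φ c₀ = 0 := by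
      intro y hy
      have := congrArg σ hy
      simpa [hφ] using this
    have hθ'0 : θ' ^ 2 + φ c₁ * θ' + φ c₀ = 0 := by
      have := hstep θ hθ0
      rwa [hσa] at this
    have hsum : φ c₁ = -(θ + θ') := by
      have : (θ - θ') * (φ c₁ + (θ + θ')) = 0 := by linear_combination hθ0 - hθ'0
      have := (mul_eq_zero.mp this).resolve_left (sub_ne_zero.mpr hne)
      linear_combination this
    have hprod : φ c₀ = θ * θ' := by
      rw [hsum] at hθ0; linear_combination hθ0
    refine ⟨θ, ?_, hrange, ?_⟩
    -- Frobenius sends `θ'` to a root, hence to `θ` or `θ'`; the second is impossible because it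
    -- already sends `θ` to `θ'` and is injective.
    · have h4 := hstep θ' hθ'0
      rw [hσa, hsum, hprod] at h4
      have : (θ' ^ Nat.card F - θ) * (θ' ^ Nat.card F - θ') = 0 := by linear_combination h4
      rcases mul_eq_zero.mp this with h | h
      · rw [sq, pow_mul]; exact sub_eq_zero.mp h
      · exfalso
        have : σ θ' = σ θ := by rw [hσa, hσa]; exact sub_eq_zero.mp h
        exact hne (σ.toRingHom.injective this).symm
    · intro y hy
      obtain ⟨a, b, rfl⟩ := Submodule.mem_span_pair.mp hy
      rw [Submodule.mem_span_pair]
      have hd : θ - θ' ≠ 0 := sub_ne_zero.mpr hne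
      rw [← hθ']
      clear_value θ'
      clear hθ'
      -- Cramer's rule on the coordinates 0 and 1, where the two geometric sequences begin with `1,
      -- θ` and `1, θ'`.
      refine ⟨(φ b - θ' * φ a) / (θ - θ'), (θ * φ a - φ b) / (θ - θ'), ?_⟩
      ext i
      fin_cases i <;> simp [cubicVec, hv, hw] <;> field_simp
      · ring
      · ring
      · rw [hsum, hprod]; ring
      · rw [hsum, hprod]; ring
  · rw [Submodule.mem_span_pair]
    refine ⟨x 0, x 1, ?_⟩
    ext i
    fin_cases i <;> simp [hv, hw]
    · rw [h2]; ring
    · rw [h3, h2]; ring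

/-- Imaginary chords avoid real chords and tangents; conversely a vector on neither falls under the
irreducible alternative of `exists_rel_or_irreducible`. -/
theorem mk_mem_icPoints_iff {y : Fin 4 → F} (hy : y ≠ 0) :
    Projectivization.mk F y hy ∈ icPoints F ↔ ∀ s t, ¬ ∀ u, Rel y s t u := by
  simp only [icPoints, Set.mem_ofPred_eq, submodule_mk_le]
  constructor
  · rintro ⟨L, ⟨_, θ, h1, h2, h3⟩, hL⟩ s t
    exact not_rel_of_mem_imaginaryChord hy h2 h1 (h3 y hL) s t
  · intro h
    rcases exists_rel_or_irreducible y with ⟨s, t, hD⟩ | ⟨c₀, c₁, hc, h2, h3⟩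
    · exact absurd hD (h s t)
    · exact exists_imaginaryChord hc h2 h3

end Imaginary

/-! ### Chords, tangents and osculating planes through a point -/

section Values

variable {F : Type*} [Field F] [Fintype F] [DecidableEq F]

/-- Through a point off the cubic passes at most one chord or tangent: two of them, with or without
a common parameter, would make some parameter related to everything. -/
theorem eq_or_eq_of_rel {y : Fin 4 → F} (hy : ¬ OnCone y) {s t s' t' : Option F}
    (h : ∀ u, Rel y s t u) (h' : ∀ u, Rel y s' t' u) :
    (s' = s ∧ t' = t) ∨ (s' = t ∧ t' = s) := by
  have hP := isPolarity_rel y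
  have key : ∀ {a b c : Option F}, (∀ u, Rel y a b u) → (∀ u, Rel y a c u) → b = c :=
    fun h1 h2 => by_contra fun hne => hy (onCone_of_rel (hP.all_of_all_of_all h1 h2 hne))
  by_cases e1 : s' = s
  · subst e1; exact Or.inl ⟨rfl, key h' h⟩
  by_cases e2 : s' = t
  · subst e2; exact Or.inr ⟨rfl, key h' (hP.all_symm h)⟩
  by_cases e3 : t' = t
  · subst e3; exact Or.inl ⟨key (hP.all_symm h') (hP.all_symm h), rfl⟩
  · exact absurd (onCone_of_rel (hP.all_of_disjoint h h' (Ne.symm e3) (Ne.symm e2))) hy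

theorem values_of_tangent {y : Fin 4 → F} (hy : ¬ OnCone y) (h : ∃ s, ∀ u, Rel y s s u) :
    tanNum y = 1 ∧ chordNum y = 0 := by
  obtain ⟨a, ha⟩ := h
  have key : ∀ s t, (∀ u, Rel y s t u) ↔ s = a ∧ t = a := by
    intro s t
    constructor
    · intro h
      have := eq_or_eq_of_rel hy ha h
      tauto
    · rintro ⟨rfl, rfl⟩; exact ha
  constructor
  · simp [tanNum, key]
  · simp only [chordNum, key]
    refine Finset.sum_eq_zero fun s _ => Finset.sum_eq_zero fun t _ => if_neg ?_
    rintro ⟨hst, rfl, rfl⟩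
    exact hst rfl

theorem values_of_chord {y : Fin 4 → F} (hy : ¬ OnCone y)
    (h : ∃ s t, s ≠ t ∧ ∀ u, Rel y s t u) : tanNum y = 0 ∧ chordNum y = 2 := by
  obtain ⟨a, b, hab, ha⟩ := h
  have key : ∀ s t, (∀ u, Rel y s t u) ↔ (s = a ∧ t = b) ∨ (s = b ∧ t = a) := by
    intro s t
    constructor
    · intro h
      exact eq_or_eq_of_rel hy ha h
    · rintro (⟨rfl, rfl⟩ | ⟨rfl, rfl⟩)
      · exact ha
      · exact (isPolarity_rel y).all_symm ha
  constructor
  · simp only [tanNum, key]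
    refine Finset.sum_eq_zero fun s _ => if_neg ?_
    rintro (⟨rfl, h⟩ | ⟨rfl, h⟩)
    · exact hab h
    · exact hab h.symm
  · simp only [chordNum, key]
    have : ∀ s t : Option F, (if s ≠ t ∧ ((s = a ∧ t = b) ∨ (s = b ∧ t = a)) then 1 else 0 : ℤ) =
        (if s = a then if t = b then 1 else 0 else 0) +
          (if s = b then if t = a then 1 else 0 else 0) := by
      intro s t
      by_cases h1 : s = a
      · subst h1
        by_cases h2 : t = b
        · subst h2; simp [hab]
        · simp [h2, hab]
      · by_cases h3 : s = b
        · subst h3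
          by_cases h2 : t = a
          · subst h2; simp [h1]
          · simp [h1, h2]
        · simp [h1, h3]
    simp [this, Finset.sum_add_distrib]

theorem values_of_imaginary {y : Fin 4 → F} (h : ∀ s t, ¬ ∀ u, Rel y s t u) :
    tanNum y = 0 ∧ chordNum y = 0 := by
  simp only [tanNum, chordNum, h, and_false, if_false, Finset.sum_const_zero, and_self]

theorem sum_ne (s : Option F) : (∑ t, if s ≠ t then 1 else 0 : ℤ) = Nat.card F := by
  rw [Finset.sum_boole, Finset.filter_ne, Finset.card_erase_of_mem (Finset.mem_univ _),
    Finset.card_univ, card_option_eq]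
  simp

theorem values_of_cone {c : F} (hc : c ≠ 0) (w : Option F) :
    tanNum (c • cubicVec w) = 1 ∧ chordNum (c • cubicVec w) = 2 * Nat.card F ∧
      oscNum (c • cubicVec w) = 1 := by
  have key : ∀ s t, (∀ u, s = w ∨ t = w ∨ u = w) ↔ s = w ∨ t = w := by
    intro s t
    constructor
    · intro h
      obtain ⟨u, hu⟩ := exists_ne w
      have := h u
      tauto
    · rintro (h | h) u <;> simp [h]
  refine ⟨?_, ?_, ?_⟩
  · simp only [tanNum, rel_smul hc, rel_cubicVec, key, or_self]
    simp
  · simp only [chordNum, rel_smul hc, rel_cubicVec, key]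
    have : ∀ s t : Option F, (if s ≠ t ∧ (s = w ∨ t = w) then 1 else 0 : ℤ) =
        (if s = w then if s ≠ t then 1 else 0 else 0) +
          (if t = w then if t ≠ s then 1 else 0 else 0) := by
      intro s t
      by_cases h1 : s = w
      · by_cases h2 : t = w
        · simp [h1, h2]
        · simp [h1, h2]
      · simp [h1]
        by_cases h2 : t = w
        · subst h2; simp [h1, Ne.symm h1]
        · simp [h2]
    have e1 : (∑ s, ∑ t, if s = w then if s ≠ t then 1 else 0 else 0 : ℤ) = Nat.card F := by
      rw [Finset.sum_eq_single w]
      · simp only [if_true]; exact sum_ne w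
      · intro b _ hb; simp [hb]
      · simp
    have e2 : (∑ s, ∑ t, if t = w then if t ≠ s then 1 else 0 else 0 : ℤ) = Nat.card F := by
      rw [Finset.sum_comm]; exact e1
    simp only [this, Finset.sum_add_distrib, e1, e2]
    ring
  · simp [oscNum, rel_smul hc, rel_cubicVec]

theorem values_zero : tanNum (0 : Fin 4 → F) = Nat.card F + 1 ∧
    chordNum (0 : Fin 4 → F) = Nat.card F * (Nat.card F + 1) ∧
    oscNum (0 : Fin 4 → F) = Nat.card F + 1 := by
  refine ⟨?_, ?_, ?_⟩
  · simp [tanNum, rel_zero]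
  · simp only [chordNum, rel_zero, implies_true, and_true]
    rw [Finset.sum_congr rfl fun s _ => sum_ne s, Finset.sum_const, Finset.card_univ,
      card_option_eq]
    simp; ring
  · simp [oscNum, rel_zero]

/-! ### Double counting -/

theorem sum_ker {V : Type*} [AddCommGroup V] [Module F V] [DecidableEq V]
    (f : (Fin 4 → F) →ₗ[F] V) (hf : Function.Surjective f) (k : ℕ)
    (hk : k + Module.finrank F V = 4) :
    (∑ y, if f y = 0 then 1 else 0 : ℤ) = (Nat.card F : ℤ) ^ k := by
  have h1 := f.finrank_range_add_finrank_ker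
  rw [LinearMap.range_eq_top.mpr hf, finrank_top, Module.finrank_fin_fun] at h1
  have h2 : Module.finrank F (LinearMap.ker f) = k := by omega
  have h3 : Nat.card (LinearMap.ker f) = Nat.card F ^ k := by
    rw [Module.natCard_eq_pow_finrank (K := F), h2]
  rw [Finset.sum_boole, ← Nat.cast_pow, ← h3, ← Fintype.card_subtype,
    ← Nat.card_eq_fintype_card]
  rfl

-- A chord or tangent is cut out by two linear conditions, the form at `(1, 0)` and at `(0, 1)` in
-- the last place; the explicit preimages show that they are independent, also at infinity.
open Classical in
theorem sum_rel_all (s t : Option F) :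
    (∑ y : Fin 4 → F, if ∀ u, Rel y s t u then 1 else 0 : ℤ) = (Nat.card F : ℤ) ^ 2 := by
  set f : (Fin 4 → F) →ₗ[F] F × F := (polarMap (param s) (param t) (1, 0)).prod
    (polarMap (param s) (param t) (0, 1)) with hf
  have h := sum_ker f ?_ 2 (by simp)
  · rw [← h]
    refine Finset.sum_congr rfl fun y _ => ?_
    congr! 1
    constructor
    · intro h
      exact Prod.ext (polar_eq_zero_of_rel h _) (polar_eq_zero_of_rel h _)
    · intro h u
      have h1 : polar y (param s) (param t) (1, 0) = 0 := congrArg Prod.fst h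
      have h2 : polar y (param s) (param t) (0, 1) = 0 := congrArg Prod.snd h
      simp only [Rel, polar] at h1 h2 ⊢
      linear_combination (param u).1 * h1 + (param u).2 * h2
  · rintro ⟨a, b⟩
    cases s with
    | none =>
      cases t with
      | none => exact ⟨![-b, a, 0, 0], by simp [hf, polar, param]⟩
      | some t => exact ⟨![0, b, t * b - a, 0], by simp [hf, polar, param]⟩
    | some s =>
      cases t with
      | none => exact ⟨![0, b, s * b - a, 0], by simp [hf, polar, param]⟩
      | some t => exact ⟨![0, 0, -b, a - (t + s) * b], by simp [hf, polar, param]⟩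

open Classical in
theorem sum_rel_diagonal (s : Option F) :
    (∑ y : Fin 4 → F, if Rel y s s s then 1 else 0 : ℤ) = (Nat.card F : ℤ) ^ 3 := by
  have h := sum_ker (polarMap (param s) (param s) (param s)) ?_ 3 (by simp)
  · rw [← h]
    refine Finset.sum_congr rfl fun y _ => ?_
    congr! 1
  · intro a
    cases s with
    | none => exact ⟨![-a, 0, 0, 0], by simp [polar, param]⟩
    | some s => exact ⟨![0, 0, 0, a], by simp [polar, param]⟩

theorem sum_tanNum : ∑ y : Fin 4 → F, tanNum y = ((Nat.card F : ℤ) + 1) * Nat.card F ^ 2 := by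
  simp only [tanNum]
  rw [Finset.sum_comm, Finset.sum_congr rfl fun s _ => sum_rel_all s s, Finset.sum_const,
    Finset.card_univ, card_option_eq]
  simp

theorem sum_oscNum : ∑ y : Fin 4 → F, oscNum y = ((Nat.card F : ℤ) + 1) * Nat.card F ^ 3 := by
  simp only [oscNum]
  rw [Finset.sum_comm, Finset.sum_congr rfl fun s _ => sum_rel_diagonal s, Finset.sum_const,
    Finset.card_univ, card_option_eq]
  simp

open Classical in
theorem sum_chordNum : ∑ y : Fin 4 → F, chordNum y =
    ((Nat.card F : ℤ) + 1) * Nat.card F * Nat.card F ^ 2 := by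
  simp only [chordNum]
  rw [Finset.sum_comm]
  have : ∀ s t : Option F, (∑ y : Fin 4 → F, if s ≠ t ∧ ∀ u, Rel y s t u then 1 else 0 : ℤ) =
      (if s ≠ t then 1 else 0) * (Nat.card F : ℤ) ^ 2 := by
    intro s t
    rw [← sum_rel_all s t]
    by_cases h : s = t <;> simp [h]
  have h2 : ∀ s : Option F, (∑ y : Fin 4 → F, ∑ t,
      if s ≠ t ∧ ∀ u, Rel y s t u then 1 else 0 : ℤ) = Nat.card F * Nat.card F ^ 2 := by
    intro s
    rw [Finset.sum_comm, Finset.sum_congr rfl fun t _ => this s t, ← Finset.sum_mul, sum_ne]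
  rw [Finset.sum_congr rfl fun s _ => h2 s, Finset.sum_const, Finset.card_univ, card_option_eq]
  simp; ring

/-! ### Vectors of each kind of point, and how many there are -/

/-- The vectors of homogeneous coordinates of the points of `S`. -/
def vecs (S : Set (ℙ F (Fin 4 → F))) : Set (Fin 4 → F) :=
  {y | ∃ h : y ≠ 0, Projectivization.mk F y h ∈ S}

theorem mem_vecs {S : Set (ℙ F (Fin 4 → F))} {y : Fin 4 → F} (hy : y ≠ 0) :
    y ∈ vecs S ↔ Projectivization.mk F y hy ∈ S := ⟨fun ⟨_, h⟩ => h, fun h => ⟨hy, h⟩⟩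

open Classical in
theorem sum_vecs (S : Set (ℙ F (Fin 4 → F))) :
    (∑ y, if y ∈ vecs S then 1 else 0 : ℤ) = (vecs S).ncard := by
  rw [Finset.sum_boole, ← Set.ncard_coe_finset]
  congr 2
  ext y
  simp

theorem zero_notMem_vecs (S : Set (ℙ F (Fin 4 → F))) : (0 : Fin 4 → F) ∉ vecs S :=
  fun ⟨h, _⟩ => h rfl

theorem mem_vecs_cubic {y : Fin 4 → F} : y ∈ vecs (cubic F) ↔ y ≠ 0 ∧ OnCone y :=
  ⟨fun ⟨h, k⟩ => ⟨h, (mk_mem_cubic_iff h).mp k⟩, fun ⟨h, k⟩ => ⟨h, (mk_mem_cubic_iff h).mpr k⟩⟩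

theorem ne_zero_of_not_onCone {y : Fin 4 → F} (hy : ¬ OnCone y) : y ≠ 0 := by
  rintro rfl
  exact hy ⟨none, 0, (zero_smul _ _).symm⟩

theorem mem_vecs_tangentPoints {y : Fin 4 → F} :
    y ∈ vecs (tangentPoints F) ↔ ¬ OnCone y ∧ ∃ s, ∀ u, Rel y s s u :=
  ⟨fun ⟨h, k⟩ => (mk_mem_tangentPoints_iff h).mp k,
    fun k => ⟨ne_zero_of_not_onCone k.1, (mk_mem_tangentPoints_iff _).mpr k⟩⟩

theorem mem_vecs_rcPoints (hF : 3 ≤ Nat.card F) {y : Fin 4 → F} :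
    y ∈ vecs (rcPoints F) ↔ ¬ OnCone y ∧ ∃ s t, s ≠ t ∧ ∀ u, Rel y s t u :=
  ⟨fun ⟨h, k⟩ => (mk_mem_rcPoints_iff hF h).mp k,
    fun k => ⟨ne_zero_of_not_onCone k.1, (mk_mem_rcPoints_iff hF _).mpr k⟩⟩

theorem not_onCone_of_imaginary {y : Fin 4 → F} (h : ∀ s t, ¬ ∀ u, Rel y s t u) :
    ¬ OnCone y := by
  rintro ⟨s, c, rfl⟩
  refine h s s fun u => ?_
  rw [Rel, polar_smul]
  exact mul_eq_zero_of_right _ (rel_cubicVec.mpr (Or.inl rfl))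

theorem mem_vecs_icPoints {y : Fin 4 → F} :
    y ∈ vecs (icPoints F) ↔ ∀ s t, ¬ ∀ u, Rel y s t u :=
  ⟨fun ⟨h, k⟩ => (mk_mem_icPoints_iff h).mp k,
    fun k => ⟨ne_zero_of_not_onCone (not_onCone_of_imaginary k), (mk_mem_icPoints_iff _).mpr k⟩⟩

theorem natCast_oscNum (y : Fin 4 → F) : (({s | Rel y s s s}.ncard : ℕ) : ℤ) = oscNum y := by
  classical
  rw [oscNum, Finset.sum_boole, ← Set.ncard_coe_finset]
  congr 2
  ext s
  simp

theorem mem_vecs_gammaPoints {y : Fin 4 → F} {m : ℕ} :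
    y ∈ vecs (gammaPoints F m) ↔ ¬ OnCone y ∧ oscNum y = m := by
  constructor
  · rintro ⟨h, h1, h2⟩
    rw [mk_mem_cubic_iff] at h1
    rw [osculatingCount_mk] at h2
    exact ⟨h1, by rw [← natCast_oscNum, h2]⟩
  · rintro ⟨h1, h2⟩
    refine ⟨ne_zero_of_not_onCone h1, by rwa [mk_mem_cubic_iff], ?_⟩
    rw [osculatingCount_mk]
    exact_mod_cast (natCast_oscNum y).trans h2

/-- The five kinds of vectors. -/
theorem vector_cases (hF : 3 ≤ Nat.card F) (y : Fin 4 → F) :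
    (y = 0 ∧ y ∉ vecs (cubic F) ∧ y ∉ vecs (tangentPoints F) ∧ y ∉ vecs (rcPoints F) ∧
      y ∉ vecs (icPoints F) ∧ tanNum y = Nat.card F + 1 ∧
      chordNum y = Nat.card F * (Nat.card F + 1) ∧ oscNum y = Nat.card F + 1) ∨
    (y ≠ 0 ∧ y ∈ vecs (cubic F) ∧ y ∉ vecs (tangentPoints F) ∧ y ∉ vecs (rcPoints F) ∧
      y ∉ vecs (icPoints F) ∧ tanNum y = 1 ∧ chordNum y = 2 * Nat.card F ∧ oscNum y = 1) ∨
    (y ≠ 0 ∧ y ∉ vecs (cubic F) ∧ y ∈ vecs (tangentPoints F) ∧ y ∉ vecs (rcPoints F) ∧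
      y ∉ vecs (icPoints F) ∧ tanNum y = 1 ∧ chordNum y = 0) ∨
    (y ≠ 0 ∧ y ∉ vecs (cubic F) ∧ y ∉ vecs (tangentPoints F) ∧ y ∈ vecs (rcPoints F) ∧
      y ∉ vecs (icPoints F) ∧ tanNum y = 0 ∧ chordNum y = 2) ∨
    (y ≠ 0 ∧ y ∉ vecs (cubic F) ∧ y ∉ vecs (tangentPoints F) ∧ y ∉ vecs (rcPoints F) ∧
      y ∈ vecs (icPoints F) ∧ tanNum y = 0 ∧ chordNum y = 0) := by
  by_cases h0 : y = 0
  · left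
    subst h0
    exact ⟨rfl, zero_notMem_vecs _, zero_notMem_vecs _, zero_notMem_vecs _, zero_notMem_vecs _,
      values_zero⟩
  right
  by_cases hc : OnCone y
  · left
    refine ⟨h0, mem_vecs_cubic.mpr ⟨h0, hc⟩, fun h => (mem_vecs_tangentPoints.mp h).1 hc,
      fun h => ((mem_vecs_rcPoints hF).mp h).1 hc,
      fun h => not_onCone_of_imaginary (mem_vecs_icPoints.mp h) hc, ?_⟩
    obtain ⟨w, c, rfl⟩ := hc
    exact values_of_cone (fun h => h0 (by rw [h, zero_smul])) w
  right
  have hcub : y ∉ vecs (cubic F) := fun h => hc (mem_vecs_cubic.mp h).2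
  by_cases ht : ∃ s, ∀ u, Rel y s s u
  · left
    have hv := values_of_tangent hc ht
    refine ⟨h0, hcub, mem_vecs_tangentPoints.mpr ⟨hc, ht⟩, fun h => ?_, fun h => ?_, hv⟩
    · have := (values_of_chord hc ((mem_vecs_rcPoints hF).mp h).2).1
      rw [hv.1] at this
      norm_num at this
    · obtain ⟨s, hs⟩ := ht
      exact mem_vecs_icPoints.mp h s s hs
  right
  have htan : y ∉ vecs (tangentPoints F) := fun h => ht (mem_vecs_tangentPoints.mp h).2
  by_cases hr : ∃ s t, s ≠ t ∧ ∀ u, Rel y s t u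
  · left
    refine ⟨h0, hcub, htan, (mem_vecs_rcPoints hF).mpr ⟨hc, hr⟩, fun h => ?_,
      values_of_chord hc hr⟩
    obtain ⟨s, t, _, hs⟩ := hr
    exact mem_vecs_icPoints.mp h s t hs
  right
  have hi : ∀ s t, ¬ ∀ u, Rel y s t u := by
    intro s t h
    by_cases hst : s = t
    · subst hst; exact ht ⟨s, h⟩
    · exact hr ⟨s, t, hst, h⟩
  exact ⟨h0, hcub, htan, fun h => hr ((mem_vecs_rcPoints hF).mp h).2, mem_vecs_icPoints.mpr hi,
    values_of_imaginary hi⟩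

theorem ncard_vecs_cubic : ((vecs (cubic F)).ncard : ℤ) =
    ((Nat.card F : ℤ) + 1) * (Nat.card F - 1) := by
  have hinj : Function.Injective fun p : Option F × Fˣ => (p.2 : F) • cubicVec p.1 := by
    rintro ⟨s, a⟩ ⟨t, b⟩ h
    simp only at h
    have hst : s = t := by
      have : Rel ((a : F) • cubicVec s) t t t := by
        rw [h, rel_smul b.ne_zero, rel_cubicVec]; simp
      rw [rel_smul a.ne_zero, rel_cubicVec] at this
      tauto
    subst hst
    have := smul_left_injective F (cubicVec_ne_zero s) h
    exact Prod.ext rfl (Units.ext this)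
  have : vecs (cubic F) = (fun p : Option F × Fˣ => (p.2 : F) • cubicVec p.1) '' Set.univ := by
    ext y
    rw [mem_vecs_cubic]
    constructor
    · rintro ⟨h, s, c, rfl⟩
      have hc : c ≠ 0 := by rintro rfl; exact h (zero_smul _ _)
      exact ⟨(s, Units.mk0 c hc), trivial, rfl⟩
    · rintro ⟨⟨s, c⟩, _, rfl⟩
      exact ⟨smul_ne_zero c.ne_zero (cubicVec_ne_zero s), s, c, rfl⟩
  rw [this, Set.ncard_image_of_injective _ hinj, Set.ncard_univ, Nat.card_prod, Nat.card_units,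
    Nat.card_eq_fintype_card, card_option_eq]
  have : 1 ≤ Nat.card F := Nat.card_pos
  push_cast [this]
  ring

open Classical in
theorem ncard_vecs_sum (hF : 3 ≤ Nat.card F) :
    ((vecs (cubic F)).ncard : ℤ) + (vecs (tangentPoints F)).ncard + (vecs (rcPoints F)).ncard +
      (vecs (icPoints F)).ncard = (Nat.card F : ℤ) ^ 4 - 1 := by
  have h : ∀ y : Fin 4 → F, (1 : ℤ) = (if y = 0 then 1 else 0) +
      (if y ∈ vecs (cubic F) then 1 else 0) + (if y ∈ vecs (tangentPoints F) then 1 else 0) +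
      (if y ∈ vecs (rcPoints F) then 1 else 0) + (if y ∈ vecs (icPoints F) then 1 else 0) := by
    intro y
    rcases vector_cases hF y with h | h | h | h | h <;> simp [h.1, h.2.1, h.2.2.1, h.2.2.2.1,
      h.2.2.2.2.1, zero_notMem_vecs]
  have h2 : (∑ y : Fin 4 → F, (1 : ℤ)) = (Nat.card F : ℤ) ^ 4 := by
    simp
  rw [Finset.sum_congr rfl fun y _ => h y] at h2
  simp only [Finset.sum_add_distrib, sum_vecs] at h2
  simp only [Finset.sum_ite_eq', Finset.mem_univ, if_true] at h2
  linarith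

-- Double counting of vectors on tangents: zero lies on all `q + 1`, a nonzero vector of the cubic
-- on one, a vector of `tangentPoints` on one, any other on none.
open Classical in
theorem ncard_vecs_tangentPoints (hF : 3 ≤ Nat.card F) :
    ((vecs (tangentPoints F)).ncard : ℤ) = ((Nat.card F : ℤ) + 1) * (Nat.card F ^ 2 - Nat.card F) := by
  have h : ∀ y : Fin 4 → F, tanNum y = (Nat.card F + 1) * (if y = 0 then 1 else 0) +
      (if y ∈ vecs (cubic F) then 1 else 0) + (if y ∈ vecs (tangentPoints F) then 1 else 0) := by
    intro y
    rcases vector_cases hF y with h | h | h | h | h <;> rw [h.2.2.2.2.2.1] <;>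
      simp [h.1, h.2.1, h.2.2.1, zero_notMem_vecs]
  have h2 := sum_tanNum (F := F)
  rw [Finset.sum_congr rfl fun y _ => h y] at h2
  simp only [Finset.sum_add_distrib, ← Finset.mul_sum, sum_vecs] at h2
  simp only [Finset.sum_ite_eq', Finset.mem_univ, if_true, ncard_vecs_cubic] at h2
  linear_combination h2

-- Double counting with ordered pairs of parameters: zero counts `q (q + 1)` times, a nonzero vector
-- of the cubic `2q` times, a vector of an RC-point twice.
open Classical in
theorem two_mul_ncard_vecs_rcPoints (hF : 3 ≤ Nat.card F) :
    2 * ((vecs (rcPoints F)).ncard : ℤ) =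
      ((Nat.card F : ℤ) + 1) * Nat.card F * (Nat.card F - 1) ^ 2 := by
  have h : ∀ y : Fin 4 → F, chordNum y = Nat.card F * (Nat.card F + 1) * (if y = 0 then 1 else 0) +
      2 * Nat.card F * (if y ∈ vecs (cubic F) then 1 else 0) +
      2 * (if y ∈ vecs (rcPoints F) then 1 else 0) := by
    intro y
    rcases vector_cases hF y with h | h | h | h | h
    · rw [h.2.2.2.2.2.2.1]; simp [h.1, zero_notMem_vecs]
    · rw [h.2.2.2.2.2.2.1]; simp [h.1, h.2.1, h.2.2.2.1]
    all_goals rw [h.2.2.2.2.2.2]; simp [h.1, h.2.1, h.2.2.2.1]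
  have h2 := sum_chordNum (F := F)
  rw [Finset.sum_congr rfl fun y _ => h y] at h2
  simp only [Finset.sum_add_distrib, ← Finset.mul_sum, sum_vecs] at h2
  simp only [Finset.sum_ite_eq', Finset.mem_univ, if_true, ncard_vecs_cubic] at h2
  linear_combination h2

open Classical in
theorem sum_oscNum_of_notMem (hF : 3 ≤ Nat.card F) :
    (∑ y : Fin 4 → F, if OnCone y then 0 else oscNum y) =
      ((Nat.card F : ℤ) + 1) * (Nat.card F ^ 3 - Nat.card F) := by
  have h : ∀ y : Fin 4 → F, (if OnCone y then 0 else oscNum y) = oscNum y -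
      (Nat.card F + 1) * (if y = 0 then 1 else 0) - (if y ∈ vecs (cubic F) then 1 else 0) := by
    intro y
    by_cases hc : OnCone y
    · rcases vector_cases hF y with h | h | h | h | h
      · rw [if_pos hc, h.2.2.2.2.2.2.2]; simp [h.1, zero_notMem_vecs]
      · rw [if_pos hc, h.2.2.2.2.2.2.2]; simp [h.1, h.2.1]
      all_goals exact absurd (mem_vecs_cubic.mpr ⟨h.1, hc⟩) h.2.1
    · have h0 := ne_zero_of_not_onCone hc
      simp [hc, h0, mem_vecs_cubic]
  rw [Finset.sum_congr rfl fun y _ => h y]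
  simp only [Finset.sum_sub_distrib, ← Finset.mul_sum, sum_vecs]
  simp only [Finset.sum_ite_eq', Finset.mem_univ, if_true, ncard_vecs_cubic, sum_oscNum]
  ring

end Values

/-! ### The number of osculating planes through each kind of point -/

section Osculating

variable {F : Type*} [Field F] [Fintype F] [DecidableEq F]

theorem three_ne_zero_of_card (h : Nat.card F % 3 ≠ 0) : (3 : F) ≠ 0 := by
  intro h3
  obtain ⟨p, hp, n, hprime, hn⟩ := FiniteField.card' F
  have hd : p ∣ 3 := (CharP.cast_eq_zero_iff F p 3).mp (by exact_mod_cast h3)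
  have hp3 : p = 3 := (Nat.prime_dvd_prime_iff_eq hprime Nat.prime_three).mp hd
  apply h
  rw [Nat.card_eq_fintype_card, hn, hp3]
  exact Nat.mod_eq_zero_of_dvd (dvd_pow_self 3 n.ne_zero)

theorem charP_three_of_card (h : Nat.card F % 3 = 0) : CharP F 3 := by
  obtain ⟨p, hp, n, hprime, hn⟩ := FiniteField.card' F
  have hd : 3 ∣ p := by
    apply Nat.Prime.dvd_of_dvd_pow Nat.prime_three (n := n)
    rw [← hn, ← Nat.card_eq_fintype_card]
    exact Nat.dvd_of_mod_eq_zero h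
  have hp3 : 3 = p := (Nat.prime_dvd_prime_iff_eq Nat.prime_three hprime).mp hd
  rw [hp3]
  exact hp

theorem oscNum_nonneg (y : Fin 4 → F) : 0 ≤ oscNum y := by
  rw [← natCast_oscNum]; positivity

-- The osculating planes through `y` are the roots of a binary cubic, which is nonzero because 3 is
-- invertible. The root at infinity occurs exactly when the cubic coefficient vanishes, so the total
-- is still at most 3.
open Polynomial in
theorem oscNum_le_three (h3 : (3 : F) ≠ 0) {y : Fin 4 → F} (hy : y ≠ 0) : oscNum y ≤ 3 := by
  classical
  set p : F[X] := C (-y 0) * X ^ 3 + C (3 * y 1) * X ^ 2 + C (-(3 * y 2)) * X + C (y 3) with hp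
  have hp0 : p ≠ 0 := by
    intro h
    apply hy
    have e : ∀ n, p.coeff n = 0 := fun n => by rw [h, coeff_zero]
    have e0 := e 0
    have e1 := e 1
    have e2 := e 2
    have e3 := e 3
    have hco : ∀ a b c d : F, (C a * X ^ 3 + C b * X ^ 2 + C c * X + C d).coeff 0 = d ∧
        (C a * X ^ 3 + C b * X ^ 2 + C c * X + C d).coeff 1 = c ∧
        (C a * X ^ 3 + C b * X ^ 2 + C c * X + C d).coeff 2 = b ∧
        (C a * X ^ 3 + C b * X ^ 2 + C c * X + C d).coeff 3 = a := by
      intro a b c d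
      simp [coeff_X, coeff_C, coeff_X_pow]
    obtain ⟨k0, k1, k2, k3⟩ := hco (-y 0) (3 * y 1) (-(3 * y 2)) (y 3)
    rw [hp, k0] at e0
    rw [hp, k1] at e1
    rw [hp, k2] at e2
    rw [hp, k3] at e3
    have f1 : y 2 = 0 := by simpa [h3] using e1
    have f2 : y 1 = 0 := by simpa [h3] using e2
    have f3 : y 0 = 0 := by simpa using e3
    ext i
    fin_cases i
    exacts [f3, f2, f1, e0]
  have hroots : ∀ t : F, Rel y (some t) (some t) (some t) ↔ t ∈ p.roots.toFinset := by
    intro t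
    rw [Multiset.mem_toFinset, mem_roots hp0, IsRoot.def]
    simp [Rel, polar, param, hp]
    constructor <;> intro h <;> linear_combination h
  have hcard : (p.roots.toFinset.card : ℤ) ≤ p.natDegree := by
    exact_mod_cast (Multiset.toFinset_card_le _).trans (card_roots' p)
  have hsum : oscNum y = (if Rel y none none none then 1 else 0) + p.roots.toFinset.card := by
    rw [oscNum, Fintype.sum_option]
    congr 1
    simp only [hroots]
    rw [Finset.sum_boole, Finset.filter_mem_eq_inter, Finset.univ_inter]
  rw [hsum]
  by_cases h0 : Rel y none none none
  · have hy0 : y 0 = 0 := by simpa [Rel, polar, param] using h0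
    have hd : p.natDegree ≤ 2 := by
      rw [hp, hy0]
      simp only [neg_zero, C_0, zero_mul, zero_add]
      compute_degree
    rw [if_pos h0]
    have : (p.natDegree : ℤ) ≤ 2 := by exact_mod_cast hd
    linarith
  · have hd : p.natDegree ≤ 3 := by
      rw [hp]; compute_degree
    rw [if_neg h0]
    have : (p.natDegree : ℤ) ≤ 3 := by exact_mod_cast hd
    linarith

/-- With `m = oscNum y` and `d = chordNum y - 2 * tanNum y`, the identity for `6 r` gives `2m - 2 +
d ≡ 0` modulo 3 when `q ≡ 1`, and `2m + 2d ≡ 0` when `q ≡ 2`. Here `d` is -2 on tangents, 2 on real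
chords and 0 on imaginary ones. Together with `0 ≤ m ≤ 3` this leaves the stated values. -/
theorem oscNum_values (hF : 3 ≤ Nat.card F) (h3 : Nat.card F % 3 ≠ 0) {y : Fin 4 → F} :
    (y ∈ vecs (tangentPoints F) → oscNum y = 2) ∧
    (y ∈ vecs (rcPoints F) →
      (Nat.card F % 3 = 1 → oscNum y = 0 ∨ oscNum y = 3) ∧
      (Nat.card F % 3 = 2 → oscNum y = 1)) ∧
    (y ∈ vecs (icPoints F) →
      (Nat.card F % 3 = 2 → oscNum y = 0 ∨ oscNum y = 3) ∧
      (Nat.card F % 3 = 1 → oscNum y = 1)) := by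
  by_cases hy : y = 0
  · subst hy
    exact ⟨fun h => absurd h (zero_notMem_vecs _), fun h => absurd h (zero_notMem_vecs _),
      fun h => absurd h (zero_notMem_vecs _)⟩
  have h1 := six_mul_threePlaneCount hF hy
  have h2 := oscNum_le_three (three_ne_zero_of_card h3) hy
  have h4 := oscNum_nonneg y
  generalize (threePlaneCount (Projectivization.mk F y hy) : ℤ) = r at h1
  generalize oscNum y = m at h1 h2 h4 ⊢
  obtain ⟨k, hk⟩ : ∃ k : ℤ, (Nat.card F : ℤ) = 3 * k + 1 ∧ Nat.card F % 3 = 1 ∨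
      (Nat.card F : ℤ) = 3 * k + 2 ∧ Nat.card F % 3 = 2 := by
    refine ⟨(Nat.card F / 3 : ℕ), ?_⟩
    omega
  have hmod : ∀ d : ℤ, chordNum y - 2 * tanNum y = d →
      (Nat.card F % 3 = 1 → ∃ j : ℤ, 3 * j = 2 * m - 2 + d) ∧
      (Nat.card F % 3 = 2 → ∃ j : ℤ, 3 * j = 2 * m + 2 * d) := by
    intro d hd
    rw [hd] at h1
    rcases hk with ⟨hk, hk'⟩ | ⟨hk, hk'⟩
    · refine ⟨fun _ => ⟨2 * r - (3 * k ^ 2 + k) - k * d, ?_⟩, fun h => by omega⟩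
      rw [hk] at h1
      linear_combination h1
    · refine ⟨fun h => by omega, fun _ => ⟨2 * r - (3 * k ^ 2 + 3 * k) - k * d, ?_⟩⟩
      rw [hk] at h1
      linear_combination h1
  refine ⟨fun hm => ?_, fun hm => ?_, fun hm => ?_⟩
  all_goals
    rcases vector_cases hF y with h | h | h | h | h
    any_goals (first | exact absurd hm (by tauto) | skip)
    have h6 := hmod _ rfl
    rw [h.2.2.2.2.2.1, h.2.2.2.2.2.2] at h6
  · rcases hk with hk | hk
    · obtain ⟨j, hj⟩ := h6.1 hk.2
      omega
    · obtain ⟨j, hj⟩ := h6.2 hk.2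
      omega
  · constructor <;> intro hq
    · obtain ⟨j, hj⟩ := h6.1 hq
      omega
    · obtain ⟨j, hj⟩ := h6.2 hq
      omega
  · constructor <;> intro hq
    · obtain ⟨j, hj⟩ := h6.2 hq
      omega
    · obtain ⟨j, hj⟩ := h6.1 hq
      omega

open Classical in
theorem sum_indicator {f : (Fin 4 → F) → ℤ} {A B C : Set (ℙ F (Fin 4 → F))} {a b c : ℤ}
    (h : ∀ y, f y = a * (if y ∈ vecs A then 1 else 0) + b * (if y ∈ vecs B then 1 else 0) +
      c * (if y ∈ vecs C then 1 else 0)) :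
    ∑ y, f y = a * (vecs A).ncard + b * (vecs B).ncard + c * (vecs C).ncard := by
  rw [Finset.sum_congr rfl fun y _ => h y]
  simp only [Finset.sum_add_distrib, ← Finset.mul_sum, sum_vecs]

theorem mem_vecs_iff_of_onCone {y : Fin 4 → F} (h : OnCone y) (m : ℕ) :
    y ∉ vecs (gammaPoints F m) := fun h' => (mem_vecs_gammaPoints.mp h').1 h

/-- The kinds of points when `q ≡ 1 (mod 3)`. -/
theorem class_cases_one (hF : 3 ≤ Nat.card F) (h1 : Nat.card F % 3 = 1) {y : Fin 4 → F}
    (hy : ¬ OnCone y) :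
    (y ∈ vecs (tangentPoints F) ∧ y ∉ vecs (rcPoints F) ∧ y ∉ vecs (icPoints F) ∧
      oscNum y = 2) ∨
    (y ∉ vecs (tangentPoints F) ∧ y ∈ vecs (rcPoints F) ∧ y ∉ vecs (icPoints F) ∧
      oscNum y = 0) ∨
    (y ∉ vecs (tangentPoints F) ∧ y ∈ vecs (rcPoints F) ∧ y ∉ vecs (icPoints F) ∧
      oscNum y = 3) ∨
    (y ∉ vecs (tangentPoints F) ∧ y ∉ vecs (rcPoints F) ∧ y ∈ vecs (icPoints F) ∧
      oscNum y = 1) := by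
  have hv := oscNum_values hF (by omega) (y := y)
  have h0 := ne_zero_of_not_onCone hy
  have hc : y ∉ vecs (cubic F) := fun h => hy (mem_vecs_cubic.mp h).2
  rcases vector_cases hF y with h | h | h | h | h
  · exact absurd h.1 h0
  · exact absurd h.2.1 hc
  · exact Or.inl ⟨h.2.2.1, h.2.2.2.1, h.2.2.2.2.1, hv.1 h.2.2.1⟩
  · rcases (hv.2.1 h.2.2.2.1).1 h1 with k | k
    · exact Or.inr (Or.inl ⟨h.2.2.1, h.2.2.2.1, h.2.2.2.2.1, k⟩)
    · exact Or.inr (Or.inr (Or.inl ⟨h.2.2.1, h.2.2.2.1, h.2.2.2.2.1, k⟩))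
  · exact Or.inr (Or.inr (Or.inr ⟨h.2.2.1, h.2.2.2.1, h.2.2.2.2.1, (hv.2.2 h.2.2.2.2.1).2 h1⟩))

/-- The kinds of points when `q ≡ -1 (mod 3)`. -/
theorem class_cases_two (hF : 3 ≤ Nat.card F) (h2 : Nat.card F % 3 = 2) {y : Fin 4 → F}
    (hy : ¬ OnCone y) :
    (y ∈ vecs (tangentPoints F) ∧ y ∉ vecs (rcPoints F) ∧ y ∉ vecs (icPoints F) ∧
      oscNum y = 2) ∨
    (y ∉ vecs (tangentPoints F) ∧ y ∈ vecs (rcPoints F) ∧ y ∉ vecs (icPoints F) ∧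
      oscNum y = 1) ∨
    (y ∉ vecs (tangentPoints F) ∧ y ∉ vecs (rcPoints F) ∧ y ∈ vecs (icPoints F) ∧
      oscNum y = 0) ∨
    (y ∉ vecs (tangentPoints F) ∧ y ∉ vecs (rcPoints F) ∧ y ∈ vecs (icPoints F) ∧
      oscNum y = 3) := by
  have hv := oscNum_values hF (by omega) (y := y)
  have h0 := ne_zero_of_not_onCone hy
  have hc : y ∉ vecs (cubic F) := fun h => hy (mem_vecs_cubic.mp h).2
  rcases vector_cases hF y with h | h | h | h | h
  · exact absurd h.1 h0
  · exact absurd h.2.1 hc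
  · exact Or.inl ⟨h.2.2.1, h.2.2.2.1, h.2.2.2.2.1, hv.1 h.2.2.1⟩
  · exact Or.inr (Or.inl ⟨h.2.2.1, h.2.2.2.1, h.2.2.2.2.1, (hv.2.1 h.2.2.2.1).2 h2⟩)
  · rcases (hv.2.2 h.2.2.2.2.1).1 h2 with k | k
    · exact Or.inr (Or.inr (Or.inl ⟨h.2.2.1, h.2.2.2.1, h.2.2.2.2.1, k⟩))
    · exact Or.inr (Or.inr (Or.inr ⟨h.2.2.1, h.2.2.2.1, h.2.2.2.2.1, k⟩))

theorem mem_vecs_toPoints {y : Fin 4 → F} :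
    y ∈ vecs (toPoints F) ↔ y ∈ vecs (tangentPoints F) ∧ oscNum y = 1 := by
  constructor
  · rintro ⟨h, h1, h2⟩
    refine ⟨⟨h, h1⟩, ?_⟩
    rw [osculatingCount_mk] at h2
    rw [← natCast_oscNum, h2, Nat.cast_one]
  · rintro ⟨⟨h, h1⟩, h2⟩
    refine ⟨h, h1, ?_⟩
    rw [osculatingCount_mk]
    exact_mod_cast (natCast_oscNum y).trans h2

/-- The kinds of points when `q ≡ 0 (mod 3)`. -/
theorem class_cases_zero (hF : 3 ≤ Nat.card F) (h3 : Nat.card F % 3 = 0) {y : Fin 4 → F}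
    (hy : ¬ OnCone y) :
    (y ∈ vecs (tangentPoints F) ∧ y ∉ vecs (rcPoints F) ∧ y ∉ vecs (icPoints F) ∧
      oscNum y = Nat.card F + 1 ∧ y 0 = 0 ∧ y 3 = 0) ∨
    (y ∈ vecs (tangentPoints F) ∧ y ∉ vecs (rcPoints F) ∧ y ∉ vecs (icPoints F) ∧
      oscNum y = 1 ∧ ¬ (y 0 = 0 ∧ y 3 = 0)) ∨
    (y ∉ vecs (tangentPoints F) ∧ y ∈ vecs (rcPoints F) ∧ y ∉ vecs (icPoints F) ∧
      oscNum y = 1) ∨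
    (y ∉ vecs (tangentPoints F) ∧ y ∉ vecs (rcPoints F) ∧ y ∈ vecs (icPoints F) ∧
      oscNum y = 1) := by
  classical
  have hchar := charP_three_of_card h3
  have h30 : (3 : F) = 0 := by exact_mod_cast CharP.cast_eq_zero F 3
  have h0 := ne_zero_of_not_onCone hy
  have hc : y ∉ vecs (cubic F) := fun h => hy (mem_vecs_cubic.mp h).2
  -- In characteristic 3 the osculating planes are `x_3 = t^3 x_0` and `x_0 = 0`. All contain the
  -- line `x_0 = x_3 = 0`; off this line exactly one passes through a given point, since cubing is
  -- bijective.
  by_cases hz : y 0 = 0 ∧ y 3 = 0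
  · have hosc : oscNum y = Nat.card F + 1 := by
      have : ∀ s, Rel y s s s := by
        intro s
        simp only [Rel, polar, hz.1, hz.2]
        linear_combination (-(param s).1 ^ 2 * (param s).2 * y 2 +
          (param s).1 * (param s).2 ^ 2 * y 1) * h30
      simp [oscNum, this]
    have htan : y ∈ vecs (tangentPoints F) := by
      rw [mem_vecs_tangentPoints]
      refine ⟨hy, ?_⟩
      by_cases h1 : y 1 = 0
      · refine ⟨none, fun u => ?_⟩
        simp [Rel, polar, param, hz.1, h1]
      -- With `y 0 = 0` the contact parameter solves `2 t y_1 = y_2`, and `2 = -1` here.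
      · refine ⟨some (-(y 2 / y 1)), fun u => ?_⟩
        rw [Rel]
        generalize param u = r
        simp only [polar, param, hz.1, hz.2]
        field_simp
        linear_combination y 1 * (r.1 * y 2 ^ 2 - r.2 * y 2 * y 1) * h30
    rcases vector_cases hF y with h | h | h | h | h
    · exact absurd h.1 h0
    · exact absurd h.2.1 hc
    · exact Or.inl ⟨h.2.2.1, h.2.2.2.1, h.2.2.2.2.1, hosc, hz⟩
    · exact absurd htan h.2.2.1
    · exact absurd htan h.2.2.1
  · have hosc : oscNum y = 1 := by
      have key : ∃ a, ∀ s, Rel y s s s ↔ s = a := by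
        by_cases hy0 : y 0 = 0
        · refine ⟨none, fun s => ?_⟩
          cases s with
          | none => simp [Rel, polar, param, hy0]
          | some s =>
            have hy3 : y 3 ≠ 0 := fun h => hz ⟨hy0, h⟩
            have e : polar y (param (some s)) (param (some s)) (param (some s)) = y 3 := by
              simp only [polar, param, hy0]
              linear_combination (-s * y 2 + s ^ 2 * y 1) * h30
            rw [Rel, e]
            simp [hy3]
        · have : Fact (Nat.Prime 3) := ⟨Nat.prime_three⟩
          obtain ⟨a, ha⟩ := (Finite.injective_iff_surjective.mp (frobenius_inj F 3)) (y 3 / y 0)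
          rw [frobenius_def] at ha
          refine ⟨some a, fun s => ?_⟩
          cases s with
          | none => simp [Rel, polar, param, hy0]
          | some s =>
            have e : polar y (param (some s)) (param (some s)) (param (some s)) =
                (a - s) ^ 3 * y 0 := by
              have : y 3 = a ^ 3 * y 0 := by rw [ha]; field_simp
              simp only [polar, param, this]
              linear_combination (-s * y 2 + s ^ 2 * y 1 + a ^ 2 * s * y 0 - a * s ^ 2 * y 0) * h30
            rw [Rel, e, mul_eq_zero, or_iff_left hy0, pow_eq_zero_iff (by norm_num), sub_eq_zero]
            simp [eq_comm]
      obtain ⟨a, ha⟩ := key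
      simp [oscNum, ha]
    rcases vector_cases hF y with h | h | h | h | h
    · exact absurd h.1 h0
    · exact absurd h.2.1 hc
    · exact Or.inr (Or.inl ⟨h.2.2.1, h.2.2.2.1, h.2.2.2.2.1, hosc, hz⟩)
    · exact Or.inr (Or.inr (Or.inl ⟨h.2.2.1, h.2.2.2.1, h.2.2.2.2.1, hosc⟩))
    · exact Or.inr (Or.inr (Or.inr ⟨h.2.2.1, h.2.2.2.1, h.2.2.2.2.1, hosc⟩))

-- Off the cubic, `oscNum` is 2 on T-points, 3 on `3_Γ`-points, 1 on the IC-points or the RC-points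
-- according to `q` modulo 3, and 0 otherwise; its sum and the other sizes are known.
open Classical in
theorem six_mul_ncard_vecs_gamma_three (hF : 3 ≤ Nat.card F) (h3 : Nat.card F % 3 ≠ 0) :
    6 * ((vecs (gammaPoints F 3)).ncard : ℤ) =
      ((Nat.card F : ℤ) ^ 3 - Nat.card F) * (Nat.card F - 1) := by
  have hsum := sum_oscNum_of_notMem hF
  have ht := ncard_vecs_tangentPoints hF
  have hr := two_mul_ncard_vecs_rcPoints hF
  have hall := ncard_vecs_sum hF
  rw [ncard_vecs_cubic] at hall
  obtain h1 | h2 : Nat.card F % 3 = 1 ∨ Nat.card F % 3 = 2 := by omega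
  · rw [sum_indicator (A := tangentPoints F) (B := icPoints F) (C := gammaPoints F 3) (a := 2)
      (b := 1) (c := 3)] at hsum
    · linear_combination 2 * hsum - 2 * ht - 2 * hall + hr
    · intro y
      by_cases hc : OnCone y
      · have e1 : y ∉ vecs (tangentPoints F) := fun h => (mem_vecs_tangentPoints.mp h).1 hc
        have e2 : y ∉ vecs (icPoints F) := fun h =>
          not_onCone_of_imaginary (mem_vecs_icPoints.mp h) hc
        simp [hc, e1, e2, mem_vecs_gammaPoints]
      · rcases class_cases_one hF h1 hc with h | h | h | h <;>
          simp [hc, h.1, h.2.2.1, mem_vecs_gammaPoints, h.2.2.2]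
  · rw [sum_indicator (A := tangentPoints F) (B := rcPoints F) (C := gammaPoints F 3) (a := 2)
      (b := 1) (c := 3)] at hsum
    · linear_combination 2 * hsum - 4 * ht - hr
    · intro y
      by_cases hc : OnCone y
      · have e1 : y ∉ vecs (tangentPoints F) := fun h => (mem_vecs_tangentPoints.mp h).1 hc
        have e2 : y ∉ vecs (rcPoints F) := fun h => ((mem_vecs_rcPoints hF).mp h).1 hc
        simp [hc, e1, e2, mem_vecs_gammaPoints]
      · rcases class_cases_two hF h2 hc with h | h | h | h <;>
          simp [hc, h.1, h.2.1, mem_vecs_gammaPoints, h.2.2.2]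

open Classical in
theorem two_mul_ncard_vecs_icPoints (hF : 3 ≤ Nat.card F) :
    2 * ((vecs (icPoints F)).ncard : ℤ) =
      ((Nat.card F : ℤ) ^ 3 - Nat.card F) * (Nat.card F - 1) := by
  have ht := ncard_vecs_tangentPoints hF
  have hr := two_mul_ncard_vecs_rcPoints hF
  have hall := ncard_vecs_sum hF
  rw [ncard_vecs_cubic] at hall
  linear_combination 2 * hall - 2 * ht - hr

theorem vecs_union (A B : Set (ℙ F (Fin 4 → F))) : vecs (A ∪ B) = vecs A ∪ vecs B := by
  ext y
  constructor
  · rintro ⟨h, k | k⟩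
    · exact Or.inl ⟨h, k⟩
    · exact Or.inr ⟨h, k⟩
  · rintro (⟨h, k⟩ | ⟨h, k⟩)
    · exact ⟨h, Or.inl k⟩
    · exact ⟨h, Or.inr k⟩

theorem ncard_vecs_union {A B : Set (ℙ F (Fin 4 → F))} (h : ∀ y, y ∈ vecs A → y ∉ vecs B) :
    (vecs (A ∪ B)).ncard = (vecs A).ncard + (vecs B).ncard := by
  rw [vecs_union]
  exact Set.ncard_union_eq (Set.disjoint_left.mpr h) (Set.toFinite _) (Set.toFinite _)

theorem set_ext_of_vecs {A B : Set (ℙ F (Fin 4 → F))} (h : ∀ y, y ∈ vecs A ↔ y ∈ vecs B) :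
    A = B := by
  ext P
  induction P using Projectivization.ind with
  | h v hv => rw [← mem_vecs hv, ← mem_vecs hv, h]

theorem mem_vecs_diff {A B : Set (ℙ F (Fin 4 → F))} {y : Fin 4 → F} :
    y ∈ vecs (A \ B) ↔ y ∈ vecs A ∧ y ∉ vecs B := by
  constructor
  · rintro ⟨h, h1, h2⟩
    exact ⟨⟨h, h1⟩, fun ⟨_, k⟩ => h2 k⟩
  · rintro ⟨⟨h, h1⟩, h2⟩
    exact ⟨h, h1, fun k => h2 ⟨h, k⟩⟩

theorem gamma_eq_one (hF : 3 ≤ Nat.card F) (h1 : Nat.card F % 3 = 1) :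
    gammaPoints F 0 = rcPoints F \ gammaPoints F 3 ∧
    gammaPoints F 3 = rcPoints F \ gammaPoints F 0 ∧ gammaPoints F 1 = icPoints F := by
  refine ⟨?_, ?_, ?_⟩ <;> refine set_ext_of_vecs fun y => ?_
  all_goals
    by_cases hc : OnCone y
    · have e1 : y ∉ vecs (rcPoints F) := fun h => ((mem_vecs_rcPoints hF).mp h).1 hc
      have e2 : y ∉ vecs (icPoints F) := fun h =>
          not_onCone_of_imaginary (mem_vecs_icPoints.mp h) hc
      simp [mem_vecs_diff, mem_vecs_gammaPoints, e1, e2, hc]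
    · rcases class_cases_one hF h1 hc with h | h | h | h <;>
        simp [mem_vecs_diff, mem_vecs_gammaPoints, hc, h.2.1, h.2.2.1, h.2.2.2]

theorem gamma_eq_two (hF : 3 ≤ Nat.card F) (h2 : Nat.card F % 3 = 2) :
    gammaPoints F 1 = rcPoints F ∧ gammaPoints F 0 = icPoints F \ gammaPoints F 3 ∧
    gammaPoints F 3 = icPoints F \ gammaPoints F 0 := by
  refine ⟨?_, ?_, ?_⟩ <;> refine set_ext_of_vecs fun y => ?_
  all_goals
    by_cases hc : OnCone y
    · have e1 : y ∉ vecs (rcPoints F) := fun h => ((mem_vecs_rcPoints hF).mp h).1 hc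
      have e2 : y ∉ vecs (icPoints F) := fun h =>
          not_onCone_of_imaginary (mem_vecs_icPoints.mp h) hc
      simp [mem_vecs_diff, mem_vecs_gammaPoints, e1, e2, hc]
    · rcases class_cases_two hF h2 hc with h | h | h | h <;>
        simp [mem_vecs_diff, mem_vecs_gammaPoints, hc, h.2.1, h.2.2.1, h.2.2.2]

/-- The `0_Γ`- and `3_Γ`-points together are the RC-points if `q ≡ 1` and the IC-points if `q ≡ 2`,
so the size follows by subtraction. -/
theorem three_mul_ncard_vecs_gamma_zero (hF : 3 ≤ Nat.card F) (h3 : Nat.card F % 3 ≠ 0) :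
    3 * ((vecs (gammaPoints F 0)).ncard : ℤ) =
      ((Nat.card F : ℤ) ^ 3 - Nat.card F) * (Nat.card F - 1) := by
  have hg := six_mul_ncard_vecs_gamma_three hF h3
  have hdisj : ∀ y, y ∈ vecs (gammaPoints F 0) → y ∉ vecs (gammaPoints F 3) := by
    intro y h h'
    rw [mem_vecs_gammaPoints] at h h'
    have := h.2.symm.trans h'.2
    norm_num at this
  have hu := ncard_vecs_union hdisj
  obtain h1 | h2 : Nat.card F % 3 = 1 ∨ Nat.card F % 3 = 2 := by omega
  · have hr := two_mul_ncard_vecs_rcPoints hF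
    have : gammaPoints F 0 ∪ gammaPoints F 3 = rcPoints F := by
      obtain ⟨e1, e2, _⟩ := gamma_eq_one hF h1
      have : gammaPoints F 3 ⊆ rcPoints F := e2 ▸ Set.sdiff_subset
      rw [e1, Set.sdiff_union_of_subset this]
    rw [this] at hu
    have hu' : ((vecs (rcPoints F)).ncard : ℤ) =
      (vecs (gammaPoints F 0)).ncard + (vecs (gammaPoints F 3)).ncard := by exact_mod_cast hu
    linarith
  · have hr := two_mul_ncard_vecs_icPoints hF
    have : gammaPoints F 0 ∪ gammaPoints F 3 = icPoints F := by
      obtain ⟨_, e1, e2⟩ := gamma_eq_two hF h2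
      have : gammaPoints F 3 ⊆ icPoints F := e2 ▸ Set.sdiff_subset
      rw [e1, Set.sdiff_union_of_subset this]
    rw [this] at hu
    have hu' : ((vecs (icPoints F)).ncard : ℤ) =
      (vecs (gammaPoints F 0)).ncard + (vecs (gammaPoints F 3)).ncard := by exact_mod_cast hu
    linarith

theorem tangentPoints_eq_union (hF : 3 ≤ Nat.card F) (h3 : Nat.card F % 3 = 0) :
    tangentPoints F = gammaPoints F (Nat.card F + 1) ∪ toPoints F := by
  refine set_ext_of_vecs fun y => ?_
  by_cases hc : OnCone y
  · simp [vecs_union, mem_vecs_gammaPoints, mem_vecs_toPoints, mem_vecs_tangentPoints, hc]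
  · rw [vecs_union, Set.mem_union, mem_vecs_toPoints, mem_vecs_gammaPoints]
    have : (Nat.card F : ℤ) ≠ 0 := by omega
    rcases class_cases_zero hF h3 hc with h | h | h | h <;>
      simp_all

-- Off the cubic, `oscNum` minus the indicator of tangent points is `q` on the `(q+1)_Γ`-points, 0
-- on the TO-points, and 1 on RC- and IC-points.
open Classical in
theorem ncard_vecs_gamma_card (hF : 3 ≤ Nat.card F) (h3 : Nat.card F % 3 = 0) :
    ((vecs (gammaPoints F (Nat.card F + 1))).ncard : ℤ) = (Nat.card F : ℤ) ^ 2 - 1 := by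
  have hsum := sum_oscNum_of_notMem hF
  have hall := ncard_vecs_sum hF
  rw [ncard_vecs_cubic] at hall
  have hpos : (Nat.card F : ℤ) ≠ 0 := by omega
  have key : ∑ y : Fin 4 → F, ((if OnCone y then 0 else oscNum y) -
      (if y ∈ vecs (tangentPoints F) then 1 else 0)) =
      (Nat.card F : ℤ) * (vecs (gammaPoints F (Nat.card F + 1))).ncard +
      1 * (vecs (rcPoints F)).ncard + 1 * (vecs (icPoints F)).ncard := by
    apply sum_indicator
    intro y
    by_cases hc : OnCone y
    · have e1 : y ∉ vecs (tangentPoints F) := fun h => (mem_vecs_tangentPoints.mp h).1 hc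
      have e2 : y ∉ vecs (rcPoints F) := fun h => ((mem_vecs_rcPoints hF).mp h).1 hc
      have e3 : y ∉ vecs (icPoints F) := fun h =>
          not_onCone_of_imaginary (mem_vecs_icPoints.mp h) hc
      simp [hc, e1, e2, e3, mem_vecs_gammaPoints]
    · rw [if_neg hc]
      rcases class_cases_zero hF h3 hc with h | h | h | h
      · have hm : y ∈ vecs (gammaPoints F (Nat.card F + 1)) :=
          mem_vecs_gammaPoints.mpr ⟨hc, by push_cast; exact h.2.2.2.1⟩
        rw [h.2.2.2.1, if_pos h.1, if_neg h.2.1, if_neg h.2.2.1, if_pos hm]; ring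
      · have hm : y ∉ vecs (gammaPoints F (Nat.card F + 1)) := by
          rw [mem_vecs_gammaPoints, h.2.2.2.1]; push_cast; omega
        rw [h.2.2.2.1, if_pos h.1, if_neg h.2.1, if_neg h.2.2.1, if_neg hm]; ring
      · have hm : y ∉ vecs (gammaPoints F (Nat.card F + 1)) := by
          rw [mem_vecs_gammaPoints, h.2.2.2]; push_cast; omega
        rw [h.2.2.2, if_neg h.1, if_pos h.2.1, if_neg h.2.2.1, if_neg hm]; ring
      · have hm : y ∉ vecs (gammaPoints F (Nat.card F + 1)) := by
          rw [mem_vecs_gammaPoints, h.2.2.2]; push_cast; omega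
        rw [h.2.2.2, if_neg h.1, if_neg h.2.1, if_pos h.2.2.1, if_neg hm]; ring
  rw [Finset.sum_sub_distrib, hsum, sum_vecs] at key
  apply mul_left_cancel₀ hpos
  linear_combination -key - hall

theorem ncard_vecs_toPoints (hF : 3 ≤ Nat.card F) (h3 : Nat.card F % 3 = 0) :
    ((vecs (toPoints F)).ncard : ℤ) = ((Nat.card F : ℤ) ^ 2 - 1) * (Nat.card F - 1) := by
  have ht := ncard_vecs_tangentPoints hF
  rw [tangentPoints_eq_union hF h3, ncard_vecs_union] at ht
  · push_cast at ht
    rw [ncard_vecs_gamma_card hF h3] at ht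
    linear_combination ht
  · intro y h h'
    rw [mem_vecs_gammaPoints] at h
    rw [mem_vecs_toPoints] at h'
    have := h.2.symm.trans h'.2
    push_cast at this
    omega

end Osculating

/-! ### Projectivities induced by fractional linear maps of the parameter -/

section SymCube

variable {K : Type*} [Field K]

def mob (a b c d : K) (p : K × K) : K × K := (a * p.1 + b * p.2, c * p.1 + d * p.2)

/-- The third symmetric power of a `2 × 2` matrix. -/
def symCube (a b c d : K) : (Fin 4 → K) →ₗ[K] (Fin 4 → K) where
  toFun x := ![a ^ 3 * x 0 + 3 * a ^ 2 * b * x 1 + 3 * a * b ^ 2 * x 2 + b ^ 3 * x 3,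
    a ^ 2 * c * x 0 + (a ^ 2 * d + 2 * a * b * c) * x 1 + (2 * a * b * d + b ^ 2 * c) * x 2
      + b ^ 2 * d * x 3,
    a * c ^ 2 * x 0 + (2 * a * c * d + b * c ^ 2) * x 1 + (a * d ^ 2 + 2 * b * c * d) * x 2
      + b * d ^ 2 * x 3,
    c ^ 3 * x 0 + 3 * c ^ 2 * d * x 1 + 3 * c * d ^ 2 * x 2 + d ^ 3 * x 3]
  map_add' x y := by
    ext i; fin_cases i <;> simp <;> ring
  map_smul' k x := by
    ext i; fin_cases i <;> simp <;> ring

theorem symCube_apply (a b c d : K) (x : Fin 4 → K) : symCube a b c d x =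
    ![a ^ 3 * x 0 + 3 * a ^ 2 * b * x 1 + 3 * a * b ^ 2 * x 2 + b ^ 3 * x 3,
    a ^ 2 * c * x 0 + (a ^ 2 * d + 2 * a * b * c) * x 1 + (2 * a * b * d + b ^ 2 * c) * x 2
      + b ^ 2 * d * x 3,
    a * c ^ 2 * x 0 + (2 * a * c * d + b * c ^ 2) * x 1 + (a * d ^ 2 + 2 * b * c * d) * x 2
      + b * d ^ 2 * x 3,
    c ^ 3 * x 0 + 3 * c ^ 2 * d * x 1 + 3 * c * d ^ 2 * x 2 + d ^ 3 * x 3] := rfl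

theorem symCube_veronese (a b c d : K) (p : K × K) :
    symCube a b c d (veronese p) = veronese (mob a b c d p) := by
  ext i; fin_cases i <;> simp [symCube_apply, veronese, mob] <;> ring

/-- Covariance of the trilinear form with factor `det^3`: the symmetric cube of an invertible matrix
transports every incidence expressed by `Rel`. -/
theorem polar_symCube (a b c d : K) (x : Fin 4 → K) (p q r : K × K) :
    polar (symCube a b c d x) (mob a b c d p) (mob a b c d q) (mob a b c d r) =
      (a * d - b * c) ^ 3 * polar x p q r := by
  simp only [polar, symCube_apply, mob, Matrix.cons_val]
  ring

/-- The third symmetric power is multiplicative, and the adjugate times the matrix is the scalar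
`det`. -/
theorem symCube_adjugate (a b c d : K) (x : Fin 4 → K) :
    symCube d (-b) (-c) a (symCube a b c d x) = (a * d - b * c) ^ 3 • x := by
  ext i
  fin_cases i <;> simp [symCube_apply] <;> ring

theorem symCube_injective {a b c d : K} (h : a * d - b * c ≠ 0) :
    Function.Injective (symCube a b c d) := by
  intro x y hxy
  have := congrArg (symCube d (-b) (-c) a) hxy
  rw [symCube_adjugate, symCube_adjugate] at this
  exact smul_right_injective _ (pow_ne_zero 3 h) this

theorem rel_symCube {a b c d : K} (h : a * d - b * c ≠ 0) (x : Fin 4 → K)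
    {s t u s' t' u' : Option K} {k l m : K} (hk : k ≠ 0) (hl : l ≠ 0) (hm : m ≠ 0)
    (hs : mob a b c d (param s) = k • param s') (ht : mob a b c d (param t) = l • param t')
    (hu : mob a b c d (param u) = m • param u') :
    Rel (symCube a b c d x) s' t' u' ↔ Rel x s t u := by
  have := polar_symCube a b c d x (param s) (param t) (param u)
  rw [hs, ht, hu, polar_smul_smul_smul] at this
  rw [Rel, Rel]
  constructor
  · intro h0
    rw [h0, mul_zero] at this
    exact (mul_eq_zero.mp this.symm).resolve_left (pow_ne_zero 3 h)
  · intro h0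
    rw [h0, mul_zero] at this
    exact (mul_eq_zero.mp this).resolve_left (mul_ne_zero (mul_ne_zero hk hl) hm)

theorem mob_ne_zero {a b c d : K} (h : a * d - b * c ≠ 0) {p : K × K} (hp : p ≠ 0) :
    mob a b c d p ≠ 0 := by
  intro h0
  apply hp
  have h1 : a * p.1 + b * p.2 = 0 := congrArg Prod.fst h0
  have h2 : c * p.1 + d * p.2 = 0 := congrArg Prod.snd h0
  have e1 : (a * d - b * c) * p.1 = 0 := by linear_combination d * h1 - b * h2
  have e2 : (a * d - b * c) * p.2 = 0 := by linear_combination a * h2 - c * h1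
  exact Prod.ext ((mul_eq_zero.mp e1).resolve_left h) ((mul_eq_zero.mp e2).resolve_left h)

/-- The projective line is sharply 3-transitive; here only the existence. -/
theorem exists_mob {s t u : Option K} (hst : s ≠ t) (hsu : s ≠ u) (htu : t ≠ u) :
    ∃ a b c d k l m : K, a * d - b * c ≠ 0 ∧ k ≠ 0 ∧ l ≠ 0 ∧ m ≠ 0 ∧
      mob a b c d (param s) = k • param none ∧ mob a b c d (param t) = l • param (some 0) ∧
      mob a b c d (param u) = m • param (some 1) := by
  have h1 := bracket_param_ne_zero hst
  have h2 := bracket_param_ne_zero hsu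
  have h3 := bracket_param_ne_zero htu
  generalize param s = s at *
  generalize param t = t at *
  generalize param u = u at *
  -- The map is `p ↦ ([t,u][s,p], [s,u][t,p])`: its coordinates vanish at `s` and `t` respectively,
  -- and agree at `u`.
  refine ⟨-(bracket t u * s.2), bracket t u * s.1, -(bracket s u * t.2), bracket s u * t.1,
    -(bracket s u * bracket s t), bracket t u * bracket s t, bracket t u * bracket s u,
    ?_, ?_, ?_, ?_, ?_, ?_, ?_⟩
  · have : -(bracket t u * s.2) * (bracket s u * t.1) - bracket t u * s.1 * -(bracket s u * t.2) =
        bracket t u * bracket s u * bracket s t := by simp only [bracket]; ring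
    rw [this]
    exact mul_ne_zero (mul_ne_zero h3 h2) h1
  · simpa using ⟨h2, h1⟩
  · exact mul_ne_zero h3 h1
  · exact mul_ne_zero h3 h2
  all_goals
    apply Prod.ext <;> simp [mob, param, bracket]
  all_goals ring

end SymCube

/-! ### Orbits and invariants of the group of the cubic -/

section Orbits

variable {F : Type*} [Field F] [Fintype F] [DecidableEq F]

theorem symCube_cubicVec {a b c d : F} (h : a * d - b * c ≠ 0) (s : Option F) :
    ∃ (t : Option F) (k : F), k ≠ 0 ∧ symCube a b c d (cubicVec s) = k • cubicVec t := by
  obtain ⟨k, t, hk, ht⟩ := exists_smul_param (mob_ne_zero h (param_ne_zero s))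
  exact ⟨t, k ^ 3, pow_ne_zero 3 hk, by
    rw [cubicVec_eq_veronese, symCube_veronese, ht, veronese_smul, ← cubicVec_eq_veronese]⟩

/-- Two vectors represent points in the same orbit of the group of the cubic. -/
def SameOrbit (x y : Fin 4 → F) : Prop :=
  ∃ (hx : x ≠ 0) (hy : y ≠ 0), Projectivization.mk F y hy ∈
    MulAction.orbit (cubicGroup F) (Projectivization.mk F x hx)

theorem SameOrbit.symm {x y : Fin 4 → F} (h : SameOrbit x y) : SameOrbit y x := by
  obtain ⟨hx, hy, h⟩ := h
  exact ⟨hy, hx, MulAction.mem_orbit_symm.mp h⟩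

theorem SameOrbit.trans {x y z : Fin 4 → F} (h : SameOrbit x y) (h' : SameOrbit y z) :
    SameOrbit x z := by
  obtain ⟨hx, hy, h⟩ := h
  obtain ⟨_, hz, h'⟩ := h'
  refine ⟨hx, hz, ?_⟩
  rw [← MulAction.orbit_eq_iff] at h h' ⊢
  exact h'.trans h

theorem sameOrbit_symCube {a b c d : F} (h : a * d - b * c ≠ 0) {x : Fin 4 → F} (hx : x ≠ 0) :
    SameOrbit x (symCube a b c d x) := by
  set g : (Fin 4 → F) ≃ₗ[F] (Fin 4 → F) :=
    LinearEquiv.ofInjectiveEndo (symCube a b c d) (symCube_injective h) with hg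
  have hgx : ∀ x, g x = symCube a b c d x := fun x => rfl
  have hx' : symCube a b c d x ≠ 0 := by
    rw [← hgx]; exact (LinearEquiv.map_ne_zero_iff g).mpr hx
  set σ : Equiv.Perm (ℙ F (Fin 4 → F)) := MulAction.toPerm g with hσ
  have hsub : σ '' cubic F ⊆ cubic F := by
    rintro _ ⟨_, ⟨s, rfl⟩, rfl⟩
    obtain ⟨t, k, hk, ht⟩ := symCube_cubicVec h s
    rw [hσ, MulAction.toPerm_apply, cubicPoint, Projectivization.smul_mk, mk_mem_cubic_iff]
    exact ⟨t, k, ht⟩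
  have hfin : (cubic F).Finite := Set.finite_range _
  have himage : σ '' cubic F = cubic F := by
    -- An injection of the finite cubic into itself is onto.
    refine Set.eq_of_subset_of_ncard_le hsub ?_ hfin
    rw [Set.ncard_image_of_injective _ σ.injective]
  have hmem : σ ∈ cubicGroup F := ⟨⟨g, fun P => rfl⟩, himage⟩
  exact ⟨hx, hx', ⟨⟨σ, hmem⟩, rfl⟩⟩

theorem sameOrbit_smul {x : Fin 4 → F} (hx : x ≠ 0) {c : F} (hc : c ≠ 0) :
    SameOrbit x (c • x) := by
  refine ⟨hx, smul_ne_zero hc hx, ?_⟩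
  have : Projectivization.mk F (c • x) (smul_ne_zero hc hx) = Projectivization.mk F x hx := by
    rw [Projectivization.mk_eq_mk_iff']
    exact ⟨c, rfl⟩
  rw [this]
  exact MulAction.mem_orbit_self _

theorem sameOrbit_of_symCube_eq {a b c d : F} (h : a * d - b * c ≠ 0) {x y : Fin 4 → F}
    (hx : x ≠ 0) (hy : y ≠ 0) {k : F} (hxy : symCube a b c d x = k • y) : SameOrbit x y := by
  have h1 := sameOrbit_symCube h hx
  have hk : k ≠ 0 := by
    rintro rfl
    obtain ⟨_, h2, _⟩ := h1
    exact h2 (by rw [hxy, zero_smul])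
  rw [hxy] at h1
  exact h1.trans (sameOrbit_smul hy hk).symm

/-- Invariance of a set of points under the group of the cubic, in terms of coordinates. -/
def IsInvariant (S : Set (ℙ F (Fin 4 → F))) : Prop :=
  ∀ σ ∈ cubicGroup F, ∀ P ∈ S, σ P ∈ S

theorem IsInvariant.mem_vecs {S : Set (ℙ F (Fin 4 → F))} (hS : IsInvariant S) {x y : Fin 4 → F}
    (h : SameOrbit x y) (hx : x ∈ vecs S) : y ∈ vecs S := by
  obtain ⟨h1, h2, ⟨σ, hσ⟩, h3⟩ := h
  obtain ⟨_, hx⟩ := hx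
  refine ⟨h2, ?_⟩
  rw [← h3]
  exact hS σ hσ _ hx

theorem isPointOrbit_of {S : Set (ℙ F (Fin 4 → F))} (hS : IsInvariant S)
    (hne : 0 < (vecs S).ncard) (h : ∀ x ∈ vecs S, ∀ y ∈ vecs S, SameOrbit x y) :
    IsPointOrbit S := by
  obtain ⟨x, hx0, hx⟩ := (Set.ncard_pos (Set.toFinite _)).mp hne
  refine ⟨Projectivization.mk F x hx0, Set.Subset.antisymm (fun Q hQ => ?_) ?_⟩
  · induction Q using Projectivization.ind with
    | h y hy => exact (h x ⟨hx0, hx⟩ y ⟨hy, hQ⟩).2.2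
  · rintro _ ⟨⟨σ, hσ⟩, rfl⟩
    exact hS σ hσ _ hx

theorem isPointOrbit_of_canonical {S : Set (ℙ F (Fin 4 → F))} (hS : IsInvariant S)
    (hne : 0 < (vecs S).ncard) (z : Fin 4 → F) (h : ∀ x ∈ vecs S, SameOrbit x z) :
    IsPointOrbit S :=
  isPointOrbit_of hS hne fun x hx y hy => (h x hx).trans (h y hy).symm

theorem isInvariant_cubic : IsInvariant (cubic F) := by
  rintro σ ⟨_, hσ⟩ P hP
  rw [← hσ]
  exact ⟨P, hP, rfl⟩

theorem isInvariant_compl {S : Set (ℙ F (Fin 4 → F))} (hS : IsInvariant S) : IsInvariant Sᶜ := by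
  intro σ hσ P hP h
  have := hS _ (inv_mem hσ) _ h
  exact hP (by simpa using this)

theorem SameOrbit.onCone_iff {x y : Fin 4 → F} (h : SameOrbit x y) : OnCone x ↔ OnCone y := by
  have h1 := fun hx => isInvariant_cubic.mem_vecs h hx
  have h2 := fun hx => isInvariant_cubic.mem_vecs h.symm hx
  rw [mem_vecs_cubic, mem_vecs_cubic] at h1 h2
  exact ⟨fun k => (h1 ⟨h.1, k⟩).2, fun k => (h2 ⟨h.2.1, k⟩).2⟩

theorem smul_submodule_le_iff (g : (Fin 4 → F) ≃ₗ[F] (Fin 4 → F)) (P : ℙ F (Fin 4 → F))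
    (π : Submodule F (Fin 4 → F)) :
    (g • P).submodule ≤ π.map (g : (Fin 4 → F) →ₗ[F] (Fin 4 → F)) ↔ P.submodule ≤ π := by
  induction P using Projectivization.ind with
  | h v hv =>
    rw [Projectivization.smul_mk, submodule_mk_le, submodule_mk_le]
    rw [Submodule.mem_map_equiv, LinearEquiv.smul_def, LinearEquiv.symm_apply_apply]

/-- The planes that contain exactly three points of the cubic. -/
def threePlanes (F : Type*) [Field F] : Set (Submodule F (Fin 4 → F)) :=
  {π | Module.finrank F π = 3 ∧
    {Q : ℙ F (Fin 4 → F) | Q ∈ cubic F ∧ Q.submodule ≤ π}.ncard = 3}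

theorem map_mem_threePlanes {σ : Equiv.Perm (ℙ F (Fin 4 → F))}
    {g : (Fin 4 → F) ≃ₗ[F] (Fin 4 → F)} (hg : ∀ P, σ P = g • P) (hσ : σ '' cubic F = cubic F)
    {π : Submodule F (Fin 4 → F)} (hπ : π ∈ threePlanes F) :
    π.map (g : (Fin 4 → F) →ₗ[F] (Fin 4 → F)) ∈ threePlanes F := by
  refine ⟨by rw [LinearEquiv.finrank_map_eq, hπ.1], ?_⟩
  have himage := Set.ncard_image_of_injective
    {Q : ℙ F (Fin 4 → F) | Q ∈ cubic F ∧ Q.submodule ≤ π} σ.injective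
  rw [← hπ.2, ← himage]
  congr 1
  ext Q
  constructor
  · rintro ⟨h1, h2⟩
    rw [← hσ] at h1
    obtain ⟨P, hP, rfl⟩ := h1
    rw [hg, smul_submodule_le_iff] at h2
    exact ⟨P, ⟨hP, h2⟩, rfl⟩
  · rintro ⟨P, ⟨h1, h2⟩, rfl⟩
    refine ⟨hσ ▸ ⟨P, h1, rfl⟩, ?_⟩
    rw [hg, smul_submodule_le_iff]
    exact h2

/-- A group element maps the three-point planes through `P` injectively to three-point planes
through its image. -/
theorem threePlaneCount_le {σ : Equiv.Perm (ℙ F (Fin 4 → F))} (hσ : σ ∈ cubicGroup F)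
    (P : ℙ F (Fin 4 → F)) : threePlaneCount P ≤ threePlaneCount (σ P) := by
  obtain ⟨⟨g, hg⟩, hσ⟩ := hσ
  have hinj : Function.Injective
      (Submodule.map (g : (Fin 4 → F) →ₗ[F] (Fin 4 → F))) :=
    Submodule.map_injective_of_injective g.injective
  rw [threePlaneCount, ← Set.ncard_image_of_injective _ hinj]
  refine Set.ncard_le_ncard ?_ (Set.toFinite _)
  rintro _ ⟨π, ⟨h1, h2, h3⟩, rfl⟩
  have := map_mem_threePlanes hg hσ (π := π) ⟨h1, h2⟩
  refine ⟨this.1, this.2, ?_⟩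
  rw [hg, smul_submodule_le_iff]
  exact h3

theorem threePlaneCount_apply {σ : Equiv.Perm (ℙ F (Fin 4 → F))} (hσ : σ ∈ cubicGroup F)
    (P : ℙ F (Fin 4 → F)) : threePlaneCount (σ P) = threePlaneCount P := by
  refine le_antisymm ?_ (threePlaneCount_le hσ P)
  have := threePlaneCount_le (inv_mem hσ) (σ P)
  simpa using this

/-- The part of `6 r(P)` that depends on the kind of `P`. -/
noncomputable def signature (y : Fin 4 → F) : ℤ :=
  2 * oscNum y + Nat.card F * (chordNum y - 2 * tanNum y)

/-- Nothing is assumed about a group element beyond linearity and preservation of the cubic. Both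
`r` and membership in the cubic are preserved, and `r` determines the signature. -/
theorem isInvariant_of_signature (hF : 3 ≤ Nat.card F) {S : Set (ℙ F (Fin 4 → F))}
    (hS : ∀ y ∈ vecs S, ¬ OnCone y) (h : ∀ x y, x ∈ vecs S → ¬ OnCone y →
      signature x = signature y → y ∈ vecs S) : IsInvariant S := by
  intro σ hσ P hP
  have hr := threePlaneCount_apply hσ P
  have hc := isInvariant_compl isInvariant_cubic σ hσ P
  generalize σ P = Q at *
  induction P using Projectivization.ind with
  | h x hx =>
    induction Q using Projectivization.ind with
    | h y hy =>
      rw [← mem_vecs hy]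
      rw [← mem_vecs hx] at hP
      rw [Set.mem_compl_iff, Set.mem_compl_iff, mk_mem_cubic_iff, mk_mem_cubic_iff] at hc
      refine h x y hP (hc (hS x hP)) ?_
      have h1 := six_mul_threePlaneCount hF hx
      have h2 := six_mul_threePlaneCount hF hy
      rw [hr, h1] at h2
      simp only [signature]
      linarith

theorem values_of_mem_tangentPoints {y : Fin 4 → F} (h : y ∈ vecs (tangentPoints F)) :
    tanNum y = 1 ∧ chordNum y = 0 :=
  values_of_tangent (mem_vecs_tangentPoints.mp h).1 (mem_vecs_tangentPoints.mp h).2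

theorem values_of_mem_rcPoints (hF : 3 ≤ Nat.card F) {y : Fin 4 → F}
    (h : y ∈ vecs (rcPoints F)) : tanNum y = 0 ∧ chordNum y = 2 :=
  values_of_chord ((mem_vecs_rcPoints hF).mp h).1 ((mem_vecs_rcPoints hF).mp h).2

theorem values_of_mem_icPoints {y : Fin 4 → F} (h : y ∈ vecs (icPoints F)) :
    tanNum y = 0 ∧ chordNum y = 0 :=
  values_of_imaginary (mem_vecs_icPoints.mp h)

theorem signature_cases_one (hF : 3 ≤ Nat.card F) (h1 : Nat.card F % 3 = 1) {y : Fin 4 → F}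
    (hy : ¬ OnCone y) :
    (y ∈ vecs (tangentPoints F) ∧ oscNum y = 2 ∧ signature y = 4 - 2 * Nat.card F) ∨
    (y ∉ vecs (tangentPoints F) ∧ oscNum y = 0 ∧ signature y = 2 * Nat.card F) ∨
    (y ∉ vecs (tangentPoints F) ∧ oscNum y = 3 ∧ signature y = 6 + 2 * Nat.card F) ∨
    (y ∉ vecs (tangentPoints F) ∧ oscNum y = 1 ∧ signature y = 2) := by
  rcases class_cases_one hF h1 hy with h | h | h | h
  · have hv := values_of_mem_tangentPoints h.1
    exact Or.inl ⟨h.1, h.2.2.2, by rw [signature, h.2.2.2, hv.1, hv.2]; ring⟩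
  · have hv := values_of_mem_rcPoints hF h.2.1
    exact Or.inr (Or.inl ⟨h.1, h.2.2.2, by rw [signature, h.2.2.2, hv.1, hv.2]; ring⟩)
  · have hv := values_of_mem_rcPoints hF h.2.1
    exact Or.inr (Or.inr (Or.inl ⟨h.1, h.2.2.2, by rw [signature, h.2.2.2, hv.1, hv.2]; ring⟩))
  · have hv := values_of_mem_icPoints h.2.2.1
    exact Or.inr (Or.inr (Or.inr ⟨h.1, h.2.2.2, by rw [signature, h.2.2.2, hv.1, hv.2]; ring⟩))

theorem signature_cases_two (hF : 3 ≤ Nat.card F) (h2 : Nat.card F % 3 = 2) {y : Fin 4 → F}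
    (hy : ¬ OnCone y) :
    (y ∈ vecs (tangentPoints F) ∧ oscNum y = 2 ∧ signature y = 4 - 2 * Nat.card F) ∨
    (y ∉ vecs (tangentPoints F) ∧ oscNum y = 1 ∧ signature y = 2 + 2 * Nat.card F) ∨
    (y ∉ vecs (tangentPoints F) ∧ oscNum y = 0 ∧ signature y = 0) ∨
    (y ∉ vecs (tangentPoints F) ∧ oscNum y = 3 ∧ signature y = 6) := by
  rcases class_cases_two hF h2 hy with h | h | h | h
  · have hv := values_of_mem_tangentPoints h.1
    exact Or.inl ⟨h.1, h.2.2.2, by rw [signature, h.2.2.2, hv.1, hv.2]; ring⟩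
  · have hv := values_of_mem_rcPoints hF h.2.1
    exact Or.inr (Or.inl ⟨h.1, h.2.2.2, by rw [signature, h.2.2.2, hv.1, hv.2]; ring⟩)
  · have hv := values_of_mem_icPoints h.2.2.1
    exact Or.inr (Or.inr (Or.inl ⟨h.1, h.2.2.2, by rw [signature, h.2.2.2, hv.1, hv.2]; ring⟩))
  · have hv := values_of_mem_icPoints h.2.2.1
    exact Or.inr (Or.inr (Or.inr ⟨h.1, h.2.2.2, by rw [signature, h.2.2.2, hv.1, hv.2]; ring⟩))

/-- For `q ≥ 5` the four values of the signature in each residue class are pairwise distinct. -/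
theorem eq_of_signature_eq (hF : 5 ≤ Nat.card F) (h3 : Nat.card F % 3 ≠ 0) {x y : Fin 4 → F}
    (hx : ¬ OnCone x) (hy : ¬ OnCone y) (h : signature x = signature y) :
    (x ∈ vecs (tangentPoints F) ↔ y ∈ vecs (tangentPoints F)) ∧ oscNum x = oscNum y := by
  obtain h1 | h2 : Nat.card F % 3 = 1 ∨ Nat.card F % 3 = 2 := by omega
  · rcases signature_cases_one (by omega) h1 hx with hx | hx | hx | hx <;>
    rcases signature_cases_one (by omega) h1 hy with hy | hy | hy | hy <;>
    first
    | exact ⟨iff_of_true hx.1 hy.1, hx.2.1.trans hy.2.1.symm⟩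
    | exact ⟨iff_of_false hx.1 hy.1, hx.2.1.trans hy.2.1.symm⟩
    | omega
  · rcases signature_cases_two (by omega) h2 hx with hx | hx | hx | hx <;>
    rcases signature_cases_two (by omega) h2 hy with hy | hy | hy | hy <;>
    first
    | exact ⟨iff_of_true hx.1 hy.1, hx.2.1.trans hy.2.1.symm⟩
    | exact ⟨iff_of_false hx.1 hy.1, hx.2.1.trans hy.2.1.symm⟩
    | omega

theorem isInvariant_tangentPoints (hF : 5 ≤ Nat.card F) (h3 : Nat.card F % 3 ≠ 0) :
    IsInvariant (tangentPoints F) :=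
  isInvariant_of_signature (by omega) (fun _ h => (mem_vecs_tangentPoints.mp h).1)
    fun _ _ hx hy h =>
      (eq_of_signature_eq hF h3 (mem_vecs_tangentPoints.mp hx).1 hy h).1.mp hx

theorem isInvariant_gammaPoints (hF : 5 ≤ Nat.card F) (h3 : Nat.card F % 3 ≠ 0) (m : ℕ) :
    IsInvariant (gammaPoints F m) := by
  refine isInvariant_of_signature (by omega) (fun _ h => (mem_vecs_gammaPoints.mp h).1)
    fun x y hx hy h => ?_
  rw [mem_vecs_gammaPoints] at hx ⊢
  exact ⟨hy, (eq_of_signature_eq hF h3 hx.1 hy h).2 ▸ hx.2⟩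

end Orbits

/-! ### Irreducible quadratic and cubic polynomials over a finite field -/

section Irreducible

open Polynomial

universe u

variable {F : Type u} [Field F]

/-- Finite extensions of `F` of equal degree embed in each other, so the field obtained by adjoining
a root of `f` also contains a root of `g`. -/
theorem exists_roots_in_common_field [Finite F] {f g : F[X]} (hf : Irreducible f)
    (hg : Irreducible g) (hdeg : f.natDegree = g.natDegree) :
    ∃ (K : Type u) (_ : Field K) (_ : Algebra F K) (θ φ : K),
      Module.finrank F K = f.natDegree ∧ aeval θ f = 0 ∧ aeval φ g = 0 := by
  have := Fact.mk hf
  have := Fact.mk hg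
  have e1 : Module.finrank F (AdjoinRoot f) = f.natDegree := finrank_quotient_span_eq_natDegree
  have e2 : Module.finrank F (AdjoinRoot g) = g.natDegree := finrank_quotient_span_eq_natDegree
  have : Module.Finite F (AdjoinRoot f) := (AdjoinRoot.powerBasis hf.ne_zero).finite
  have : Finite (AdjoinRoot f) := Module.finite_of_finite F
  obtain ⟨ψ⟩ := FiniteField.nonempty_algHom_of_finrank_dvd (F := F) (K := AdjoinRoot g)
    (L := AdjoinRoot f) (by rw [e1, e2, hdeg])
  refine ⟨AdjoinRoot f, inferInstance, inferInstance, AdjoinRoot.root f, ψ (AdjoinRoot.root g),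
    e1, ?_, ?_⟩
  · rw [AdjoinRoot.aeval_eq, AdjoinRoot.mk_self]
  · rw [aeval_algHom_apply, AdjoinRoot.aeval_eq, AdjoinRoot.mk_self, map_zero]

/-- A nonzero `p` of smaller degree is coprime to `f`; a Bézout relation evaluated at `θ` would read
`0 = 1`. -/
theorem eq_zero_of_aeval_eq_zero {K : Type*} [Field K] [Algebra F K] {f p : F[X]}
    (hf : Irreducible f) {θ : K} (hθ : aeval θ f = 0) (hp : aeval θ p = 0)
    (hdeg : p.natDegree < f.natDegree) : p = 0 := by
  by_contra hp0
  have hnd : ¬ f ∣ p := fun h => absurd (natDegree_le_of_dvd h hp0) (not_le.mpr hdeg)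
  obtain ⟨u, v, huv⟩ := (hf.coprime_iff_not_dvd).mpr hnd
  have := congrArg (aeval θ) huv
  simp [hθ, hp] at this

theorem exists_relation {K : Type*} [Field K] [Algebra F K] {n : ℕ} (w : Fin n → K)
    (hn : Module.finrank F K < n) (hpos : 0 < Module.finrank F K) :
    ∃ c : Fin n → F, (∑ i, c i • w i = 0) ∧ c ≠ 0 := by
  have := Module.finite_of_finrank_pos hpos
  have hli : ¬ LinearIndependent F w := fun h => by
    have := h.fintype_card_le_finrank
    rw [Fintype.card_fin] at this
    omega
  obtain ⟨c, hc, i, hi⟩ := Fintype.not_linearIndependent_iff.mp hli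
  exact ⟨c, hc, fun h => hi (by rw [h]; rfl)⟩

theorem irreducible_quadratic {c₀ c₁ : F} (h : ∀ τ : F, τ ^ 2 + c₁ * τ + c₀ ≠ 0) :
    Irreducible (X ^ 2 + C c₁ * X + C c₀ : F[X]) ∧
      (X ^ 2 + C c₁ * X + C c₀ : F[X]).natDegree = 2 := by
  have hd : (X ^ 2 + C c₁ * X + C c₀ : F[X]).natDegree = 2 := by compute_degree!
  refine ⟨?_, hd⟩
  rw [irreducible_iff_roots_eq_zero_of_degree_le_three (by omega) (by omega),
    Multiset.eq_zero_iff_forall_notMem]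
  intro τ hτ
  have := (mem_roots'.mp hτ).2
  exact h τ (by simpa [IsRoot] using this)

/-- Irreducible quadratic polynomials over a finite field are affinely equivalent. -/
theorem exists_affine_of_irreducible [Finite F] {c₀ c₁ d₀ d₁ : F}
    (hc : ∀ τ : F, τ ^ 2 + c₁ * τ + c₀ ≠ 0) (hd : ∀ τ : F, τ ^ 2 + d₁ * τ + d₀ ≠ 0) :
    ∃ k m : F, k ≠ 0 ∧ k * c₁ = 2 * m + d₁ ∧ k ^ 2 * c₀ = m ^ 2 + d₁ * m + d₀ := by
  obtain ⟨hf, hf2⟩ := irreducible_quadratic hc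
  obtain ⟨hg, hg2⟩ := irreducible_quadratic hd
  obtain ⟨K, _, _, θ, φ, hK, hθ, hφ⟩ := exists_roots_in_common_field hf hg (by rw [hf2, hg2])
  have hlin : ∀ (f : F[X]), Irreducible f → f.natDegree = 2 → ∀ ψ : K, aeval ψ f = 0 →
      ∀ a b : F, algebraMap F K a + algebraMap F K b * ψ = 0 → a = 0 ∧ b = 0 := by
    intro f hf hf2 ψ hψ a b hab
    have h0 : (C b * X + C a : F[X]) = 0 := by
      refine eq_zero_of_aeval_eq_zero hf hψ (by simpa [add_comm] using hab) ?_
      rw [hf2]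
      exact lt_of_le_of_lt (natDegree_linear_le) (by norm_num)
    constructor
    · simpa using congrArg (fun p => coeff p 0) h0
    · simpa using congrArg (fun p => coeff p 1) h0
  -- In a quadratic extension `1, θ, φ` are dependent. Since neither root lies in `F`, the
  -- coefficients of both roots are nonzero and `φ = kθ + m`.
  obtain ⟨c, hc0, hcne⟩ := exists_relation (F := F) ![1, θ, φ] (by rw [hK, hf2]; norm_num)
    (by rw [hK, hf2]; norm_num)
  simp [Fin.sum_univ_three, Algebra.smul_def] at hc0
  have hc2 : c 2 ≠ 0 := by
    intro h
    have := hlin _ hf hf2 θ hθ (c 0) (c 1) (by simpa [h] using hc0)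
    apply hcne
    ext i
    fin_cases i <;> simp [this, h]
  have hc1 : c 1 ≠ 0 := by
    intro h
    have := hlin _ hg hg2 φ hφ (c 0) (c 2) (by simpa [h] using hc0)
    exact hc2 this.2
  have hmc2 : algebraMap F K (c 2) ≠ 0 := by simpa using hc2
  have hφe : φ = algebraMap F K (-(c 1 / c 2)) * θ + algebraMap F K (-(c 0 / c 2)) := by
    simp only [map_neg, map_div₀]
    field_simp
    linear_combination hc0
  set k := -(c 1 / c 2)
  set m := -(c 0 / c 2)
  have hk : k ≠ 0 := neg_ne_zero.mpr (div_ne_zero hc1 hc2)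
  have hθ' : θ ^ 2 + algebraMap F K c₁ * θ + algebraMap F K c₀ = 0 := by simpa using hθ
  have hφ' : φ ^ 2 + algebraMap F K d₁ * φ + algebraMap F K d₀ = 0 := by simpa using hφ
  rw [hφe] at hφ'
  -- Insert `kθ + m` into the equation of `φ`, reduce by that of `θ`, and compare the coefficients
  -- of `1` and `θ`.
  have := hlin _ hf hf2 θ hθ (m ^ 2 + d₁ * m + d₀ - k ^ 2 * c₀)
    (2 * k * m + d₁ * k - k ^ 2 * c₁) (by
      simp only [map_sub, map_add, map_mul, map_pow, map_ofNat]
      linear_combination hφ' - (algebraMap F K k) ^ 2 * hθ')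
  refine ⟨k, m, hk, ?_, by linear_combination -this.1⟩
  apply mul_left_cancel₀ hk
  linear_combination -this.2

theorem irreducible_cubic {x : Fin 4 → F} (h0 : x 0 ≠ 0)
    (h : ∀ τ : F, ¬ Rel x (some τ) (some τ) (some τ)) :
    Irreducible (C (-x 0) * X ^ 3 + C (3 * x 1) * X ^ 2 + C (-(3 * x 2)) * X + C (x 3) : F[X]) ∧
    (C (-x 0) * X ^ 3 + C (3 * x 1) * X ^ 2 + C (-(3 * x 2)) * X + C (x 3) : F[X]).natDegree
      = 3 := by
  have hd : (C (-x 0) * X ^ 3 + C (3 * x 1) * X ^ 2 + C (-(3 * x 2)) * X +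
      C (x 3) : F[X]).natDegree = 3 := natDegree_cubic (neg_ne_zero.mpr h0)
  refine ⟨?_, hd⟩
  rw [irreducible_iff_roots_eq_zero_of_degree_le_three (by omega) (by omega),
    Multiset.eq_zero_iff_forall_notMem]
  intro τ hτ
  have := (mem_roots'.mp hτ).2
  apply h τ
  simp [IsRoot] at this
  simp only [Rel, polar, param]
  linear_combination this

/-- Vectors without osculating planes are equivalent. -/
theorem exists_symCube_of_irreducible [Finite F] (h3 : (3 : F) ≠ 0) {x y : Fin 4 → F}
    (hx : ∀ s, ¬ Rel x s s s) (hy : ∀ s, ¬ Rel y s s s) :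
    ∃ a b c d k : F, a * d - b * c ≠ 0 ∧ symCube a b c d x = k • y := by
  have hx0 : x 0 ≠ 0 := fun h => hx none (by simp [Rel, polar, param, h])
  have hy0 : y 0 ≠ 0 := fun h => hy none (by simp [Rel, polar, param, h])
  obtain ⟨hf, hf3⟩ := irreducible_cubic hx0 fun τ => hx (some τ)
  obtain ⟨hg, hg3⟩ := irreducible_cubic hy0 fun τ => hy (some τ)
  obtain ⟨K, _, _, θ, φ, hK, hθ, hφ⟩ := exists_roots_in_common_field hf hg (by rw [hf3, hg3])
  have hquad : ∀ (f : F[X]), Irreducible f → f.natDegree = 3 → ∀ ψ : K, aeval ψ f = 0 →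
      ∀ a b c : F, algebraMap F K a + algebraMap F K b * ψ + algebraMap F K c * ψ ^ 2 = 0 →
      a = 0 ∧ b = 0 ∧ c = 0 := by
    intro f hf hf3 ψ hψ a b c habc
    have h0 : (C c * X ^ 2 + C b * X + C a : F[X]) = 0 := by
      refine eq_zero_of_aeval_eq_zero hf hψ ?_ ?_
      · simp
        linear_combination habc
      · rw [hf3]
        exact lt_of_le_of_lt (natDegree_quadratic_le) (by norm_num)
    refine ⟨?_, ?_, ?_⟩
    · simpa using congrArg (fun p => coeff p 0) h0
    · simpa using congrArg (fun p => coeff p 1) h0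
    · simpa [coeff_X, coeff_C] using congrArg (fun p => coeff p 2) h0
  -- Four elements of a cubic extension are dependent. The relation reads `φ = (c + dθ)/(a + bθ)`,
  -- which is the required fractional linear map.
  obtain ⟨w, hw0, hwne⟩ := exists_relation (F := F) ![φ, φ * θ, -1, -θ]
    (by rw [hK, hf3]; norm_num) (by rw [hK, hf3]; norm_num)
  simp [Fin.sum_univ_four, Algebra.smul_def] at hw0
  obtain ⟨a, b, c, d, hw⟩ : ∃ a b c d, w = ![a, b, c, d] :=
    ⟨w 0, w 1, w 2, w 3, by ext i; fin_cases i <;> rfl⟩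
  subst hw
  simp only [Matrix.cons_val] at hw0
  set ι := algebraMap F K with hι
  have i2 : ι 2 = 2 := map_ofNat ι 2
  have i3 : ι 3 = 3 := map_ofNat ι 3
  have hrel : ι c + ι d * θ = φ * (ι a + ι b * θ) := by linear_combination -hw0
  have hu : ι a + ι b * θ ≠ 0 := by
    intro h
    obtain ⟨ha, hb, _⟩ := hquad _ hf hf3 θ hθ a b 0 (by simpa using h)
    rw [h, mul_zero] at hrel
    obtain ⟨hc, hd, _⟩ := hquad _ hf hf3 θ hθ c d 0 (by simpa using hrel)
    apply hwne
    ext i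
    fin_cases i <;> simp [ha, hb, hc, hd]
  -- A singular matrix would give `aφ = c` and `bφ = d`; as `φ` is not in `F`, this forces `a = b =
  -- 0`, against `hu`.
  have hdet : a * d - b * c ≠ 0 := by
    intro h
    have key : ∀ p r : F, (ι a + ι b * θ) * (ι p * φ - ι r) = 0 → p = 0 := by
      intro p r hpr
      have h1 := (mul_eq_zero.mp hpr).resolve_left hu
      exact (hquad _ hg hg3 φ hφ (-r) p 0 (by
        simp only [map_neg, map_zero, zero_mul, add_zero]
        linear_combination h1)).2.1
    have h' : ι a * ι d - ι b * ι c = 0 := by rw [← map_mul, ← map_mul, ← map_sub, h, map_zero]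
    have ha := key a c (by linear_combination -ι a * hrel + θ * h')
    have hb := key b d (by linear_combination -ι b * hrel - h')
    exact hu (by rw [ha, hb]; simp)
  set x' := symCube a b c d x with hx'
  have hmap : (fun i => ι (x' i)) = symCube (ι a) (ι b) (ι c) (ι d) (fun i => ι (x i)) := by
    ext i
    rw [hx', symCube_apply, symCube_apply]
    fin_cases i <;> simp [i2, i3]
  have hpolar : ∀ (z : Fin 4 → F) (ψ : K), polar (fun i => ι (z i)) (1, ψ) (1, ψ) (1, ψ) =
      aeval ψ (C (-z 0) * X ^ 3 + C (3 * z 1) * X ^ 2 + C (-(3 * z 2)) * X + C (z 3) : F[X]) := by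
    intro z ψ
    simp [polar, ← hι, i3]
    ring
  have hx'φ : polar (fun i => ι (x' i)) (1, φ) (1, φ) (1, φ) = 0 := by
    have hm : mob (ι a) (ι b) (ι c) (ι d) (1, θ) = (ι a + ι b * θ) • ((1, φ) : K × K) := by
      apply Prod.ext
      · simp [mob]
      · simp only [mob, Prod.smul_snd, smul_eq_mul]
        linear_combination hrel
    have h1 := polar_symCube (ι a) (ι b) (ι c) (ι d) (fun i => ι (x i)) (1, θ) (1, θ) (1, θ)
    rw [hm, polar_smul_smul_smul, hpolar x θ, hθ, mul_zero, ← hmap] at h1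
    exact (mul_eq_zero.mp h1).resolve_left (mul_ne_zero (mul_ne_zero hu hu) hu)
  refine ⟨a, b, c, d, x' 0 / y 0, hdet, ?_⟩
  set k := x' 0 / y 0 with hk
  have hk0 : x' 0 = k * y 0 := by rw [hk]; field_simp
  have hyφ : polar (fun i => ι (y i)) (1, φ) (1, φ) (1, φ) = 0 := by rw [hpolar, hφ]
  -- The cubics of `x'` and of `k • y` both vanish at `φ` and have equal leading coefficients. Their
  -- difference has degree at most 2, so it is zero, and invertibility of 3 recovers the middle
  -- coordinates.
  obtain ⟨e3, e2, e1⟩ := hquad _ hg hg3 φ hφ (x' 3 - k * y 3) (-(3 * (x' 2 - k * y 2)))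
    (3 * (x' 1 - k * y 1)) (by
      have e0 : ι (x' 0) = ι k * ι (y 0) := by rw [hk0, map_mul]
      simp only [polar] at hx'φ hyφ
      simp only [map_sub, map_neg, map_mul, map_ofNat]
      linear_combination hx'φ - ι k * hyφ + φ ^ 3 * e0)
  have e2' : x' 2 - k * y 2 = 0 := by simpa [h3] using e2
  have e1' : x' 1 - k * y 1 = 0 := by simpa [h3] using e1
  ext i
  fin_cases i <;> simp
  · exact hk0
  · exact sub_eq_zero.mp e1'
  · exact sub_eq_zero.mp e2'
  · exact sub_eq_zero.mp e3

end Irreducible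

/-! ### Normal forms of points under the group of the cubic -/

section NormalForms

variable {F : Type*} [Field F] [Fintype F] [DecidableEq F]

/-- Moving three parameters to `∞, 0, 1` carries along all relations among them, repetitions
included; the relations at `∞` and `0` then become the vanishing of single coordinates. -/
theorem exists_sameOrbit_rel {x : Fin 4 → F} (hx : x ≠ 0) {s t u : Option F} (hst : s ≠ t)
    (hsu : s ≠ u) (htu : t ≠ u) :
    ∃ y, SameOrbit x y ∧ ∀ i j k : Fin 3,
      Rel y (![none, some 0, some 1] i) (![none, some 0, some 1] j) (![none, some 0, some 1] k) ↔
        Rel x (![s, t, u] i) (![s, t, u] j) (![s, t, u] k) := by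
  obtain ⟨a, b, c, d, k, l, m, hdet, hk, hl, hm, h1, h2, h3⟩ := exists_mob hst hsu htu
  have hne : ∀ i : Fin 3, ![k, l, m] i ≠ 0 := by intro i; fin_cases i <;> simpa
  have hmob : ∀ i : Fin 3, mob a b c d (param (![s, t, u] i)) =
      ![k, l, m] i • param (![none, some 0, some 1] i) := by
    intro i
    fin_cases i
    exacts [h1, h2, h3]
  exact ⟨_, sameOrbit_symCube hdet hx, fun i₁ i₂ i₃ =>
    rel_symCube hdet x (hne i₁) (hne i₂) (hne i₃) (hmob i₁) (hmob i₂) (hmob i₃)⟩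

theorem exists_third (hF : 3 ≤ Nat.card F) (s t : Option F) : ∃ u, s ≠ u ∧ t ≠ u := by
  obtain ⟨u, hu⟩ := exists_ne_of_card_lt {s, t} (lt_of_le_of_lt Finset.card_le_two (by
    rw [card_option_eq]; omega))
  simp only [Finset.mem_insert, Finset.mem_singleton, not_or] at hu
  exact ⟨u, Ne.symm hu.1, Ne.symm hu.2⟩

theorem rel_none_none_none {x : Fin 4 → F} : Rel x none none none ↔ x 0 = 0 := by
  simp [Rel, polar, param]

theorem rel_none_none_zero {x : Fin 4 → F} : Rel x none none (some 0) ↔ x 1 = 0 := by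
  simp [Rel, polar, param]

theorem rel_none_zero_zero {x : Fin 4 → F} : Rel x none (some 0) (some 0) ↔ x 2 = 0 := by
  simp [Rel, polar, param]

theorem rel_zero_zero_zero {x : Fin 4 → F} :
    Rel x (some 0) (some 0) (some 0) ↔ x 3 = 0 := by
  simp [Rel, polar, param]

theorem sameOrbit_cubicVec_none (hF : 3 ≤ Nat.card F) {x : Fin 4 → F}
    (h : x ∈ vecs (cubic F)) : SameOrbit x (cubicVec none) := by
  obtain ⟨hx, s, e, rfl⟩ := mem_vecs_cubic.mp h
  obtain ⟨t, -, hst⟩ := exists_third hF s s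
  obtain ⟨u, hsu, htu⟩ := exists_third hF s t
  obtain ⟨a, b, c, d, k, l, m, hdet, hk, -, -, h1, -, -⟩ := exists_mob hst hsu htu
  refine sameOrbit_of_symCube_eq hdet hx (cubicVec_ne_zero _) (k := e * k ^ 3) ?_
  rw [map_smul, cubicVec_eq_veronese, symCube_veronese, h1, veronese_smul, ← cubicVec_eq_veronese,
    smul_smul]

/-- The tangent at `∞` is `x_0 = x_1 = 0`, and `z = 0` would put the point on the cubic. -/
theorem exists_sameOrbit_tangent (hF : 3 ≤ Nat.card F) {x : Fin 4 → F}
    (h : x ∈ vecs (tangentPoints F)) : ∃ z w, z ≠ 0 ∧ SameOrbit x ![0, 0, z, w] := by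
  obtain ⟨hc, s, hs⟩ := mem_vecs_tangentPoints.mp h
  obtain ⟨t, -, hst⟩ := exists_third hF s s
  obtain ⟨u, hsu, htu⟩ := exists_third hF s t
  obtain ⟨y, hxy, hy⟩ := exists_sameOrbit_rel (ne_zero_of_not_onCone hc) hst hsu htu
  have h0 : y 0 = 0 := rel_none_none_none.mp ((hy 0 0 0).mpr (hs _))
  have h1 : y 1 = 0 := rel_none_none_zero.mp ((hy 0 0 1).mpr (hs _))
  have hyv : y = ![0, 0, y 2, y 3] := by ext i; fin_cases i <;> simp [h0, h1]
  refine ⟨y 2, y 3, fun h2 => ?_, hyv ▸ hxy⟩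
  refine hc (hxy.onCone_iff.mpr ⟨none, y 3, ?_⟩)
  rw [hyv]
  ext i; fin_cases i <;> simp [cubicVec, h2]

/-- The chord of `∞` and `0` is `x_1 = x_2 = 0`, and its end points are excluded. -/
theorem exists_sameOrbit_chord (hF : 3 ≤ Nat.card F) {x : Fin 4 → F}
    (h : x ∈ vecs (rcPoints F)) : ∃ z w, z ≠ 0 ∧ w ≠ 0 ∧ SameOrbit x ![z, 0, 0, w] := by
  obtain ⟨hc, s, t, hst, hs⟩ := (mem_vecs_rcPoints hF).mp h
  obtain ⟨u, hsu, htu⟩ := exists_third hF s t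
  obtain ⟨y, hxy, hy⟩ := exists_sameOrbit_rel (ne_zero_of_not_onCone hc) hst hsu htu
  have h1 : y 1 = 0 :=
    rel_none_none_zero.mp ((hy 0 0 1).mpr ((isPolarity_rel x).right (hs _)))
  have h2 : y 2 = 0 := rel_none_zero_zero.mp ((hy 0 1 1).mpr (hs _))
  have hyv : y = ![y 0, 0, 0, y 3] := by ext i; fin_cases i <;> simp [h1, h2]
  refine ⟨y 0, y 3, fun h0 => ?_, fun h3 => ?_, hyv ▸ hxy⟩
  · refine hc (hxy.onCone_iff.mpr ⟨none, y 3, ?_⟩)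
    rw [hyv]
    ext i; fin_cases i <;> simp [cubicVec, h0]
  · refine hc (hxy.onCone_iff.mpr ⟨some 0, y 0, ?_⟩)
    rw [hyv]
    ext i; fin_cases i <;> simp [cubicVec, h3]

theorem vec_ne_zero_of_apply {x : Fin 4 → F} (i : Fin 4) (h : x i ≠ 0) : x ≠ 0 :=
  fun h0 => h (by rw [h0]; rfl)

theorem sameOrbit_of_mem_tangentPoints (hF : 3 ≤ Nat.card F) (h3 : (3 : F) ≠ 0) {x : Fin 4 → F}
    (h : x ∈ vecs (tangentPoints F)) : SameOrbit x ![0, 0, 1, 0] := by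
  obtain ⟨z, w, hz, hxy⟩ := exists_sameOrbit_tangent hF h
  -- The translation of the parameter by `c` adds `3cz` to the last coordinate; `c = -w/(3z)` clears
  -- it.
  refine hxy.trans (sameOrbit_of_symCube_eq (a := 1) (b := 0) (c := -w / (3 * z)) (d := 1) (k := z)
    (by simp) hxy.2.1 (vec_ne_zero_of_apply 2 (by simp)) ?_)
  ext i
  fin_cases i <;> simp [symCube_apply]
  field_simp
  ring

/-- Once the three osculating planes are those at `∞, 0, 1`, the coordinates satisfy `y 0 = y 3 = 0`
and `3 (y 1 - y 2) = 0`, which determines the point. -/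
theorem sameOrbit_of_mem_gamma_three (hF3 : (3 : F) ≠ 0) {x : Fin 4 → F}
    (h : x ∈ vecs (gammaPoints F 3)) : SameOrbit x ![0, 1, 1, 0] := by
  obtain ⟨hc, ho⟩ := mem_vecs_gammaPoints.mp h
  rw [← natCast_oscNum] at ho
  obtain ⟨s, t, u, hst, hsu, htu, hset⟩ := Set.ncard_eq_three.mp (by exact_mod_cast ho)
  obtain ⟨y, hxy, hy⟩ := exists_sameOrbit_rel (ne_zero_of_not_onCone hc) hst hsu htu
  have hmem : ∀ v, Rel x v v v ↔ v ∈ ({s, t, u} : Set (Option F)) := fun v => hset ▸ Iff.rfl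
  have h0 : y 0 = 0 := rel_none_none_none.mp ((hy 0 0 0).mpr ((hmem s).mpr (by simp)))
  have h3 : y 3 = 0 := rel_zero_zero_zero.mp ((hy 1 1 1).mpr ((hmem t).mpr (by simp)))
  have h12 : 3 * (y 1 - y 2) = 0 := by
    have : Rel y (some 1) (some 1) (some 1) := (hy 2 2 2).mpr ((hmem u).mpr (by simp))
    simp only [Rel, polar, param, h0, h3] at this
    linear_combination this
  have h12' : y 2 = y 1 := (sub_eq_zero.mp ((mul_eq_zero.mp h12).resolve_left hF3)).symm
  refine hxy.trans (sameOrbit_of_symCube_eq (a := 1) (b := 0) (c := 0) (d := 1) (k := y 1)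
    (by simp) hxy.2.1 (vec_ne_zero_of_apply 1 (by simp)) ?_)
  ext i
  fin_cases i <;> simp [symCube_apply, h0, h3, h12']

/-- With the only osculating plane at `∞`, the condition at finite `τ` is a quadratic equation
without roots. It is truly quadratic: a linear one would have a root, and a constant one would put
the point on the cubic. -/
theorem exists_sameOrbit_gamma_one (hF : 5 ≤ Nat.card F) (h3 : Nat.card F % 3 ≠ 0)
    {x : Fin 4 → F} (h : x ∈ vecs (gammaPoints F 1)) :
    ∃ y, SameOrbit x y ∧ y 0 = 0 ∧ y 1 ≠ 0 ∧
      ∀ τ : F, τ ^ 2 + (-y 2 / y 1) * τ + y 3 / (3 * y 1) ≠ 0 := by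
  have hF3 := three_ne_zero_of_card h3
  have hF' : 3 ≤ Nat.card F := by omega
  obtain ⟨hc, ho⟩ := mem_vecs_gammaPoints.mp h
  rw [← natCast_oscNum] at ho
  obtain ⟨s, hset⟩ := Set.ncard_eq_one.mp (by exact_mod_cast ho)
  obtain ⟨t, -, hst⟩ := exists_third hF' s s
  obtain ⟨u, hsu, htu⟩ := exists_third hF' s t
  obtain ⟨y, hxy, hy⟩ := exists_sameOrbit_rel (ne_zero_of_not_onCone hc) hst hsu htu
  have h0 : Rel y none none none := (hy 0 0 0).mpr (by
    have : s ∈ {s | Rel x s s s} := by rw [hset]; simp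
    exact this)
  obtain ⟨hcy, hoy⟩ := mem_vecs_gammaPoints.mp ((isInvariant_gammaPoints hF h3 1).mem_vecs hxy h)
  rw [← natCast_oscNum] at hoy
  obtain ⟨s', hset'⟩ := Set.ncard_eq_one.mp (by exact_mod_cast hoy)
  have hs' : none = s' := by
    have : none ∈ {s | Rel y s s s} := h0
    rwa [hset'] at this
  have hroot : ∀ τ : F, y 3 - 3 * τ * y 2 + 3 * τ ^ 2 * y 1 ≠ 0 := by
    intro τ hτ
    have : some τ ∈ {s | Rel y s s s} := by
      simp only [Set.mem_ofPred_eq, Rel, polar, param, rel_none_none_none.mp h0]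
      linear_combination hτ
    rw [hset', ← hs'] at this
    simp at this
  rw [rel_none_none_none] at h0
  have h1 : y 1 ≠ 0 := by
    intro h1
    by_cases h2 : y 2 = 0
    · refine hcy ⟨none, y 3, ?_⟩
      ext i; fin_cases i <;> simp [cubicVec, h0, h1, h2]
    · refine hroot (y 3 / (3 * y 2)) ?_
      rw [h1]
      field_simp
      ring
  refine ⟨y, hxy, h0, h1, fun τ hτ => hroot τ ?_⟩
  field_simp at hτ
  linear_combination hτ

/-- The affine substitution matching the two irreducible quadratics is itself a change of parameter
fixing `∞`. -/
theorem sameOrbit_of_mem_gamma_one (hF : 5 ≤ Nat.card F) (h3 : Nat.card F % 3 ≠ 0)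
    {x y : Fin 4 → F} (hx : x ∈ vecs (gammaPoints F 1)) (hy : y ∈ vecs (gammaPoints F 1)) :
    SameOrbit x y := by
  have hF3 := three_ne_zero_of_card h3
  obtain ⟨x', hxx, hx0, hx1, hxr⟩ := exists_sameOrbit_gamma_one hF h3 hx
  obtain ⟨y', hyy, hy0, hy1, hyr⟩ := exists_sameOrbit_gamma_one hF h3 hy
  refine (hxx.trans ?_).trans hyy.symm
  obtain ⟨k, m, hk, e1, e2⟩ := exists_affine_of_irreducible hxr hyr
  refine sameOrbit_of_symCube_eq (a := 1) (b := 0) (c := m) (d := k) (k := k * x' 1 / y' 1)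
    (by simpa using hk) hxx.2.1 hyy.2.1 ?_
  have e1' : k * x' 2 * y' 1 = -2 * m * x' 1 * y' 1 + y' 2 * x' 1 := by
    field_simp at e1
    linear_combination -e1
  have e2' : k ^ 2 * x' 3 * y' 1 =
      3 * m ^ 2 * x' 1 * y' 1 - 3 * m * y' 2 * x' 1 + y' 3 * x' 1 := by
    field_simp at e2
    linear_combination e2
  ext i
  fin_cases i <;> simp [symCube_apply, hx0, hy0]
  · field_simp
  · field_simp
    linear_combination e1'
  · field_simp
    linear_combination e2' + 3 * m * e1'

theorem sameOrbit_of_mem_gamma_zero (hF3 : (3 : F) ≠ 0) {x y : Fin 4 → F}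
    (hx : x ∈ vecs (gammaPoints F 0)) (hy : y ∈ vecs (gammaPoints F 0)) : SameOrbit x y := by
  have key : ∀ {z : Fin 4 → F}, z ∈ vecs (gammaPoints F 0) → ∀ s, ¬ Rel z s s s := by
    intro z hz s hs
    obtain ⟨hc, ho⟩ := mem_vecs_gammaPoints.mp hz
    rw [← natCast_oscNum] at ho
    have := (Set.ncard_eq_zero (Set.toFinite _)).mp
      (show {s | Rel z s s s}.ncard = 0 by exact_mod_cast ho)
    exact (Set.eq_empty_iff_forall_notMem.mp this) s hs
  obtain ⟨a, b, c, d, k, hdet, h⟩ := exists_symCube_of_irreducible hF3 (key hx) (key hy)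
  exact sameOrbit_of_symCube_eq hdet hx.1 hy.1 h

end NormalForms

/-! ### Normal forms in characteristic three -/

section CharThree

variable {F : Type*} [Field F] [Fintype F] [DecidableEq F]

theorem exists_cube_eq (h3 : Nat.card F % 3 = 0) (a : F) : ∃ b, b ^ 3 = a := by
  have := charP_three_of_card h3
  have : Fact (Nat.Prime 3) := ⟨Nat.prime_three⟩
  obtain ⟨b, hb⟩ := (Finite.injective_iff_surjective.mp (frobenius_inj F 3)) a
  exact ⟨b, hb⟩

theorem three_eq_zero (h3 : Nat.card F % 3 = 0) : (3 : F) = 0 := by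
  have := charP_three_of_card h3
  exact_mod_cast CharP.cast_eq_zero F 3

theorem two_ne_zero_of_card (h3 : Nat.card F % 3 = 0) : (2 : F) ≠ 0 := by
  intro h
  have : (1 : F) = 0 := by linear_combination three_eq_zero h3 - h
  exact one_ne_zero this

theorem sameOrbit_of_mem_toPoints (hF : 3 ≤ Nat.card F) (h3 : Nat.card F % 3 = 0)
    (hinv : IsInvariant (toPoints F)) {x : Fin 4 → F} (h : x ∈ vecs (toPoints F)) :
    SameOrbit x ![0, 0, 1, 1] := by
  obtain ⟨z, w, hz, hxy⟩ := exists_sameOrbit_tangent hF (mem_vecs_toPoints.mp h).1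
  -- If `w = 0`, the point lies on `x_0 = x_3 = 0`, hence on all osculating planes.
  have hw : w ≠ 0 := by
    rintro rfl
    have hm := mem_vecs_toPoints.mp (hinv.mem_vecs hxy h)
    have hq : (Nat.card F : ℤ) ≠ 0 := by omega
    rcases class_cases_zero hF h3 (mem_vecs_tangentPoints.mp hm.1).1 with k | k | k | k
    · have := k.2.2.2.1
      rw [hm.2] at this
      omega
    · exact k.2.2.2.2 (by simp)
    · exact k.1 hm.1
    · exact k.1 hm.1
  -- Scaling the parameter by `d` multiplies the last two coordinates by `d^2` and `d^3`; they
  -- become equal for `d = z/w`.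
  refine hxy.trans (sameOrbit_of_symCube_eq (a := 1) (b := 0) (c := 0) (d := z / w)
    (k := z ^ 3 / w ^ 2) (by simp [hz, hw]) hxy.2.1 (vec_ne_zero_of_apply 2 (by simp)) ?_)
  ext i
  fin_cases i <;> simp [symCube_apply] <;> field_simp

theorem sameOrbit_of_mem_gamma_card (hF : 3 ≤ Nat.card F) (h3 : Nat.card F % 3 = 0)
    (hinv : IsInvariant (gammaPoints F (Nat.card F + 1))) {x : Fin 4 → F}
    (h : x ∈ vecs (gammaPoints F (Nat.card F + 1))) : SameOrbit x ![0, 0, 1, 0] := by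
  have key : ∀ {y : Fin 4 → F}, y ∈ vecs (gammaPoints F (Nat.card F + 1)) →
      y ∈ vecs (tangentPoints F) ∧ y 3 = 0 := by
    intro y hy
    obtain ⟨hc, ho⟩ := mem_vecs_gammaPoints.mp hy
    push_cast at ho
    rcases class_cases_zero hF h3 hc with k | k | k | k
    · exact ⟨k.1, k.2.2.2.2.2⟩
    · have := k.2.2.2.1
      omega
    · have := k.2.2.2
      omega
    · have := k.2.2.2
      omega
  obtain ⟨z, w, hz, hxy⟩ := exists_sameOrbit_tangent hF (key h).1
  have hw : w = 0 := by simpa using (key (hinv.mem_vecs hxy h)).2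
  subst hw
  refine hxy.trans (sameOrbit_of_symCube_eq (a := 1) (b := 0) (c := 0) (d := 1)
    (k := z) (by simp) hxy.2.1 (vec_ne_zero_of_apply 2 (by simp)) ?_)
  ext i
  fin_cases i <;> simp [symCube_apply]

theorem sameOrbit_of_mem_rcPoints (hF : 3 ≤ Nat.card F) (h3 : Nat.card F % 3 = 0)
    {x : Fin 4 → F} (h : x ∈ vecs (rcPoints F)) : SameOrbit x ![1, 0, 0, 1] := by
  obtain ⟨z, w, hz, hw, hxy⟩ := exists_sameOrbit_chord hF h
  -- Scaling the parameter by `k` multiplies the last coordinate by `k^3`, and every element is a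
  -- cube.
  obtain ⟨k, hk⟩ := exists_cube_eq h3 (z / w)
  have hk0 : k ≠ 0 := by
    rintro rfl
    have : z / w ≠ 0 := div_ne_zero hz hw
    exact this (by rw [← hk]; ring)
  refine hxy.trans (sameOrbit_of_symCube_eq (a := 1) (b := 0) (c := 0) (d := k)
    (k := z) (by simpa using hk0) hxy.2.1 (vec_ne_zero_of_apply 0 (by simp)) ?_)
  ext i
  fin_cases i <;> simp [symCube_apply]
  rw [hk]
  field_simp

/-- An affine change of parameter moves the conjugate pair of the chord to the square roots of `n`,
so the point becomes `(y_0, y_1, n y_0, n y_1)`. Multiplication by `d + c√n` fixes this pair and, in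
characteristic 3, sends `(1, 0, n, 0)` to `(d^3, n^2 c^3, n d^3, n^3 c^3)`. As cubing is bijective,
every point of the chord is reached. -/
theorem sameOrbit_of_mem_icPoints (h3 : Nat.card F % 3 = 0) {n : F}
    (hn : ¬ IsSquare n) {x : Fin 4 → F} (h : x ∈ vecs (icPoints F)) :
    SameOrbit x ![1, 0, n, 0] := by
  have h30 := three_eq_zero h3
  have hx := mem_vecs_icPoints.mp h
  rcases exists_rel_or_irreducible x with ⟨s, t, k⟩ | ⟨c₀, c₁, hc, hx2, hx3⟩
  · exact (hx s t k).elim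
  obtain ⟨k, m, hk, e1, e2⟩ := exists_affine_of_irreducible (d₀ := -n) (d₁ := 0) hc
    (fun τ hτ => hn ⟨τ, by linear_combination -hτ⟩)
  have hdet : (1 : F) * k - 0 * m ≠ 0 := by simpa using hk
  have hxy := sameOrbit_symCube hdet h.1
  obtain ⟨y, hy⟩ : ∃ y, y = symCube 1 0 m k x := ⟨_, rfl⟩
  rw [← hy] at hxy
  refine hxy.trans (SameOrbit.symm ?_)
  have y0 : y 0 = x 0 := by simp [hy, symCube_apply]
  have y1 : y 1 = m * x 0 + k * x 1 := by simp [hy, symCube_apply]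
  have y2 : y 2 = n * y 0 := by
    rw [y0, hy]
    simp [symCube_apply, hx2]
    linear_combination -(x 0) * e2 - k * x 1 * e1
  have y3 : y 3 = n * y 1 := by
    rw [y1, hy]
    simp [symCube_apply]
    rw [hx3]
    have e : k ^ 2 * x 2 = n * x 0 - m ^ 2 * x 0 - 2 * m * k * x 1 := by
      rw [hx2]
      linear_combination -(x 0) * e2 - k * x 1 * e1
    linear_combination m * e - k ^ 2 * x 2 * e1 - k * x 1 * e2
  obtain ⟨d, hd⟩ := exists_cube_eq h3 (y 0)
  obtain ⟨c, hc'⟩ := exists_cube_eq h3 (y 1 / n ^ 2)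
  have hn0 : n ≠ 0 := by
    rintro rfl
    exact hn (IsSquare.zero)
  have hc3 : c ^ 3 * n ^ 2 = y 1 := by rw [hc']; field_simp
  -- The determinant is the norm of `d + c√n`, which vanishes only for `c = d = 0` because `n` is
  -- not a square.
  have hdet' : d * d - c * (c * n) ≠ 0 := by
    intro h0
    by_cases hc0 : c = 0
    · have hd0 : d = 0 := by simpa [hc0] using h0
      have h0 : y 0 = 0 := by rw [← hd, hd0]; ring
      have h1 : y 1 = 0 := by rw [← hc3, hc0]; ring
      apply hxy.2.1
      ext i; fin_cases i <;> simp [h0, h1, y2, y3]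
    · refine hn ⟨d / c, ?_⟩
      field_simp
      linear_combination -h0
  refine sameOrbit_of_symCube_eq (k := 1) hdet' (vec_ne_zero_of_apply 0 (by simp)) hxy.2.1 ?_
  ext i
  fin_cases i <;> simp [symCube_apply, y2, y3]
  · linear_combination hd + d * c ^ 2 * n * h30
  · linear_combination hc3 + d ^ 2 * c * n * h30
  · linear_combination n * hd + d * c ^ 2 * n ^ 2 * h30
  · linear_combination n * hc3 + d ^ 2 * c * n ^ 2 * h30

end CharThree

/-! ### Invariance of the point classes in characteristic three -/

section Isolated

variable {F : Type*} [Field F] [Fintype F] [DecidableEq F]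

/-- Points not joined to some point of the cubic by any plane that meets the cubic in three
points. -/
def isolatedPoints (F : Type*) [Field F] : Set (ℙ F (Fin 4 → F)) :=
  {P | ∃ s : Option F, ∀ π ∈ threePlanes F, (cubicPoint s).submodule ≤ π → ¬ P.submodule ≤ π}

/-- The definition refers only to planes and the cubic, which the group preserves. A second
invariant is needed because `r` takes the same value on `(q+1)_Γ`-points and IC-points in
characteristic 3. -/
theorem isInvariant_isolatedPoints : IsInvariant (isolatedPoints F) := by
  rintro σ hσ P ⟨s, hs⟩
  have hmem : σ (cubicPoint s) ∈ cubic F := isInvariant_cubic σ hσ _ ⟨s, rfl⟩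
  obtain ⟨s', hs'⟩ := hmem
  obtain ⟨⟨g, hg⟩, hcub⟩ := inv_mem hσ
  have hback : ∀ Q : ℙ F (Fin 4 → F), g • σ Q = Q := fun Q => by
    rw [← hg]
    simp
  refine ⟨s', fun π hπ h1 h2 => hs _ (map_mem_threePlanes hg hcub hπ) ?_ ?_⟩
  · rw [hs', ← smul_submodule_le_iff g, hback] at h1
    exact h1
  · rw [← smul_submodule_le_iff g, hback] at h2
    exact h2

theorem mem_threePlanes_iff (hF : 3 ≤ Nat.card F) (π : Submodule F (Fin 4 → F)) :
    π ∈ threePlanes F ↔ ∃ S : Finset (Option F), S.card = 3 ∧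
      Submodule.span F (cubicVec '' (S : Set (Option F))) = π := by
  constructor
  · rintro ⟨hπ, h3⟩
    rw [ncard_cubic_inter] at h3
    have hfin : {s : Option F | cubicVec s ∈ π}.Finite := Set.toFinite _
    have hS : hfin.toFinset.card = 3 := by rw [← h3, Set.ncard_eq_toFinset_card _ hfin]
    have hle : Submodule.span F (cubicVec '' (hfin.toFinset : Set (Option F))) ≤ π := by
      rw [Submodule.span_le]
      rintro _ ⟨s, hs, rfl⟩
      exact (Set.Finite.mem_toFinset hfin).mp hs
    exact ⟨_, hS, Submodule.eq_of_le_of_finrank_eq hle (by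
      rw [finrank_span_cubicVec hF _ (by omega), hS, hπ])⟩
  · rintro ⟨S, hS, rfl⟩
    refine ⟨by rw [finrank_span_cubicVec hF S (by omega), hS], ?_⟩
    rw [ncard_cubic_inter, ← hS, ← Set.ncard_coe_finset]
    congr 1
    ext w
    exact cubicVec_mem_span_iff hF hS w

theorem mem_vecs_isolatedPoints (hF : 3 ≤ Nat.card F) {y : Fin 4 → F} (hy : y ≠ 0) :
    y ∈ vecs (isolatedPoints F) ↔
      ∃ s, ∀ t u, s ≠ t → s ≠ u → t ≠ u → ¬ Rel y s t u := by
  rw [mem_vecs hy]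
  refine exists_congr fun s => ⟨fun h t u hst hsu htu hR => ?_, fun h π hπ h1 h2 => ?_⟩
  · rw [← mem_span_triple_iff hF hst hsu htu] at hR
    refine h _ ((mem_threePlanes_iff hF _).mpr
      ⟨{s, t, u}, Finset.card_eq_three.mpr ⟨s, t, u, hst, hsu, htu, rfl⟩, rfl⟩) ?_ ?_
    · rw [cubicPoint_le_iff]
      exact Submodule.subset_span ⟨s, by simp, rfl⟩
    · rwa [submodule_mk_le]
  · obtain ⟨S, hS, rfl⟩ := (mem_threePlanes_iff hF _).mp hπ
    rw [cubicPoint_le_iff, cubicVec_mem_span_iff hF hS] at h1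
    rw [submodule_mk_le] at h2
    obtain ⟨t, u, htu, hSe⟩ := Finset.card_eq_two.mp
      (show (S.erase s).card = 2 by rw [Finset.card_erase_of_mem h1, hS])
    have ht : t ∈ S.erase s := by simp [hSe]
    have hu : u ∈ S.erase s := by simp [hSe]
    have hst := Ne.symm (Finset.ne_of_mem_erase ht)
    have hsu := Ne.symm (Finset.ne_of_mem_erase hu)
    have : S = {s, t, u} := by rw [← Finset.insert_erase h1, hSe]
    rw [this, mem_span_triple_iff hF hst hsu htu] at h2
    exact h t u hst hsu htu h2

/-- A plane joining `y` to its contact point contains the tangent there, so it cannot meet the cubic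
in two further points. -/
theorem mem_isolatedPoints_of_tangent (hF : 3 ≤ Nat.card F) {y : Fin 4 → F}
    (h : y ∈ vecs (tangentPoints F)) : y ∈ vecs (isolatedPoints F) := by
  obtain ⟨hc, s, hs⟩ := mem_vecs_tangentPoints.mp h
  have hP := isPolarity_rel y
  rw [mem_vecs_isolatedPoints hF (ne_zero_of_not_onCone hc)]
  refine ⟨s, fun t u hst hsu _ hR => hc (onCone_of_rel (s := s) ?_)⟩
  exact hP.all_of_all_of_all hs (hP.all_of_two hR (hP.right (hs t)) (Ne.symm hsu)) hst

/-- A symmetric bilinear form on the plane with three isotropic lines vanishes. -/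
theorem rel_of_three_isotropic (h2 : (2 : F) ≠ 0) {y : Fin 4 → F} {s t u v : Option F}
    (htv : t ≠ v) (huv : u ≠ v) (ht : Rel y s t t) (hu : Rel y s u u)
    (hv : Rel y s v v) : Rel y s t u := by
  have b1 := bracket_param_ne_zero huv
  have b2 := bracket_param_ne_zero htv
  have key : 2 * (bracket (param u) (param v) * bracket (param t) (param v)) *
      polar y (param s) (param t) (param u) =
      bracket (param u) (param v) ^ 2 * polar y (param s) (param t) (param t) +
      bracket (param t) (param v) ^ 2 * polar y (param s) (param u) (param u) -
      bracket (param t) (param u) ^ 2 * polar y (param s) (param v) (param v) := by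
    simp only [polar, bracket]
    ring
  rw [show polar y (param s) (param t) (param t) = 0 from ht,
    show polar y (param s) (param u) (param u) = 0 from hu,
    show polar y (param s) (param v) (param v) = 0 from hv] at key
  have h0 : 2 * (bracket (param u) (param v) * bracket (param t) (param v)) ≠ 0 :=
    mul_ne_zero h2 (mul_ne_zero b1 b2)
  have : 2 * (bracket (param u) (param v) * bracket (param t) (param v)) *
      polar y (param s) (param t) (param u) = 0 := by rw [key]; ring
  exact (mul_eq_zero.mp this).resolve_left h0

/-- Suppose `y` is isolated from `P(s)`. The solution of `(s, t)` cannot be a third parameter, and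
it is `s` only for the single parameter `a` with `R s s a`; so every other `t` satisfies `R s t t`.
As `q ≥ 5`, there are three such `t`, and by `rel_of_three_isotropic` any two of them are related
through `s`, a contradiction. -/
theorem notMem_isolatedPoints_of_imaginary (hF : 5 ≤ Nat.card F) (h2 : (2 : F) ≠ 0)
    {y : Fin 4 → F} (h : y ∈ vecs (icPoints F)) : y ∉ vecs (isolatedPoints F) := by
  rw [mem_vecs_isolatedPoints (by omega) h.1]
  rintro ⟨s, hs⟩
  have hI := mem_vecs_icPoints.mp h
  have hP := isPolarity_rel y
  obtain ⟨a, ha⟩ := hP.exists_rel s s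
  have hiso : ∀ t, t ≠ s → t ≠ a → Rel y s t t := by
    intro t hts hta
    have hn : ¬ Rel y s s t := fun k => hI s s (hP.all_of_two k ha hta)
    obtain ⟨u, hu⟩ := hP.exists_rel s t
    by_cases hut : t = u
    · rwa [← hut] at hu
    · by_cases hsu : s = u
      · rw [← hsu] at hu
        exact (hn (hP.right hu)).elim
      · exact (hs t u (Ne.symm hts) hsu hut hu).elim
  have hcard := card_option_eq (F := F)
  obtain ⟨t, ht⟩ := exists_ne_of_card_lt {s, a} (lt_of_le_of_lt Finset.card_le_two (by omega))
  obtain ⟨u, hu⟩ := exists_ne_of_card_lt {s, a, t} (lt_of_le_of_lt Finset.card_le_three (by omega))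
  obtain ⟨v, hv⟩ := exists_ne_of_card_lt {s, a, t, u}
    (lt_of_le_of_lt Finset.card_le_four (by omega))
  simp only [Finset.mem_insert, Finset.mem_singleton, not_or] at ht hu hv
  exact hs t u (Ne.symm ht.1) (Ne.symm hu.1) (Ne.symm hu.2.2)
    (rel_of_three_isotropic h2 (Ne.symm hv.2.2.1) (Ne.symm hv.2.2.2)
      (hiso t ht.1 ht.2) (hiso u hu.1 hu.2.1) (hiso v hv.1 hv.2.1))

/-- The value 2 occurs twice, so the signature isolates TO-points and RC-points but only the union
of the other two classes. -/
theorem signature_cases_zero (hF : 3 ≤ Nat.card F) (h3 : Nat.card F % 3 = 0) {y : Fin 4 → F}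
    (hy : ¬ OnCone y) :
    (y ∈ vecs (gammaPoints F (Nat.card F + 1)) ∧ y ∉ vecs (toPoints F) ∧ y ∉ vecs (rcPoints F) ∧
      y ∉ vecs (icPoints F) ∧ signature y = 2) ∨
    (y ∉ vecs (gammaPoints F (Nat.card F + 1)) ∧ y ∈ vecs (toPoints F) ∧ y ∉ vecs (rcPoints F) ∧
      y ∉ vecs (icPoints F) ∧ signature y = 2 - 2 * Nat.card F) ∨
    (y ∉ vecs (gammaPoints F (Nat.card F + 1)) ∧ y ∉ vecs (toPoints F) ∧ y ∈ vecs (rcPoints F) ∧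
      y ∉ vecs (icPoints F) ∧ signature y = 2 + 2 * Nat.card F) ∨
    (y ∉ vecs (gammaPoints F (Nat.card F + 1)) ∧ y ∉ vecs (toPoints F) ∧ y ∉ vecs (rcPoints F) ∧
      y ∈ vecs (icPoints F) ∧ signature y = 2) := by
  have hq : (Nat.card F : ℤ) ≠ 0 := by omega
  simp only [mem_vecs_toPoints, mem_vecs_gammaPoints, hy, not_false_eq_true, true_and]
  rcases class_cases_zero hF h3 hy with h | h | h | h
  · obtain ⟨e1, e2⟩ := values_of_mem_tangentPoints h.1
    refine Or.inl ⟨by rw [h.2.2.2.1]; simp, ?_, h.2.1, h.2.2.1, ?_⟩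
    · rw [h.2.2.2.1]; omega
    · rw [signature, e1, e2, h.2.2.2.1]; ring
  · obtain ⟨e1, e2⟩ := values_of_mem_tangentPoints h.1
    refine Or.inr (Or.inl ⟨?_, ⟨h.1, h.2.2.2.1⟩, h.2.1, h.2.2.1, ?_⟩)
    · rw [h.2.2.2.1]; omega
    · rw [signature, e1, e2, h.2.2.2.1]; ring
  · obtain ⟨e1, e2⟩ := values_of_mem_rcPoints hF h.2.1
    refine Or.inr (Or.inr (Or.inl ⟨?_, fun k => h.1 k.1, h.2.1, h.2.2.1, ?_⟩))
    · rw [h.2.2.2]; omega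
    · rw [signature, e1, e2, h.2.2.2]; ring
  · obtain ⟨e1, e2⟩ := values_of_mem_icPoints h.2.2.1
    refine Or.inr (Or.inr (Or.inr ⟨?_, fun k => h.1 k.1, h.2.1, h.2.2.1, ?_⟩))
    · rw [h.2.2.2]; omega
    · rw [signature, e1, e2, h.2.2.2]; ring

theorem isInvariant_toPoints (hF : 5 ≤ Nat.card F) (h3 : Nat.card F % 3 = 0) :
    IsInvariant (toPoints F) := by
  refine isInvariant_of_signature (by omega)
    (fun y h => (mem_vecs_tangentPoints.mp (mem_vecs_toPoints.mp h).1).1) fun x y hx hy h => ?_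
  rcases signature_cases_zero (by omega) h3
    (mem_vecs_tangentPoints.mp (mem_vecs_toPoints.mp hx).1).1 with k | k | k | k <;>
  rcases signature_cases_zero (by omega) h3 hy with l | l | l | l <;>
  first
  | exact l.2.1
  | exact absurd hx k.2.1
  | (exfalso; have := k.2.2.2.2; have := l.2.2.2.2; omega)

theorem isInvariant_rcPoints (hF : 5 ≤ Nat.card F) (h3 : Nat.card F % 3 = 0) :
    IsInvariant (rcPoints F) := by
  refine isInvariant_of_signature (by omega)
    (fun y h => ((mem_vecs_rcPoints (by omega)).mp h).1) fun x y hx hy h => ?_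
  rcases signature_cases_zero (by omega) h3 ((mem_vecs_rcPoints (by omega)).mp hx).1 with
    k | k | k | k <;>
  rcases signature_cases_zero (by omega) h3 hy with l | l | l | l <;>
  first
  | exact l.2.2.1
  | exact absurd hx k.2.2.1
  | (exfalso; have := k.2.2.2.2; have := l.2.2.2.2; omega)

theorem isInvariant_union (hF : 5 ≤ Nat.card F) (h3 : Nat.card F % 3 = 0) :
    IsInvariant (gammaPoints F (Nat.card F + 1) ∪ icPoints F) := by
  have hc : ∀ y ∈ vecs (gammaPoints F (Nat.card F + 1) ∪ icPoints F), ¬ OnCone y := by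
    intro y hy
    rw [vecs_union] at hy
    exact hy.elim (fun h => (mem_vecs_gammaPoints.mp h).1)
      fun h => not_onCone_of_imaginary (mem_vecs_icPoints.mp h)
  refine isInvariant_of_signature (by omega) hc fun x y hx hy h => ?_
  have hxc := hc x hx
  rw [vecs_union] at hx ⊢
  rcases signature_cases_zero (by omega) h3 hxc with k | k | k | k <;>
  rcases signature_cases_zero (by omega) h3 hy with l | l | l | l <;>
  first
  | exact Or.inl l.1
  | exact Or.inr l.2.2.2.1
  | exact absurd hx (not_or.mpr ⟨k.1, k.2.2.2.1⟩)
  | (exfalso; have := k.2.2.2.2; have := l.2.2.2.2; omega)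

theorem IsInvariant.inter {S T : Set (ℙ F (Fin 4 → F))} (hS : IsInvariant S)
    (hT : IsInvariant T) : IsInvariant (S ∩ T) :=
  fun σ hσ P hP => ⟨hS σ hσ P hP.1, hT σ hσ P hP.2⟩

theorem vecs_inter (A B : Set (ℙ F (Fin 4 → F))) : vecs (A ∩ B) = vecs A ∩ vecs B := by
  ext y
  exact ⟨fun ⟨h, h1, h2⟩ => ⟨⟨h, h1⟩, h, h2⟩, fun ⟨⟨h, h1⟩, _, h2⟩ => ⟨h, h1, h2⟩⟩

theorem mem_vecs_compl {A : Set (ℙ F (Fin 4 → F))} {y : Fin 4 → F} (hy : y ≠ 0) :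
    y ∈ vecs Aᶜ ↔ y ∉ vecs A := by
  rw [mem_vecs hy, mem_vecs hy, Set.mem_compl_iff]

theorem gamma_card_subset_tangent (hF : 3 ≤ Nat.card F) (h3 : Nat.card F % 3 = 0)
    {y : Fin 4 → F} (h : y ∈ vecs (gammaPoints F (Nat.card F + 1))) :
    y ∈ vecs (tangentPoints F) := by
  rw [tangentPoints_eq_union hF h3, vecs_union]
  exact Or.inl h

/-- Within the invariant union, the `(q+1)_Γ`-points are exactly the isolated points. -/
theorem isInvariant_gamma_card (hF : 5 ≤ Nat.card F) (h3 : Nat.card F % 3 = 0) :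
    IsInvariant (gammaPoints F (Nat.card F + 1)) := by
  have h := (isInvariant_union hF h3).inter isInvariant_isolatedPoints
  have e : gammaPoints F (Nat.card F + 1) =
      (gammaPoints F (Nat.card F + 1) ∪ icPoints F) ∩ isolatedPoints F := by
    refine set_ext_of_vecs fun y => ?_
    rw [vecs_inter, vecs_union]
    refine ⟨fun hy => ⟨Or.inl hy, mem_isolatedPoints_of_tangent (by omega)
      (gamma_card_subset_tangent (by omega) h3 hy)⟩, ?_⟩
    rintro ⟨hy | hy, hi⟩
    · exact hy
    · exact (notMem_isolatedPoints_of_imaginary hF (two_ne_zero_of_card h3) hy hi).elim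
  rw [e]
  exact h

theorem isInvariant_icPoints (hF : 5 ≤ Nat.card F) (h3 : Nat.card F % 3 = 0) :
    IsInvariant (icPoints F) := by
  have h := (isInvariant_union hF h3).inter (isInvariant_compl isInvariant_isolatedPoints)
  have e : icPoints F =
      (gammaPoints F (Nat.card F + 1) ∪ icPoints F) ∩ (isolatedPoints F)ᶜ := by
    refine set_ext_of_vecs fun y => ?_
    rw [vecs_inter, vecs_union]
    refine ⟨fun hy => ⟨Or.inr hy, (mem_vecs_compl hy.1).mpr
      (notMem_isolatedPoints_of_imaginary hF (two_ne_zero_of_card h3) hy)⟩, ?_⟩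
    rintro ⟨hy | hy, hi⟩
    · exact ((mem_vecs_compl hy.1).mp hi (mem_isolatedPoints_of_tangent (by omega)
        (gamma_card_subset_tangent (by omega) h3 hy))).elim
    · exact hy
  rw [e]
  exact h

/-- The five classes of points are orbits. -/
theorem isPointOrbit_pointClass (hF : 5 ≤ Nat.card F) (j : Fin 5) :
    IsPointOrbit (pointClass F (Nat.card F) j) := by
  have hF' : 3 ≤ Nat.card F := by omega
  have hq : (5 : ℤ) ≤ Nat.card F := by exact_mod_cast hF
  have hcub : IsPointOrbit (cubic F) :=
    isPointOrbit_of_canonical isInvariant_cubic (by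
      have := ncard_vecs_cubic (F := F)
      have : 0 < ((Nat.card F : ℤ) + 1) * (Nat.card F - 1) := by nlinarith
      omega) (cubicVec none) fun x hx => sameOrbit_cubicVec_none hF' hx
  have hpos : 0 < ((Nat.card F : ℤ) ^ 3 - Nat.card F) * (Nat.card F - 1) := by
    have : 0 < (Nat.card F : ℤ) * ((Nat.card F : ℤ) ^ 2 - 1) := by
      apply mul_pos <;> nlinarith
    apply mul_pos <;> nlinarith
  rw [pointClass]
  split_ifs with h3
  · fin_cases j
    · exact hcub
    · change IsPointOrbit (gammaPoints F (Nat.card F + 1))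
      refine isPointOrbit_of_canonical (isInvariant_gamma_card hF h3) ?_ _ fun x hx =>
        sameOrbit_of_mem_gamma_card hF' h3 (isInvariant_gamma_card hF h3) hx
      have := ncard_vecs_gamma_card hF' h3
      have : (0 : ℤ) < (Nat.card F : ℤ) ^ 2 - 1 := by nlinarith
      omega
    · change IsPointOrbit (toPoints F)
      refine isPointOrbit_of_canonical (isInvariant_toPoints hF h3) ?_ _ fun x hx =>
        sameOrbit_of_mem_toPoints hF' h3 (isInvariant_toPoints hF h3) hx
      have := ncard_vecs_toPoints hF' h3
      have : (0 : ℤ) < ((Nat.card F : ℤ) ^ 2 - 1) * (Nat.card F - 1) := by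
        apply mul_pos <;> nlinarith
      omega
    · change IsPointOrbit (rcPoints F)
      refine isPointOrbit_of_canonical (isInvariant_rcPoints hF h3) ?_ _ fun x hx =>
        sameOrbit_of_mem_rcPoints hF' h3 hx
      have := two_mul_ncard_vecs_rcPoints hF'
      have : (0 : ℤ) < ((Nat.card F : ℤ) + 1) * Nat.card F * (Nat.card F - 1) ^ 2 := by
        have : (0 : ℤ) < Nat.card F - 1 := by omega
        positivity
      omega
    · obtain ⟨n, hn⟩ := FiniteField.exists_nonsquare (F := F) (by
        have := charP_three_of_card h3
        rw [ringChar.eq F 3]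
        norm_num)
      change IsPointOrbit (icPoints F)
      refine isPointOrbit_of_canonical (isInvariant_icPoints hF h3) ?_ _ fun x hx =>
        sameOrbit_of_mem_icPoints h3 hn hx
      have := two_mul_ncard_vecs_icPoints hF'
      omega
  · have hF3 := three_ne_zero_of_card h3
    fin_cases j
    · exact hcub
    · change IsPointOrbit (tangentPoints F)
      refine isPointOrbit_of_canonical (isInvariant_tangentPoints hF h3) ?_ _ fun x hx =>
        sameOrbit_of_mem_tangentPoints hF' hF3 hx
      have := ncard_vecs_tangentPoints hF'
      have : (0 : ℤ) < ((Nat.card F : ℤ) + 1) * (Nat.card F ^ 2 - Nat.card F) := by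
        apply mul_pos <;> nlinarith
      omega
    · change IsPointOrbit (gammaPoints F 3)
      refine isPointOrbit_of_canonical (isInvariant_gammaPoints hF h3 3) ?_ _ fun x hx =>
        sameOrbit_of_mem_gamma_three hF3 hx
      have := six_mul_ncard_vecs_gamma_three hF' h3
      omega
    · change IsPointOrbit (gammaPoints F 1)
      refine isPointOrbit_of (isInvariant_gammaPoints hF h3 1) ?_ fun x hx y hy =>
        sameOrbit_of_mem_gamma_one hF h3 hx hy
      obtain h1 | h2 : Nat.card F % 3 = 1 ∨ Nat.card F % 3 = 2 := by omega
      · rw [(gamma_eq_one hF' h1).2.2]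
        have := two_mul_ncard_vecs_icPoints hF'
        omega
      · rw [(gamma_eq_two hF' h2).1]
        have := two_mul_ncard_vecs_rcPoints hF'
        have : (0 : ℤ) < ((Nat.card F : ℤ) + 1) * Nat.card F * (Nat.card F - 1) ^ 2 := by
          have : (0 : ℤ) < Nat.card F - 1 := by omega
          positivity
        omega
    · change IsPointOrbit (gammaPoints F 0)
      refine isPointOrbit_of (isInvariant_gammaPoints hF h3 0) ?_ fun x hx y hy =>
        sameOrbit_of_mem_gamma_zero hF3 hx hy
      have := three_mul_ncard_vecs_gamma_zero hF' h3
      omega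

end Isolated

/-! ### Linear combinations of the points of the cubic -/

section Weights

variable {F : Type*} [Field F] [Fintype F] [DecidableEq F]

/-- The number of ways to write `y` as a combination of exactly `w` of the points of the cubic. -/
noncomputable def combinationCount (w : ℕ) (y : Fin 4 → F) : ℕ :=
  {z : Option F → F | ∑ s, z s • cubicVec s = y ∧ hammingNorm z = w}.ncard

/-- The least number of points of the cubic that span a space containing `y`. -/
noncomputable def combinationWeight (y : Fin 4 → F) : ℕ :=
  sInf {w : ℕ | ∃ z : Option F → F, ∑ s, z s • cubicVec s = y ∧ hammingNorm z = w}

theorem combinationWeight_le {y : Fin 4 → F} {z : Option F → F}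
    (hz : ∑ s, z s • cubicVec s = y) : combinationWeight y ≤ hammingNorm z :=
  Nat.sInf_le ⟨z, hz, rfl⟩

theorem exists_combination (hF : 3 ≤ Nat.card F) (y : Fin 4 → F) :
    ∃ z : Option F → F, ∑ s, z s • cubicVec s = y := by
  obtain ⟨S, -, hS⟩ := Finset.exists_subset_card_eq (s := (Finset.univ : Finset (Option F)))
    (n := 4) (by rw [Finset.card_univ, card_option_eq]; omega)
  obtain ⟨z, -, hz⟩ := exists_sum_eq hF S hS y
  exact ⟨z, hz⟩

theorem exists_hammingNorm_eq (hF : 3 ≤ Nat.card F) (y : Fin 4 → F) :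
    ∃ z : Option F → F, ∑ s, z s • cubicVec s = y ∧ hammingNorm z = combinationWeight y := by
  obtain ⟨z, hz⟩ := exists_combination hF y
  exact Nat.sInf_mem (s := {w : ℕ | ∃ z : Option F → F, ∑ s, z s • cubicVec s = y ∧
    hammingNorm z = w}) ⟨_, z, hz, rfl⟩

theorem combination_mem_span (z : Option F → F) :
    ∑ s, z s • cubicVec s ∈
      Submodule.span F (cubicVec '' ((Finset.univ.filter fun i => z i ≠ 0 :
        Finset (Option F)) : Set (Option F))) := by
  rw [mem_span_cubicVec_iff]
  exact ⟨z, fun i hi => by simpa using hi, rfl⟩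

theorem onCone_of_hammingNorm_le_one {z : Option F → F} (h : hammingNorm z ≤ 1) :
    OnCone (∑ s, z s • cubicVec s) := by
  obtain ⟨a, ha⟩ := Finset.card_le_one_iff_subset_singleton.mp h
  refine ⟨a, z a, Finset.sum_eq_single a (fun b _ hb => ?_) (by simp)⟩
  by_contra hne
  have : z b ≠ 0 := fun h0 => hne (by rw [h0, zero_smul])
  exact hb (Finset.mem_singleton.mp (ha (by simpa using this)))

theorem exists_rel_of_hammingNorm_eq_two (hF : 3 ≤ Nat.card F) {z : Option F → F}
    (h : hammingNorm z = 2) : ∃ s t, s ≠ t ∧ ∀ u, Rel (∑ s, z s • cubicVec s) s t u := by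
  obtain ⟨s, t, hst, hS⟩ := Finset.card_eq_two.mp h
  refine ⟨s, t, hst, (mem_span_pair_iff_rel hF hst _).mp ?_⟩
  have := combination_mem_span z
  rwa [hS] at this

theorem combinationWeight_eq_zero_iff (hF : 3 ≤ Nat.card F) {y : Fin 4 → F} :
    combinationWeight y = 0 ↔ y = 0 := by
  constructor
  · intro h
    obtain ⟨z, hz, hw⟩ := exists_hammingNorm_eq hF y
    rw [h, hammingNorm_eq_zero] at hw
    rw [← hz, hw]
    simp
  · rintro rfl
    have := combinationWeight_le (y := (0 : Fin 4 → F)) (z := 0) (by simp)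
    simpa using this

theorem combinationWeight_of_onCone (hF : 3 ≤ Nat.card F) {y : Fin 4 → F} (hy : y ≠ 0)
    (h : OnCone y) : combinationWeight y = 1 := by
  have h0 := mt (combinationWeight_eq_zero_iff hF).mp hy
  obtain ⟨s, c, rfl⟩ := h
  have h1 := combinationWeight_le (y := c • cubicVec s) (z := Pi.single s c) (by
    rw [Finset.sum_eq_single s (fun b _ hb => by rw [Pi.single_eq_of_ne hb, zero_smul])
      (by simp), Pi.single_eq_same])
  have h2 : hammingNorm (Pi.single s c : Option F → F) ≤ 1 := by
    refine Finset.card_le_one_iff_subset_singleton.mpr ⟨s, fun b hb => ?_⟩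
    rw [Finset.mem_singleton]
    by_contra hne
    simp [Pi.single_eq_of_ne hne] at hb
  omega

theorem two_le_combinationWeight (hF : 3 ≤ Nat.card F) {y : Fin 4 → F} (hy : ¬ OnCone y) :
    2 ≤ combinationWeight y := by
  obtain ⟨z, hz, hw⟩ := exists_hammingNorm_eq hF y
  by_contra h
  exact hy (hz ▸ onCone_of_hammingNorm_le_one (z := z) (by omega))

theorem combinationWeight_of_chord (hF : 3 ≤ Nat.card F) {y : Fin 4 → F} (hy : ¬ OnCone y)
    (h : ∃ s t, s ≠ t ∧ ∀ u, Rel y s t u) : combinationWeight y = 2 := by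
  refine le_antisymm ?_ (two_le_combinationWeight hF hy)
  obtain ⟨s, t, hst, h⟩ := h
  rw [← mem_span_pair_iff_rel hF hst, mem_span_cubicVec_iff] at h
  obtain ⟨z, hz, hzy⟩ := h
  refine (combinationWeight_le hzy).trans ((Finset.card_le_card (t := {s, t}) fun i hi => ?_).trans
    Finset.card_le_two)
  by_contra hne
  simp [hz i hne] at hi

theorem combinationCount_eq (hF : 3 ≤ Nat.card F) {y : Fin 4 → F} (hy : ¬ OnCone y) :
    6 * (combinationCount 3 y : ℤ) = (Nat.card F : ℤ) ^ 2 - Nat.card F - 2 + signature y -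
      3 * (Nat.card F - 1) * chordNum y := by
  rw [combinationCount, six_mul_ncard_weight_three hF hy, signature]
  ring

/-- Weight 2 would put `y` on a real chord. Weight at most 3 follows from the count itself: without
chords, `6 B_3 ≥ q^2 - 3q - 2`, which is positive for `q ≥ 5`. -/
theorem combinationWeight_of_chordNum_eq_zero (hF : 5 ≤ Nat.card F) {y : Fin 4 → F}
    (hy : ¬ OnCone y) (h : chordNum y = 0) : combinationWeight y = 3 := by
  have hF' : 3 ≤ Nat.card F := by omega
  have hq : (5 : ℤ) ≤ Nat.card F := by exact_mod_cast hF
  have h2 := two_le_combinationWeight hF' hy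
  have hne : combinationWeight y ≠ 2 := by
    intro hw
    obtain ⟨z, rfl, hz⟩ := exists_hammingNorm_eq hF' y
    rw [hw] at hz
    have := (values_of_chord hy (exists_rel_of_hammingNorm_eq_two hF' hz)).2
    omega
  have htan : tanNum y ≤ 1 := by
    by_cases ht : ∃ s, ∀ u, Rel y s s u
    · exact (values_of_tangent hy ht).1.le
    · push Not at ht
      rw [tanNum, Finset.sum_eq_zero fun s _ => if_neg (by simpa using ht s)]
      norm_num
  have hc := combinationCount_eq hF' hy
  have hpos : 0 < combinationCount 3 y := by
    rw [signature, h] at hc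
    have := oscNum_nonneg y
    have : 0 < 6 * (combinationCount 3 y : ℤ) := by nlinarith
    omega
  obtain ⟨z, hz, h3⟩ := (Set.ncard_pos (Set.toFinite _)).mp hpos
  have := combinationWeight_le hz
  omega

end Weights

/-! ### The codes of the cubic and their cosets -/

section Codes

variable {F : Type*} [Field F] [Fintype F] [DecidableEq F] {n : ℕ} (e : Fin n ≃ Option F)
  (v : Fin n → Fˣ)

/-- The coefficients of a word, rescaled and indexed by the parameters of the columns. -/
def coefficients : (Fin n → F) ≃ (Option F → F) where
  toFun x s := v (e.symm s) * x (e.symm s)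
  invFun z i := ((v i)⁻¹ : Fˣ) * z (e i)
  left_inv x := by ext i; simp
  right_inv z := by ext s; simp

theorem mulVecLin_cubicParityCheck (x : Fin n → F) :
    (cubicParityCheck e v).mulVecLin x = ∑ s, coefficients e v x s • cubicVec s := by
  ext i
  rw [Matrix.mulVecLin_apply, Matrix.mulVec, dotProduct, Finset.sum_apply, ← e.sum_comp]
  refine Finset.sum_congr rfl fun j _ => ?_
  simp only [cubicParityCheck, Matrix.of_apply, coefficients, Equiv.coe_fn_mk, Pi.smul_apply,
    smul_eq_mul, Equiv.symm_apply_apply]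
  ring

theorem hammingNorm_coefficients (x : Fin n → F) :
    hammingNorm (coefficients e v x) = hammingNorm x := by
  rw [hammingNorm, hammingNorm]
  refine Finset.card_equiv e.symm fun s => ?_
  simp [coefficients]

theorem syndrome_mkQ {m : ℕ} (H : Matrix (Fin m) (Fin n) F) (x : Fin n → F) :
    syndrome H ((codeOf H).mkQ x) = H.mulVecLin x := rfl

theorem mkQ_eq_iff {m : ℕ} (H : Matrix (Fin m) (Fin n) F) (x : Fin n → F)
    (V : (Fin n → F) ⧸ codeOf H) :
    (codeOf H).mkQ x = V ↔ H.mulVecLin x = syndrome H V := by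
  obtain ⟨y, rfl⟩ := (codeOf H).mkQ_surjective V
  rw [syndrome_mkQ, Submodule.mkQ_apply, Submodule.mkQ_apply, Submodule.Quotient.eq, codeOf,
    LinearMap.mem_ker, map_sub, sub_eq_zero]

theorem syndrome_injective {m : ℕ} (H : Matrix (Fin m) (Fin n) F) :
    Function.Injective (syndrome H) := by
  intro V W h
  obtain ⟨x, rfl⟩ := (codeOf H).mkQ_surjective V
  rw [mkQ_eq_iff, ← h, syndrome_mkQ]

theorem syndrome_zero {m : ℕ} (H : Matrix (Fin m) (Fin n) F) :
    syndrome H (0 : (Fin n → F) ⧸ codeOf H) = 0 := map_zero _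

theorem mulVecLin_surjective (hF : 3 ≤ Nat.card F) :
    Function.Surjective (cubicParityCheck e v).mulVecLin := by
  intro y
  obtain ⟨z, hz⟩ := exists_combination hF y
  refine ⟨(coefficients e v).symm z, ?_⟩
  rw [mulVecLin_cubicParityCheck, Equiv.apply_symm_apply, hz]

theorem syndrome_bijective (hF : 3 ≤ Nat.card F) :
    Function.Bijective (syndrome (cubicParityCheck e v)) := by
  refine ⟨syndrome_injective _, fun y => ?_⟩
  obtain ⟨x, hx⟩ := mulVecLin_surjective e v hF y
  exact ⟨(codeOf (cubicParityCheck e v)).mkQ x, (syndrome_mkQ _ x).trans hx⟩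

/-- Rescaling and relabelling the coordinates preserve the Hamming weight, so the order of the
columns and the multipliers play no role. -/
theorem weightCount_eq (w : ℕ) (V : (Fin n → F) ⧸ codeOf (cubicParityCheck e v)) :
    weightCount w V = combinationCount w (syndrome (cubicParityCheck e v) V) := by
  rw [weightCount, combinationCount, ← Set.ncard_image_of_injective _ (coefficients e v).injective]
  congr 1
  ext z
  rw [(coefficients e v).image_eq_preimage_symm]
  simp only [Set.mem_preimage, Set.mem_ofPred_eq, mkQ_eq_iff, mulVecLin_cubicParityCheck]
  rw [← hammingNorm_coefficients e v, Equiv.apply_symm_apply]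

theorem cosetWeight_eq (V : (Fin n → F) ⧸ codeOf (cubicParityCheck e v)) :
    cosetWeight V = combinationWeight (syndrome (cubicParityCheck e v) V) := by
  rw [cosetWeight, combinationWeight]
  congr 1
  ext w
  simp only [Set.mem_ofPred_eq, mkQ_eq_iff, mulVecLin_cubicParityCheck]
  rw [(coefficients e v).surjective.exists]
  simp only [hammingNorm_coefficients]

theorem mem_cosetsOver_iff {H : Matrix (Fin 4) (Fin n) F} {S : Set (ℙ F (Fin 4 → F))}
    {V : (Fin n → F) ⧸ codeOf H} : V ∈ cosetsOver H S ↔ syndrome H V ∈ vecs S := Iff.rfl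

/-- The syndrome map is a bijection from cosets to vectors. -/
theorem ncard_cosetsOver (hF : 3 ≤ Nat.card F) (S : Set (ℙ F (Fin 4 → F))) :
    (cosetsOver (cubicParityCheck e v) S).ncard = (vecs S).ncard := by
  rw [← Set.ncard_image_of_injective _ (syndrome_injective (cubicParityCheck e v))]
  congr 1
  exact Set.image_preimage_eq (vecs S) (syndrome_bijective e v hF).2

theorem finrank_codeOf (hF : 3 ≤ Nat.card F) :
    Module.finrank F (codeOf (cubicParityCheck e v)) = n - 4 := by
  have h := (cubicParityCheck e v).mulVecLin.finrank_range_add_finrank_ker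
  rw [LinearMap.range_eq_top.mpr (mulVecLin_surjective e v hF), finrank_top,
    Module.finrank_fin_fun, Module.finrank_fin_fun] at h
  rw [codeOf]
  omega

/-- No four columns are dependent, while expressing `P(∞)` through four other points gives a nonzero
codeword of weight at most 5. -/
theorem isMinDist_codeOf (hF : 5 ≤ Nat.card F) : IsMinDist (codeOf (cubicParityCheck e v)) 5 := by
  have hF' : 3 ≤ Nat.card F := by omega
  have hlow : ∀ c ∈ codeOf (cubicParityCheck e v), c ≠ 0 → 5 ≤ hammingNorm c := by
    intro c hc hc0
    by_contra hlt
    rw [codeOf, LinearMap.mem_ker, mulVecLin_cubicParityCheck] at hc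
    have h0 := eq_zero_of_sum_smul_cubicVec hF' hc (by rw [hammingNorm_coefficients]; omega)
    rw [← hammingNorm_eq_zero, hammingNorm_coefficients, hammingNorm_eq_zero] at h0
    exact hc0 h0
  refine ⟨?_, fun w ⟨c, hc, hc0, hw⟩ => hw ▸ hlow c hc hc0⟩
  obtain ⟨S, hS1, hS⟩ := Finset.exists_subset_card_eq
    (s := (Finset.univ.erase none : Finset (Option F)))
    (n := 4) (by rw [Finset.card_erase_of_mem (Finset.mem_univ _), Finset.card_univ,
      card_option_eq]; omega)
  have hS0 : none ∉ S := fun h => by simpa using hS1 h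
  obtain ⟨z, hz, hsum⟩ := exists_sum_eq hF' S hS (cubicVec none)
  set z' : Option F → F := z - Pi.single none 1 with hz'
  have hsum' : ∑ s, z' s • cubicVec s = 0 := by
    simp only [hz', Pi.sub_apply, sub_smul, Finset.sum_sub_distrib, hsum]
    rw [Finset.sum_eq_single none (fun b _ hb => by rw [Pi.single_eq_of_ne hb, zero_smul])
      (by simp), Pi.single_eq_same, one_smul, sub_self]
  have hn : z' none ≠ 0 := by simp [hz', hz none hS0]
  have hle : hammingNorm z' ≤ 5 := by
    have : (insert none S).card = 5 := by rw [Finset.card_insert_of_notMem hS0, hS]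
    rw [← this]
    refine Finset.card_le_card fun i hi => ?_
    by_contra hne
    rw [Finset.mem_insert, not_or] at hne
    simp [hz', hz i hne.2, Pi.single_eq_of_ne hne.1] at hi
  obtain ⟨c, hc⟩ := (coefficients e v).surjective z'
  have hcm : c ∈ codeOf (cubicParityCheck e v) := by
    rw [codeOf, LinearMap.mem_ker, mulVecLin_cubicParityCheck, hc, hsum']
  have hc0 : c ≠ 0 := by
    rintro rfl
    apply hn
    rw [← hc]
    simp [coefficients]
  refine ⟨c, hcm, hc0, le_antisymm ?_ (hlow c hcm hc0)⟩
  rw [← hammingNorm_coefficients e v, hc]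
  exact hle

/-- The tangent points attain weight 3. For the upper bound, a vector off the cubic has weight 2 if
it is on a real chord and 3 otherwise. -/
theorem isCoveringRadius_codeOf (hF : 5 ≤ Nat.card F) :
    IsCoveringRadius (codeOf (cubicParityCheck e v)) 3 := by
  have hF' : 3 ≤ Nat.card F := by omega
  have hq : (5 : ℤ) ≤ Nat.card F := by exact_mod_cast hF
  constructor
  · have hpos : 0 < (vecs (tangentPoints F)).ncard := by
      have := ncard_vecs_tangentPoints hF'
      have : (0 : ℤ) < ((Nat.card F : ℤ) + 1) * (Nat.card F ^ 2 - Nat.card F) := by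
        apply mul_pos <;> nlinarith
      omega
    obtain ⟨y, hy⟩ := (Set.ncard_pos (Set.toFinite _)).mp hpos
    obtain ⟨V, rfl⟩ := (syndrome_bijective e v hF').2 y
    refine ⟨V, ?_⟩
    simp only
    rw [cosetWeight_eq]
    exact combinationWeight_of_chordNum_eq_zero hF (mem_vecs_tangentPoints.mp hy).1
      (values_of_mem_tangentPoints hy).2
  · rintro _ ⟨V, rfl⟩
    simp only
    rw [cosetWeight_eq]
    generalize syndrome (cubicParityCheck e v) V = y
    by_cases hc : OnCone y
    · by_cases h0 : y = 0
      · rw [(combinationWeight_eq_zero_iff hF').mpr h0]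
        norm_num
      · rw [combinationWeight_of_onCone hF' h0 hc]
        norm_num
    · by_cases hd : ∃ s t, s ≠ t ∧ ∀ u, Rel y s t u
      · rw [combinationWeight_of_chord hF' hc hd]
        norm_num
      · refine (combinationWeight_of_chordNum_eq_zero hF hc ?_).le
        rw [chordNum]
        refine Finset.sum_eq_zero fun s _ => Finset.sum_eq_zero fun t _ => if_neg fun h => ?_
        exact hd ⟨s, t, h⟩

theorem setOf_cosetWeight_eq_zero (hF : 3 ≤ Nat.card F) :
    {V : (Fin n → F) ⧸ codeOf (cubicParityCheck e v) | cosetWeight V = 0} = {0} := by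
  ext V
  rw [Set.mem_ofPred_eq, cosetWeight_eq, combinationWeight_eq_zero_iff hF, Set.mem_singleton_iff,
    ← syndrome_zero, (syndrome_injective _).eq_iff]

theorem weightCount_zero (hF : 3 ≤ Nat.card F) :
    weightCount 3 (0 : (Fin n → F) ⧸ codeOf (cubicParityCheck e v)) = 0 := by
  rw [weightCount_eq, syndrome_zero]
  exact ncard_weight_three_of_onCone hF ⟨none, 0, (zero_smul _ _).symm⟩

theorem tableRow_cubic (hF : 3 ≤ Nat.card F) :
    TableRow (cubicParityCheck e v) (cubic F) 1 0
      (((Nat.card F : ℚ) + 1) * (Nat.card F - 1)) := by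
  refine ⟨?_, fun V hV => ?_⟩
  · rw [ncard_cosetsOver e v hF]
    exact_mod_cast ncard_vecs_cubic (F := F)
  · obtain ⟨h0, hc⟩ := mem_vecs_cubic.mp (mem_cosetsOver_iff.mp hV)
    rw [cosetWeight_eq, weightCount_eq, combinationWeight_of_onCone hF h0 hc, combinationCount,
      ncard_weight_three_of_onCone hF hc]
    simp

/-- Here `6 r = q^2 - q - 2 + m`, and the single chord through the point removes `q - 1` planes, so
everything depends only on the common signature `m`. -/
theorem tableRow_of_chord (hF : 3 ≤ Nat.card F) {S : Set (ℙ F (Fin 4 → F))} {m : ℤ} {B N : ℚ}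
    (hS : ∀ y ∈ vecs S, y ∈ vecs (rcPoints F) ∧ signature y = m)
    (hN : ((vecs S).ncard : ℚ) = N)
    (hB : (Nat.card F : ℚ) ^ 2 - Nat.card F - 2 + m - 6 * (Nat.card F - 1) = 6 * B) :
    TableRow (cubicParityCheck e v) S 2 B N ∧
      PlaneColumn (cubicParityCheck e v) S ((Nat.card F : ℚ) - 1) := by
  have key : ∀ y ∈ vecs S, (combinationCount 3 y : ℚ) = B := by
    intro y hy
    obtain ⟨hr, hm⟩ := hS y hy
    have h := combinationCount_eq hF ((mem_vecs_rcPoints hF).mp hr).1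
    rw [hm, (values_of_mem_rcPoints hF hr).2] at h
    have h' : 6 * (combinationCount 3 y : ℚ) = (Nat.card F : ℚ) ^ 2 - Nat.card F - 2 + m -
      3 * (Nat.card F - 1) * 2 := by exact_mod_cast h
    linarith
  refine ⟨⟨by rw [ncard_cosetsOver e v hF, hN], fun V hV => ?_⟩, fun P hP V hV => ?_⟩
  · rw [cosetWeight_eq, weightCount_eq]
    refine ⟨?_, key _ hV⟩
    obtain ⟨hc, hd⟩ := (mem_vecs_rcPoints hF).mp (hS _ hV).1
    exact combinationWeight_of_chord hF hc hd
  · obtain ⟨h0, rfl⟩ := hV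
    have hV : syndrome (cubicParityCheck e v) V ∈ vecs S := ⟨h0, hP⟩
    rw [weightCount_eq, key _ hV]
    obtain ⟨hr, hm⟩ := hS _ hV
    have h := six_mul_threePlaneCount hF h0
    have h' : 6 * (threePlaneCount (Projectivization.mk F _ h0) : ℤ) =
      (Nat.card F : ℤ) ^ 2 - Nat.card F - 2 + m := by rw [h, ← hm, signature]; ring
    have h'' : 6 * (threePlaneCount (Projectivization.mk F _ h0) : ℚ) =
      (Nat.card F : ℚ) ^ 2 - Nat.card F - 2 + m := by exact_mod_cast h'
    linarith

/-- With no chord to discard, every three-point plane through the point yields a vector of weight 3,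
so `B_3 = r`. -/
theorem tableRow_of_no_chord (hF : 5 ≤ Nat.card F) {S : Set (ℙ F (Fin 4 → F))} {m : ℤ} {B N : ℚ}
    (hS : ∀ y ∈ vecs S, ¬ OnCone y ∧ chordNum y = 0 ∧ signature y = m)
    (hN : ((vecs S).ncard : ℚ) = N)
    (hB : (Nat.card F : ℚ) ^ 2 - Nat.card F - 2 + m = 6 * B) :
    TableRow (cubicParityCheck e v) S 3 B N ∧ PlaneColumn (cubicParityCheck e v) S 0 := by
  have hF' : 3 ≤ Nat.card F := by omega
  have key : ∀ y ∈ vecs S, (combinationCount 3 y : ℚ) = B := by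
    intro y hy
    obtain ⟨hc, h0, hm⟩ := hS y hy
    have h := combinationCount_eq hF' hc
    rw [hm, h0] at h
    have h' : 6 * (combinationCount 3 y : ℚ) = (Nat.card F : ℚ) ^ 2 - Nat.card F - 2 + m -
      3 * (Nat.card F - 1) * 0 := by exact_mod_cast h
    linarith
  refine ⟨⟨by rw [ncard_cosetsOver e v hF', hN], fun V hV => ?_⟩, fun P hP V hV => ?_⟩
  · rw [cosetWeight_eq, weightCount_eq]
    obtain ⟨hc, h0, -⟩ := hS _ hV
    exact ⟨combinationWeight_of_chordNum_eq_zero hF hc h0, key _ hV⟩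
  · obtain ⟨h0, rfl⟩ := hV
    have hV : syndrome (cubicParityCheck e v) V ∈ vecs S := ⟨h0, hP⟩
    rw [weightCount_eq, key _ hV]
    obtain ⟨-, -, hm⟩ := hS _ hV
    have h := six_mul_threePlaneCount hF' h0
    have h' : 6 * (threePlaneCount (Projectivization.mk F _ h0) : ℤ) =
      (Nat.card F : ℤ) ^ 2 - Nat.card F - 2 + m := by rw [h, ← hm, signature]; ring
    have h'' : 6 * (threePlaneCount (Projectivization.mk F _ h0) : ℚ) =
      (Nat.card F : ℚ) ^ 2 - Nat.card F - 2 + m := by exact_mod_cast h'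
    linarith

end Codes

/-! ### The classification of points and cosets -/

section Classification

variable {F : Type*} [Field F] [Fintype F] [DecidableEq F]

theorem existsUnique_fin_five {p : Fin 5 → Prop}
    (h : (p 0 ∧ ¬ p 1 ∧ ¬ p 2 ∧ ¬ p 3 ∧ ¬ p 4) ∨ (¬ p 0 ∧ p 1 ∧ ¬ p 2 ∧ ¬ p 3 ∧ ¬ p 4) ∨
      (¬ p 0 ∧ ¬ p 1 ∧ p 2 ∧ ¬ p 3 ∧ ¬ p 4) ∨ (¬ p 0 ∧ ¬ p 1 ∧ ¬ p 2 ∧ p 3 ∧ ¬ p 4) ∨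
      (¬ p 0 ∧ ¬ p 1 ∧ ¬ p 2 ∧ ¬ p 3 ∧ p 4)) : ∃! j, p j := by
  rcases h with h | h | h | h | h
  · exact ⟨0, h.1, fun j hj => by fin_cases j <;> simp_all⟩
  · exact ⟨1, h.2.1, fun j hj => by fin_cases j <;> simp_all⟩
  · exact ⟨2, h.2.2.1, fun j hj => by fin_cases j <;> simp_all⟩
  · exact ⟨3, h.2.2.2.1, fun j hj => by fin_cases j <;> simp_all⟩
  · exact ⟨4, h.2.2.2.2, fun j hj => by fin_cases j <;> simp_all⟩

theorem existsUnique_mem_vecs_pointClass (hF : 3 ≤ Nat.card F) {y : Fin 4 → F} (hy : y ≠ 0) :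
    ∃! j, y ∈ vecs (pointClass F (Nat.card F) j) := by
  by_cases h3 : Nat.card F % 3 = 0
  · rw [pointClass, if_pos h3]
    refine existsUnique_fin_five ?_
    simp only [Matrix.cons_val]
    by_cases hc : OnCone y
    · have h1 : y ∈ vecs (cubic F) := mem_vecs_cubic.mpr ⟨hy, hc⟩
      have h2 : y ∉ vecs (tangentPoints F) := fun h => (mem_vecs_tangentPoints.mp h).1 hc
      have h4 : y ∉ vecs (rcPoints F) := fun h => ((mem_vecs_rcPoints hF).mp h).1 hc
      have h5 : y ∉ vecs (icPoints F) :=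
        fun h => not_onCone_of_imaginary (mem_vecs_icPoints.mp h) hc
      exact Or.inl ⟨h1, mem_vecs_iff_of_onCone hc _, fun h => h2 (mem_vecs_toPoints.mp h).1, h4, h5⟩
    · have h1 : y ∉ vecs (cubic F) := fun h => hc (mem_vecs_cubic.mp h).2
      rcases signature_cases_zero hF h3 hc with ⟨k1, k2, k3, k4, -⟩ | ⟨k1, k2, k3, k4, -⟩ |
        ⟨k1, k2, k3, k4, -⟩ | ⟨k1, k2, k3, k4, -⟩
      · exact Or.inr (Or.inl ⟨h1, k1, k2, k3, k4⟩)
      · exact Or.inr (Or.inr (Or.inl ⟨h1, k1, k2, k3, k4⟩))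
      · exact Or.inr (Or.inr (Or.inr (Or.inl ⟨h1, k1, k2, k3, k4⟩)))
      · exact Or.inr (Or.inr (Or.inr (Or.inr ⟨h1, k1, k2, k3, k4⟩)))
  · rw [pointClass, if_neg h3]
    refine existsUnique_fin_five ?_
    simp only [Matrix.cons_val]
    by_cases hc : OnCone y
    · have h1 : y ∈ vecs (cubic F) := mem_vecs_cubic.mpr ⟨hy, hc⟩
      have h2 : y ∉ vecs (tangentPoints F) := fun h => (mem_vecs_tangentPoints.mp h).1 hc
      exact Or.inl ⟨h1, h2, mem_vecs_iff_of_onCone hc _, mem_vecs_iff_of_onCone hc _,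
        mem_vecs_iff_of_onCone hc _⟩
    · have h1 : y ∉ vecs (cubic F) := fun h => hc (mem_vecs_cubic.mp h).2
      simp only [mem_vecs_gammaPoints, hc, h1, not_false_eq_true, true_and, false_and, false_or]
      obtain h | h : Nat.card F % 3 = 1 ∨ Nat.card F % 3 = 2 := by omega
      · rcases signature_cases_one hF h hc with ⟨k1, k2, -⟩ | ⟨k1, k2, -⟩ | ⟨k1, k2, -⟩ |
          ⟨k1, k2, -⟩ <;> simp [k1, k2]
      · rcases signature_cases_two hF h hc with ⟨k1, k2, -⟩ | ⟨k1, k2, -⟩ | ⟨k1, k2, -⟩ |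
          ⟨k1, k2, -⟩ <;> simp [k1, k2]

theorem existsUnique_mem_pointClass (hF : 3 ≤ Nat.card F) (P : ℙ F (Fin 4 → F)) :
    ∃! j, P ∈ pointClass F (Nat.card F) j := by
  induction P using Projectivization.ind with
  | h y hy =>
    simp only [← mem_vecs hy]
    exact existsUnique_mem_vecs_pointClass hF hy

theorem signature_of_mem_gamma {y : Fin 4 → F} {m : ℕ}
    (h : y ∈ vecs (gammaPoints F m)) :
    signature y = 2 * m + Nat.card F * (chordNum y - 2 * tanNum y) := by
  rw [signature, (mem_vecs_gammaPoints.mp h).2]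

variable {n : ℕ} (e : Fin n ≃ Option F) (v : Fin n → Fˣ)

theorem tableRow_gamma_of_chord (hF : 3 ≤ Nat.card F) {m : ℕ} {B N : ℚ}
    (hS : gammaPoints F m ⊆ rcPoints F) (hN : ((vecs (gammaPoints F m)).ncard : ℚ) = N)
    (hB : (Nat.card F : ℚ) ^ 2 - 5 * Nat.card F + 4 + 2 * m = 6 * B) :
    TableRow (cubicParityCheck e v) (gammaPoints F m) 2 B N ∧
      PlaneColumn (cubicParityCheck e v) (gammaPoints F m) ((Nat.card F : ℚ) - 1) := by
  refine tableRow_of_chord e v hF (m := 2 * m + 2 * Nat.card F) (fun y hy => ?_) hN ?_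
  · have hr : y ∈ vecs (rcPoints F) := ⟨hy.1, hS hy.2⟩
    obtain ⟨e1, e2⟩ := values_of_mem_rcPoints hF hr
    exact ⟨hr, by rw [signature_of_mem_gamma hy, e1, e2]; ring⟩
  · push_cast
    linear_combination hB

theorem tableRow_gamma_of_imaginary (hF : 5 ≤ Nat.card F) {m : ℕ} {B N : ℚ}
    (hS : gammaPoints F m ⊆ icPoints F) (hN : ((vecs (gammaPoints F m)).ncard : ℚ) = N)
    (hB : (Nat.card F : ℚ) ^ 2 - Nat.card F - 2 + 2 * m = 6 * B) :
    TableRow (cubicParityCheck e v) (gammaPoints F m) 3 B N ∧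
      PlaneColumn (cubicParityCheck e v) (gammaPoints F m) 0 := by
  refine tableRow_of_no_chord e v hF (m := 2 * m) (fun y hy => ?_) hN (by exact_mod_cast hB)
  have hr : y ∈ vecs (icPoints F) := ⟨hy.1, hS hy.2⟩
  obtain ⟨e1, e2⟩ := values_of_mem_icPoints hr
  exact ⟨(mem_vecs_gammaPoints.mp hy).1, e2, by
    rw [signature_of_mem_gamma hy, e1, e2]; ring⟩

theorem tableRow_tangentPoints (hF : 5 ≤ Nat.card F) (h3 : Nat.card F % 3 ≠ 0) :
    TableRow (cubicParityCheck e v) (tangentPoints F) 3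
      (((Nat.card F : ℚ) ^ 2 - 3 * Nat.card F + 2) / 6)
      (((Nat.card F : ℚ) ^ 2 + Nat.card F) * (Nat.card F - 1)) ∧
      PlaneColumn (cubicParityCheck e v) (tangentPoints F) 0 := by
  have hF' : 3 ≤ Nat.card F := by omega
  refine tableRow_of_no_chord e v hF (m := 4 - 2 * Nat.card F) (fun y hy => ?_) ?_ ?_
  · obtain ⟨e1, e2⟩ := values_of_mem_tangentPoints hy
    refine ⟨(mem_vecs_tangentPoints.mp hy).1, e2, ?_⟩
    rw [signature, (oscNum_values hF' h3).1 hy, e1, e2]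
    ring
  · have h : ((vecs (tangentPoints F)).ncard : ℚ) =
      ((Nat.card F : ℚ) + 1) * (Nat.card F ^ 2 - Nat.card F) := by
      exact_mod_cast ncard_vecs_tangentPoints hF'
    rw [h]
    ring
  · push_cast
    ring

/-! ### Class sizes and rows in the form of the table -/

theorem ncard_vecs_rcPoints_rat (hF : 3 ≤ Nat.card F) : ((vecs (rcPoints F)).ncard : ℚ) =
    ((Nat.card F : ℚ) ^ 3 - Nat.card F) / 2 * (Nat.card F - 1) := by
  have h : 2 * ((vecs (rcPoints F)).ncard : ℚ) =
      ((Nat.card F : ℚ) + 1) * Nat.card F * (Nat.card F - 1) ^ 2 := by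
    exact_mod_cast two_mul_ncard_vecs_rcPoints hF
  linear_combination h / 2

theorem ncard_vecs_icPoints_rat (hF : 3 ≤ Nat.card F) : ((vecs (icPoints F)).ncard : ℚ) =
    ((Nat.card F : ℚ) ^ 3 - Nat.card F) / 2 * (Nat.card F - 1) := by
  have h : 2 * ((vecs (icPoints F)).ncard : ℚ) =
      ((Nat.card F : ℚ) ^ 3 - Nat.card F) * (Nat.card F - 1) := by
    exact_mod_cast two_mul_ncard_vecs_icPoints hF
  linear_combination h / 2

theorem ncard_vecs_gamma_three_rat (hF : 3 ≤ Nat.card F) (h3 : Nat.card F % 3 ≠ 0) :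
    ((vecs (gammaPoints F 3)).ncard : ℚ) =
      ((Nat.card F : ℚ) ^ 3 - Nat.card F) / 6 * (Nat.card F - 1) := by
  have h : 6 * ((vecs (gammaPoints F 3)).ncard : ℚ) =
      ((Nat.card F : ℚ) ^ 3 - Nat.card F) * (Nat.card F - 1) := by
    exact_mod_cast six_mul_ncard_vecs_gamma_three hF h3
  linear_combination h / 6

theorem ncard_vecs_gamma_zero_rat (hF : 3 ≤ Nat.card F) (h3 : Nat.card F % 3 ≠ 0) :
    ((vecs (gammaPoints F 0)).ncard : ℚ) =
      ((Nat.card F : ℚ) ^ 3 - Nat.card F) / 3 * (Nat.card F - 1) := by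
  have h : 3 * ((vecs (gammaPoints F 0)).ncard : ℚ) =
      ((Nat.card F : ℚ) ^ 3 - Nat.card F) * (Nat.card F - 1) := by
    exact_mod_cast three_mul_ncard_vecs_gamma_zero hF h3
  linear_combination h / 3

theorem tableRow_rcPoints_zero (hF : 3 ≤ Nat.card F) (h3 : Nat.card F % 3 = 0) :
    TableRow (cubicParityCheck e v) (rcPoints F) 2
      (((Nat.card F : ℚ) ^ 2 - 5 * Nat.card F + 6) / 6)
      (((Nat.card F : ℚ) ^ 3 - Nat.card F) / 2 * (Nat.card F - 1)) ∧
      PlaneColumn (cubicParityCheck e v) (rcPoints F) ((Nat.card F : ℚ) - 1) := by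
  refine tableRow_of_chord e v hF (m := 2 + 2 * Nat.card F) (fun y hy => ⟨hy, ?_⟩)
    (ncard_vecs_rcPoints_rat hF) ?_
  · rcases signature_cases_zero hF h3 ((mem_vecs_rcPoints hF).mp hy).1 with k | k | k | k
    · exact absurd hy k.2.2.1
    · exact absurd hy k.2.2.1
    · exact k.2.2.2.2
    · exact absurd hy k.2.2.1
  · push_cast
    ring

theorem tableRow_toPoints (hF : 5 ≤ Nat.card F) (h3 : Nat.card F % 3 = 0) :
    TableRow (cubicParityCheck e v) (toPoints F) 3
      (((Nat.card F : ℚ) ^ 2 - 3 * Nat.card F) / 6)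
      (((Nat.card F : ℚ) ^ 2 - 1) * (Nat.card F - 1)) ∧
      PlaneColumn (cubicParityCheck e v) (toPoints F) 0 := by
  have hF' : 3 ≤ Nat.card F := by omega
  refine tableRow_of_no_chord e v hF (m := 2 - 2 * Nat.card F) (fun y hy => ?_) ?_ ?_
  · obtain ⟨ht, ho⟩ := mem_vecs_toPoints.mp hy
    obtain ⟨e1, e2⟩ := values_of_mem_tangentPoints ht
    refine ⟨(mem_vecs_tangentPoints.mp ht).1, e2, ?_⟩
    rw [signature, ho, e1, e2]
    ring
  · exact_mod_cast ncard_vecs_toPoints hF' h3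
  · push_cast
    ring

theorem tableRow_gamma_card_union (hF : 5 ≤ Nat.card F) (h3 : Nat.card F % 3 = 0) :
    TableRow (cubicParityCheck e v) (gammaPoints F (Nat.card F + 1) ∪ icPoints F) 3
      (((Nat.card F : ℚ) ^ 2 - Nat.card F) / 6)
      (((Nat.card F : ℚ) + 1) * (Nat.card F ^ 2 - Nat.card F + 2) / 2 * (Nat.card F - 1)) ∧
      PlaneColumn (cubicParityCheck e v) (gammaPoints F (Nat.card F + 1) ∪ icPoints F) 0 := by
  have hF' : 3 ≤ Nat.card F := by omega
  refine tableRow_of_no_chord e v hF (m := 2) (fun y hy => ?_) ?_ ?_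
  · rw [vecs_union] at hy
    rcases hy with hy | hy
    · have hc := (mem_vecs_gammaPoints.mp hy).1
      refine ⟨hc, (values_of_mem_tangentPoints (gamma_card_subset_tangent hF' h3 hy)).2, ?_⟩
      rcases signature_cases_zero hF' h3 hc with k | k | k | k
      · exact k.2.2.2.2
      · exact absurd hy k.1
      · exact absurd hy k.1
      · exact absurd hy k.1
    · have hc := not_onCone_of_imaginary (mem_vecs_icPoints.mp hy)
      refine ⟨hc, (values_of_mem_icPoints hy).2, ?_⟩
      rcases signature_cases_zero hF' h3 hc with k | k | k | k
      · exact absurd hy k.2.2.2.1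
      · exact absurd hy k.2.2.2.1
      · exact absurd hy k.2.2.2.1
      · exact k.2.2.2.2
  · rw [ncard_vecs_union]
    · have h : ((vecs (gammaPoints F (Nat.card F + 1))).ncard : ℚ) = (Nat.card F : ℚ) ^ 2 - 1 := by
        exact_mod_cast ncard_vecs_gamma_card hF' h3
      rw [Nat.cast_add, h, ncard_vecs_icPoints_rat hF']
      ring
    · intro y hy hi
      rcases signature_cases_zero hF' h3 (mem_vecs_gammaPoints.mp hy).1 with k | k | k | k
      · exact k.2.2.2.1 hi
      · exact k.1 hy
      · exact k.1 hy
      · exact k.1 hy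
  · push_cast
    ring

end Classification

end TwistedCubic

/-! ### The classification theorem -/

open TwistedCubic in
theorem theorem3p1 {F : Type*} [Field F] [Finite F] [DecidableEq F] (q : ℕ)
    (hq : Nat.card F = q) (hq5 : 5 ≤ q) (e : Fin (q + 1) ≃ Option F) (v : Fin (q + 1) → Fˣ)
    (H : Matrix (Fin 4) (Fin (q + 1)) F) (hH : H = cubicParityCheck e v) :
    -- the code is a `[q+1, q-3, 5]_q 3` code
    (Module.finrank F (codeOf H) = q - 3 ∧ IsMinDist (codeOf H) 5 ∧
      IsCoveringRadius (codeOf H) 3) ∧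
    -- `ℳ_1, …, ℳ_5` are orbits; every point is in exactly one of them, and every coset
    -- other than the code itself is generated by exactly one of them
    (∀ j, IsPointOrbit (pointClass F q j)) ∧
    (∀ P, ∃! j, P ∈ pointClass F q j) ∧
    (∀ V : (Fin (q + 1) → F) ⧸ codeOf H, V ≠ 0 →
      ∃! j, V ∈ cosetsOver H (pointClass F q j)) ∧
    -- the code itself, the only coset of weight 0
    ({V : (Fin (q + 1) → F) ⧸ codeOf H | cosetWeight V = 0} = {0} ∧
      weightCount 3 (0 : (Fin (q + 1) → F) ⧸ codeOf H) = 0) ∧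
    -- cosets generated by the points of the cubic
    TableRow H (cubic F) 1 0 (((q : ℚ) + 1) * (q - 1)) ∧
    -- `q ≡ 1 mod 3`
    (q % 3 = 1 →
      gammaPoints F 0 = rcPoints F \ gammaPoints F 3 ∧
      gammaPoints F 3 = rcPoints F \ gammaPoints F 0 ∧
      gammaPoints F 1 = icPoints F ∧
      (TableRow H (gammaPoints F 0) 2 (((q : ℚ) ^ 2 - 5 * q + 4) / 6)
          (((q : ℚ) ^ 3 - q) / 3 * (q - 1)) ∧
        PlaneColumn H (gammaPoints F 0) ((q : ℚ) - 1)) ∧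
      (TableRow H (gammaPoints F 3) 2 (((q : ℚ) ^ 2 - 5 * q + 10) / 6)
          (((q : ℚ) ^ 3 - q) / 6 * (q - 1)) ∧
        PlaneColumn H (gammaPoints F 3) ((q : ℚ) - 1)) ∧
      (TableRow H (tangentPoints F) 3 (((q : ℚ) ^ 2 - 3 * q + 2) / 6)
          (((q : ℚ) ^ 2 + q) * (q - 1)) ∧
        PlaneColumn H (tangentPoints F) 0) ∧
      (TableRow H (icPoints F) 3 (((q : ℚ) ^ 2 - q) / 6)
          (((q : ℚ) ^ 3 - q) / 2 * (q - 1)) ∧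
        PlaneColumn H (icPoints F) 0)) ∧
    -- `q ≡ -1 mod 3`
    (q % 3 = 2 →
      gammaPoints F 1 = rcPoints F ∧
      gammaPoints F 0 = icPoints F \ gammaPoints F 3 ∧
      gammaPoints F 3 = icPoints F \ gammaPoints F 0 ∧
      (TableRow H (rcPoints F) 2 (((q : ℚ) ^ 2 - 5 * q + 6) / 6)
          (((q : ℚ) ^ 3 - q) / 2 * (q - 1)) ∧
        PlaneColumn H (rcPoints F) ((q : ℚ) - 1)) ∧
      (TableRow H (tangentPoints F) 3 (((q : ℚ) ^ 2 - 3 * q + 2) / 6)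
          (((q : ℚ) ^ 2 + q) * (q - 1)) ∧
        PlaneColumn H (tangentPoints F) 0) ∧
      (TableRow H (gammaPoints F 0) 3 (((q : ℚ) ^ 2 - q - 2) / 6)
          (((q : ℚ) ^ 3 - q) / 3 * (q - 1)) ∧
        PlaneColumn H (gammaPoints F 0) 0) ∧
      (TableRow H (gammaPoints F 3) 3 (((q : ℚ) ^ 2 - q + 4) / 6)
          (((q : ℚ) ^ 3 - q) / 6 * (q - 1)) ∧
        PlaneColumn H (gammaPoints F 3) 0)) ∧
    -- `q ≡ 0 mod 3`
    (q % 3 = 0 →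
      (TableRow H (rcPoints F) 2 (((q : ℚ) ^ 2 - 5 * q + 6) / 6)
          (((q : ℚ) ^ 3 - q) / 2 * (q - 1)) ∧
        PlaneColumn H (rcPoints F) ((q : ℚ) - 1)) ∧
      (TableRow H (toPoints F) 3 (((q : ℚ) ^ 2 - 3 * q) / 6)
          (((q : ℚ) ^ 2 - 1) * (q - 1)) ∧
        PlaneColumn H (toPoints F) 0) ∧
      (TableRow H (gammaPoints F (q + 1) ∪ icPoints F) 3 (((q : ℚ) ^ 2 - q) / 6)
          (((q : ℚ) + 1) * (q ^ 2 - q + 2) / 2 * (q - 1)) ∧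
        PlaneColumn H (gammaPoints F (q + 1) ∪ icPoints F) 0)) := by
  cases nonempty_fintype F
  subst hq hH
  have hF' : 3 ≤ Nat.card F := by omega
  refine ⟨⟨?_, isMinDist_codeOf e v hq5, isCoveringRadius_codeOf e v hq5⟩,
    isPointOrbit_pointClass hq5, existsUnique_mem_pointClass hF', fun V hV => ?_,
    ⟨setOf_cosetWeight_eq_zero e v hF', weightCount_zero e v hF'⟩, tableRow_cubic e v hF',
    fun h1 => ?_, fun h2 => ?_, fun h0 => ?_⟩
  · rw [finrank_codeOf e v hF']
    omega
  · simp only [mem_cosetsOver_iff]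
    refine existsUnique_mem_vecs_pointClass hF' fun h => hV ?_
    rwa [← syndrome_zero, (syndrome_injective _).eq_iff] at h
  · have h3 : Nat.card F % 3 ≠ 0 := by omega
    obtain ⟨g0, g3, g1⟩ := gamma_eq_one hF' h1
    refine ⟨g0, g3, g1, ?_, ?_, tableRow_tangentPoints e v hq5 h3, ?_⟩
    · refine tableRow_gamma_of_chord e v hF' (g0 ▸ Set.sdiff_subset)
        (ncard_vecs_gamma_zero_rat hF' h3) ?_
      push_cast
      ring
    · refine tableRow_gamma_of_chord e v hF' (g3 ▸ Set.sdiff_subset)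
        (ncard_vecs_gamma_three_rat hF' h3) ?_
      push_cast
      ring
    · have hN := ncard_vecs_icPoints_rat hF'
      -- The IC-points are the `1_Γ`-points for `q ≡ 1`, so the general row for `gammaPoints`
      -- applies with `m = 1`.
      rw [← g1] at hN ⊢
      refine tableRow_gamma_of_imaginary e v hq5 g1.subset hN ?_
      push_cast
      ring
  · have h3 : Nat.card F % 3 ≠ 0 := by omega
    obtain ⟨g1, g0, g3⟩ := gamma_eq_two hF' h2
    refine ⟨g1, g0, g3, ?_, tableRow_tangentPoints e v hq5 h3, ?_, ?_⟩
    · have hN := ncard_vecs_rcPoints_rat hF'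
      rw [← g1] at hN ⊢
      refine tableRow_gamma_of_chord e v hF' g1.subset hN ?_
      push_cast
      ring
    · refine tableRow_gamma_of_imaginary e v hq5 (g0 ▸ Set.sdiff_subset)
        (ncard_vecs_gamma_zero_rat hF' h3) ?_
      push_cast
      ring
    · refine tableRow_gamma_of_imaginary e v hq5 (g3 ▸ Set.sdiff_subset)
        (ncard_vecs_gamma_three_rat hF' h3) ?_
      push_cast
      ring
  · exact ⟨tableRow_rcPoints_zero e v hF' h0, tableRow_toPoints e v hq5 h0,
      tableRow_gamma_card_union e v hq5 h0⟩
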